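/- For a compact Lie group $G$ and a subgroup $T\subset G\times G$, the biquotient action of $T$ on $G$ is $(u_L,u_R)\cdot g=u_L\,g\,u_R^{-1}$. It is free if $u_L g u_R^{-1}=g$ for some $g \in G$ only for $(u_L,u_R)=(e,e)$. It is one-sided if $u_R=e$ for all $(u_L,u_R)\in T$, or $u_L=e$ for all $(u_L,u_R)\in T$. A $k$-torus in $G \times G$ is the image of an injective continuous homomorphism $(S^1)^k\to G\times G$. Two subgroups of $G\times G$ are called conjugate up to interchange if one is conjugate in $G\times G$ to the other, or to the image of the other under $(u_L,u_R)\mapsto(u_R,u_L)$ (on $G$ this is the change of variable $g\mapsto g^{-1}$). The biquotient actions of $T$ and $T'$ on $G$ are called equivalent if there are an isomorphism of topological groups $\varphi:T\to T'$ and a map $f:G\to G$ of the form $f(g)=a\,\alpha(g)$ or $f(g)=a\,\alpha(g)^{-1}$, with $a\in G$ and $\alpha$ a continuous automorphism of $G$, such that $f(u\cdot g)=\varphi(u)\cdot f(g)$ for all $u\in T$, $g\in G$. Let $Sp(n)$ be the group of quaternionic unitary $n\times n$ matrices and consider the usual embeddings $U(n)\subset Sp(n)$ and $U(n)\subset SO(2n)\subset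 SO(2n+1)$. In $U(n)\times U(n)$ let $$P_1^n=\{(\mathrm{diag}(1,\dots,1,z),\ \mathrm{diag}(w_1,\dots,w_{n-1},\bar w_1\cdots\bar w_{n-1}))\},\qquad P_2^n=\{(\mathrm{diag}(z,\dots,z),\ \mathrm{diag}(w_1,\dots,w_{n-1},1))\},$$ where $z,w_1,\dots,w_{n-1}$ run through $S^1\subset\mathbb C$. We also write $P_i^n$ for the images in $Sp(n)\times Sp(n)$, $SO(2n)\times SO(2n)$ and $SO(2n+1)\times SO(2n+1)$. **Theorem.** (1) Let $n\ge 3$. An $n$-torus $T\subset Sp(n)\times Sp(n)$ acts freely on $Sp(n)$ if and only if it is one-sided or it is conjugate up to interchange to $P_1^n$ or to $P_2^n$. (2) For $n\ge2$, the actions of $P_1^n$ and $P_2^n$ on $Sp(n)$ are equivalent if and only if $n=2$. (3) Let $S\subset U(n)\times U(n)$ be an $n$-torus. For $n\ge2$, $S$ acts freely on $Sp(n)$ if and only if it acts freely on $SO(2n+1)$. For $n\ge3$, $S$ acts freely on $Sp(n)$ if and only if it acts freely on $SO(2n)$. (4) Let $n\ge3$. An $n$-torus $T\subset SO(2n)\times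 SO(2n)$ acts freely on $SO(2n)$ if and only if it is one-sided or it is conjugate up to interchange to $P_1^n$ or to $P_2^n$, where conjugation is by elements of $O(2n)\times O(2n)$. (5) Let $n\ge3$. An $n$-torus $T\subset SO(2n+1)\times SO(2n+1)$ acts freely on $SO(2n+1)$ if and only if it is one-sided or it is conjugate up to interchange to $P_1^n$ or to $P_2^n$. -/

import Mathlib

open scoped Quaternion Matrix

/-! ### Biquotient actions -/

section Biquotient

variable {G : Type*} [Group G]

/-- The action of `(u_L, u_R)` in `G × G` on `G`, given by `x ↦ u_L * x * u_R⁻¹`. -/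
def biquotientAct (u : G × G) (x : G) : G := u.1 * x * u.2⁻¹

/-- The biquotient action of `T ≤ G × G` on `G` is free: all isotropy groups are trivial. -/
def ActsFreely (T : Subgroup (G × G)) : Prop :=
  ∀ u ∈ T, ∀ x : G, biquotientAct u x = x → u = 1

/-- `T ≤ G × G` acts only on the left, or only on the right. -/
def ActsOnOneSide (T : Subgroup (G × G)) : Prop :=
  (∀ u ∈ T, u.2 = 1) ∨ (∀ u ∈ T, u.1 = 1)

/-- `T'` is conjugate to `T` in `G × G`. -/
def IsConjSubgroup (T T' : Subgroup (G × G)) : Prop :=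
  ∃ k : G × G, T' = T.map (MulAut.conj k).toMonoidHom

/-- The subgroup `{(u_R, u_L) | (u_L, u_R) ∈ T}`. -/
def swapSides (T : Subgroup (G × G)) : Subgroup (G × G) :=
  T.map (MulEquiv.prodComm : G × G ≃* G × G).toMonoidHom

/-- `T'` is conjugate in `G × G` to `T`, possibly after interchanging the two factors. -/
def IsConjUpToSwap (T T' : Subgroup (G × G)) : Prop :=
  IsConjSubgroup T T' ∨ IsConjSubgroup (swapSides T) T'

variable [TopologicalSpace G]

/-- `T ≤ G` is a `k`-torus: the image of an injective continuous homomorphism from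
`(S¹)^k` (automatically an embedding when `G` is Hausdorff, by compactness). -/
def IsTorus (k : ℕ) (T : Subgroup G) : Prop :=
  ∃ φ : (Fin k → Circle) →* G, Continuous φ ∧ Function.Injective φ ∧ φ.range = T

/-- The maps `x ↦ a * α x` and `x ↦ a * (α x)⁻¹`, for `a ∈ G` and a continuous automorphism
`α` of `G`. They comprise all maps `x ↦ a * α (x ^ (±1)) * b`. -/
def IsAffineMap (f : G → G) : Prop :=
  ∃ (a : G) (α : G ≃ₜ* G), (∀ x, f x = a * α x) ∨ (∀ x, f x = a * (α x)⁻¹)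

/-- The biquotient actions of `T` and `T'` on `G` are equivalent: they correspond to each
other under an isomorphism `T ≃ T'` and a map of `G` composed of translations, automorphisms
and possibly the inversion. -/
def EquivalentActions (T T' : Subgroup (G × G)) : Prop :=
  ∃ f : G → G, IsAffineMap f ∧ ∃ φ : T ≃ₜ* T', ∀ (u : T) (x : G),
    f (biquotientAct (u : G × G) x) = biquotientAct (φ u : G × G) (f x)

end Biquotient

/-! ### The classical groups and their standard embeddings -/

/-- The unitary group `U(n)`. -/
abbrev UGrp (n : ℕ) : Type := Matrix.unitaryGroup (Fin n) ℂ

/-- The compact symplectic group `Sp(n)`: quaternionic `n × n` matrices `A` with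
`Aᴴ * A = A * Aᴴ = 1`. -/
abbrev SpGrp (n : ℕ) : Type := unitary (Matrix (Fin n) (Fin n) ℍ[ℝ])

/-- `O(2n)`, with rows and columns indexed by two copies of `{1, …, n}`. -/
abbrev OEvenGrp (n : ℕ) : Type := Matrix.orthogonalGroup (Fin n ⊕ Fin n) ℝ

/-- `SO(2n)`. -/
abbrev SOEvenGrp (n : ℕ) : Type := Matrix.specialOrthogonalGroup (Fin n ⊕ Fin n) ℝ

/-- `SO(2n+1)`. -/
abbrev SOOddGrp (n : ℕ) : Type :=
  Matrix.specialOrthogonalGroup ((Fin n ⊕ Fin n) ⊕ Unit) ℝ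

/-- Complex matrices viewed as quaternionic matrices. -/
noncomputable def quatMatrix (n : ℕ) :
    Matrix (Fin n) (Fin n) ℂ →* Matrix (Fin n) (Fin n) ℍ[ℝ] :=
  ((Quaternion.ofComplex : ℂ →ₐ[ℝ] ℍ[ℝ]).toRingHom.mapMatrix :
    Matrix (Fin n) (Fin n) ℂ →+* Matrix (Fin n) (Fin n) ℍ[ℝ])

theorem quatMatrix_star (n : ℕ) (A : Matrix (Fin n) (Fin n) ℂ) :
    quatMatrix n (star A) = star (quatMatrix n A) := by
  ext i j <;> simp [quatMatrix, Matrix.star_apply]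

theorem quatMatrix_mem (n : ℕ) (A : Matrix (Fin n) (Fin n) ℂ)
    (hA : A ∈ Matrix.unitaryGroup (Fin n) ℂ) :
    quatMatrix n A ∈ unitary (Matrix (Fin n) (Fin n) ℍ[ℝ]) := by
  have h1 : star A * A = 1 := Matrix.mem_unitaryGroup_iff'.1 hA
  have h2 : A * star A = 1 := Matrix.mem_unitaryGroup_iff.1 hA
  refine Unitary.mem_iff.2 ⟨?_, ?_⟩
  · rw [← quatMatrix_star, ← map_mul, h1, map_one]
  · rw [← quatMatrix_star, ← map_mul, h2, map_one]

/-- The usual embedding `U(n) → Sp(n)`. -/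
noncomputable def uToSp (n : ℕ) : UGrp n →* SpGrp n where
  toFun A := ⟨quatMatrix n A.1, quatMatrix_mem n A.1 A.2⟩
  map_one' := Subtype.ext (map_one (quatMatrix n))
  map_mul' A B := Subtype.ext (map_mul (quatMatrix n) A.1 B.1)

/-- The real `2n × 2n` matrix of a complex `n × n` matrix. -/
def realMatrix (n : ℕ) (A : Matrix (Fin n) (Fin n) ℂ) :
    Matrix (Fin n ⊕ Fin n) (Fin n ⊕ Fin n) ℝ :=
  Matrix.fromBlocks (A.map Complex.re) (-(A.map Complex.im))
    (A.map Complex.im) (A.map Complex.re)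

theorem realMatrix_one (n : ℕ) : realMatrix n 1 = 1 := by
  rw [realMatrix, ← Matrix.fromBlocks_one]
  congr 1 <;> ext i j <;> by_cases h : i = j <;> simp [Matrix.one_apply, h]

theorem realMatrix_mul (n : ℕ) (A B : Matrix (Fin n) (Fin n) ℂ) :
    realMatrix n (A * B) = realMatrix n A * realMatrix n B := by
  simp only [realMatrix, Matrix.fromBlocks_multiply]
  congr 1 <;> ext i j <;>
    simp [Matrix.mul_apply, Finset.sum_add_distrib, Finset.sum_sub_distrib] <;> ring

theorem realMatrix_star (n : ℕ) (A : Matrix (Fin n) (Fin n) ℂ) :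
    realMatrix n (star A) = (realMatrix n A)ᵀ := by
  simp only [realMatrix, Matrix.fromBlocks_transpose]
  congr 1 <;> (ext i j; simp [Matrix.star_apply])

theorem realMatrix_det (n : ℕ) (A : Matrix (Fin n) (Fin n) ℂ) :
    (realMatrix n A).det = Complex.normSq A.det := by
  let I' : Matrix (Fin n) (Fin n) ℂ := Complex.I • 1
  have hI : ∀ M : Matrix (Fin n) (Fin n) ℂ, I' * M = Complex.I • M := fun M => by simp [I']
  have hI2 : ∀ M : Matrix (Fin n) (Fin n) ℂ, M * I' = Complex.I • M := fun M => by simp [I']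
  have key : Matrix.fromBlocks 1 I' 0 1 * (realMatrix n A).map Complex.ofRealHom *
      Matrix.fromBlocks 1 (-I') 0 1 =
        Matrix.fromBlocks A 0 ((A.map Complex.im).map Complex.ofRealHom)
          (A.map (starRingEnd ℂ)) := by
    simp only [realMatrix, Matrix.fromBlocks_map, Matrix.fromBlocks_multiply, hI, mul_neg,
      Matrix.add_mul, Matrix.smul_mul, hI2]
    congr 1 <;> ext i j <;> apply Complex.ext <;> simp
  have h := congrArg Matrix.det key
  rw [Matrix.det_mul, Matrix.det_mul, Matrix.det_fromBlocks_zero₂₁,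
    Matrix.det_fromBlocks_zero₂₁, Matrix.det_fromBlocks_zero₁₂, Matrix.det_one, one_mul,
    one_mul, mul_one, ← RingHom.mapMatrix_apply, ← RingHom.map_det,
    ← RingHom.mapMatrix_apply, ← RingHom.map_det, Complex.mul_conj] at h
  exact Complex.ofReal_injective h

theorem realMatrix_mem (n : ℕ) (A : UGrp n) :
    realMatrix n A.1 ∈ Matrix.specialOrthogonalGroup (Fin n ⊕ Fin n) ℝ := by
  rw [Matrix.mem_specialOrthogonalGroup_iff, Matrix.mem_orthogonalGroup_iff]
  have h : A.1 * star A.1 = 1 := Unitary.mul_star_self_of_mem A.2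
  constructor
  · change realMatrix n A.1 * (realMatrix n A.1)ᵀ = 1
    rw [← realMatrix_star, ← realMatrix_mul, h, realMatrix_one]
  · have h2 := congrArg Matrix.det h
    rw [Matrix.det_mul, Matrix.star_eq_conjTranspose, Matrix.det_conjTranspose,
      Matrix.det_one, Complex.star_def, Complex.mul_conj] at h2
    rw [realMatrix_det]
    exact_mod_cast h2

/-- The usual embedding `U(n) → SO(2n)`. -/
def uToSOEven (n : ℕ) : UGrp n →* SOEvenGrp n where
  toFun A := ⟨realMatrix n A.1, realMatrix_mem n A⟩
  map_one' := by ext1; exact realMatrix_one n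
  map_mul' A B := by ext1; exact realMatrix_mul n _ _

/-- The usual embedding `SO(2n) → SO(2n+1)`, `A ↦ diag(A, 1)`. -/
def soEvenToSOOdd (n : ℕ) : SOEvenGrp n →* SOOddGrp n where
  toFun A := ⟨Matrix.fromBlocks A.1 0 0 1, by
    obtain ⟨h1, h2⟩ := Matrix.mem_specialOrthogonalGroup_iff.1 A.2
    rw [Matrix.mem_orthogonalGroup_iff] at h1
    rw [Matrix.mem_specialOrthogonalGroup_iff, Matrix.mem_orthogonalGroup_iff]
    constructor
    · change A.1 * A.1ᵀ = 1 at h1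
      simp [Matrix.fromBlocks_transpose, Matrix.fromBlocks_multiply, h1]
    · simp [h2]⟩
  map_one' := by ext1; simp
  map_mul' A B := by ext1; simp [Matrix.fromBlocks_multiply]

/-- The inclusion `SO(2n) → O(2n)`. -/
def soEvenToOEven (n : ℕ) : SOEvenGrp n →* OEvenGrp n where
  toFun A := ⟨A.1, (Matrix.mem_specialOrthogonalGroup_iff.1 A.2).1⟩
  map_one' := rfl
  map_mul' _ _ := rfl

/-- The usual embedding `U(n) → SO(2n+1)`. -/
def uToSOOdd (n : ℕ) : UGrp n →* SOOddGrp n := (soEvenToSOOdd n).comp (uToSOEven n)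

/-- The image in `G × G` of a subgroup of `H × H` under a homomorphism `ι : H → G`. -/
def mapBoth {H G : Type*} [Group H] [Group G] (ι : H →* G) (T : Subgroup (H × H)) :
    Subgroup (G × G) :=
  T.map (ι.prodMap ι)

/-! ### The tori `P₁ⁿ` and `P₂ⁿ` -/

/-- The diagonal maximal torus `w ↦ diag(w_1, …, w_n)` of `U(n)`. -/
noncomputable def diagU (n : ℕ) : (Fin n → Circle) →* UGrp n where
  toFun w := ⟨Matrix.diagonal fun i => (w i : ℂ), by
    rw [Matrix.mem_unitaryGroup_iff, Matrix.star_eq_conjTranspose,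
      Matrix.diagonal_conjTranspose, Matrix.diagonal_mul_diagonal, ← Matrix.diagonal_one]
    congr 1
    ext1 i
    simp [Complex.mul_conj]⟩
  map_one' := by ext1; simp
  map_mul' v w := by ext1; simp

/-- The vector `(w_1, …, w_{n-1}, z)`. -/
def appendLast {n : ℕ} (w : Fin (n - 1) → Circle) (z : Circle) : Fin n → Circle :=
  fun i => if h : (i : ℕ) < n - 1 then w ⟨i, h⟩ else z

/-- The parametrization
`(z, w) ↦ ((1, …, 1, z), (w_1, …, w_{n-1}, w_1⁻¹ ⋯ w_{n-1}⁻¹))`. -/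
noncomputable def paramP1 (n : ℕ) : Circle × (Fin (n - 1) → Circle) →*
    (Fin n → Circle) × (Fin n → Circle) where
  toFun p := (appendLast 1 p.1, appendLast p.2 (∏ j, (p.2 j)⁻¹))
  map_one' := by ext i <;> simp [appendLast]
  map_mul' p q := by
    ext i <;> by_cases h : (i : ℕ) < n - 1 <;>
      simp [appendLast, h, Finset.prod_mul_distrib, mul_comm]

/-- The parametrization `(z, w) ↦ ((z, …, z), (w_1, …, w_{n-1}, 1))`. -/
noncomputable def paramP2 (n : ℕ) : Circle × (Fin (n - 1) → Circle) →*
    (Fin n → Circle) × (Fin n → Circle) where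
  toFun p := (fun _ => p.1, appendLast p.2 1)
  map_one' := by ext i <;> simp [appendLast]
  map_mul' p q := by
    ext i <;> by_cases h : (i : ℕ) < n - 1 <;> simp [appendLast, h]

/-- `P₁ⁿ = {(diag(1, …, 1, z), diag(w_1, …, w_{n-1}, w̄_1 ⋯ w̄_{n-1}))}` in `U(n) × U(n)`. -/
noncomputable def torusP1 (n : ℕ) : Subgroup (UGrp n × UGrp n) :=
  mapBoth (diagU n) (paramP1 n).range

/-- `P₂ⁿ = {(diag(z, …, z), diag(w_1, …, w_{n-1}, 1))}` in `U(n) × U(n)`. -/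
noncomputable def torusP2 (n : ℕ) : Subgroup (UGrp n × UGrp n) :=
  mapBoth (diagU n) (paramP2 n).range

/-! ### Unimodular systems of integer vectors -/

section Lattice

/-! Parametrize T by (S¹)ⁿ and conjugate each of its two components into a standard maximal torus of
G. The components become endomorphisms of (S¹)ⁿ given by integer matrices A and B
(`IsStandardTorus.exists_charMap`). An element of T fixes a point exactly when its components are
conjugate in G, so freeness forces B − wA to be invertible over ℤ for every w in the Weyl group
(`isUnit_det_of_charMap`). Only permutations with an even number of sign changes are used as w, so
that SO(2n) is covered together with Sp(n) and SO(2n+1).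

For a fixed permutation, det(B − wA) is a polynomial in the signs, and its coefficients c_S are the
determinants obtained by choosing one row from each matched pair. All its values at even sign
vectors are ±1. Parseval then gives Σ c_S(c_S + c_Sᶜ) = 1. For n ≥ 3, changing the matching by a
transposition separates c_S from c_Sᶜ and yields Σ c_S² = 1 (`uniqueTransversal_of_even`): each
matching has exactly one transversal that is a basis.

Taking one such transversal as the basis of ℤⁿ and comparing matchings by exchange arguments leaves
little room: one matrix vanishes (a one-sided action), or the pair has the shape of P₁ⁿ or P₂ⁿ up to
signed permutations and exchange of the two sides (`UniqueTransversal.type`). Conversely, these tori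
are free because torus elements are conjugate only if they differ by a signed permutation.

The groups enter only through `IsStandardTorus`, which requires simultaneous diagonalization,
representatives of Weyl elements, and the determination of conjugacy in the torus. For SO(2n) the
conjugating group is enlarged to O(2n). Transfer between the groups follows since conjugacy of
diagonal matrices means the same in Sp(n), SO(2n+1) and O(2n); on SO(2n) the classification bridges
the gap to O(2n). The two actions on Sp(n), n ≥ 3, are told apart by noncentral involutions with one
trivial component (`not_equivalentActions_sp`). -/

theorem sum_signs_prod_mul_prod {n : ℕ} (S T : Finset (Fin n)) :
    ∑ ε : Fin n → ℤˣ, (∏ i ∈ S, (ε i : ℤ)) * ∏ i ∈ T, (ε i : ℤ) =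
      if S = T then 2 ^ n else 0 := by
  have h : ∀ ε : Fin n → ℤˣ, (∏ i ∈ S, (ε i : ℤ)) * ∏ i ∈ T, (ε i : ℤ) =
      ∏ i, ((if i ∈ S then (ε i : ℤ) else 1) * if i ∈ T then (ε i : ℤ) else 1) := fun ε => by
    rw [Finset.prod_mul_distrib, Finset.prod_ite_mem, Finset.prod_ite_mem, Finset.univ_inter,
      Finset.univ_inter]
  simp_rw [h]
  have h2 := Finset.prod_univ_sum (fun _ : Fin n => (Finset.univ : Finset ℤˣ))
    (fun i u => (if i ∈ S then (u : ℤ) else 1) * if i ∈ T then (u : ℤ) else 1)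
  rw [Fintype.piFinset_univ] at h2
  rw [← h2]
  have h3 : ∀ g : ℤˣ → ℤ, ∑ u, g u = g 1 + g (-1) := fun g => by
    rw [show (Finset.univ : Finset ℤˣ) = {1, -1} by decide, Finset.sum_pair (by decide)]
  split_ifs with hST
  · subst hST
    have : ∀ i ∈ (Finset.univ : Finset (Fin n)), ∑ u : ℤˣ, ((if i ∈ S then (u : ℤ) else 1) *
        if i ∈ S then (u : ℤ) else 1) = 2 := fun i _ => by
      rw [h3]; split_ifs <;> simp
    rw [Finset.prod_congr rfl this]; simp
  · obtain ⟨i, hi⟩ : ∃ i, ¬ (i ∈ S ↔ i ∈ T) := by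
      by_contra! hc; exact hST (Finset.ext hc)
    refine Finset.prod_eq_zero (Finset.mem_univ i) ?_
    rw [h3]
    by_cases hS : i ∈ S <;> by_cases hT : i ∈ T <;> simp_all

/-- Parseval's identity on the group of sign vectors of product `1`. -/
theorem sum_mul_add_compl_eq_one {n : ℕ} (hn : 0 < n) (c : Finset (Fin n) → ℤ)
    (h : ∀ ε : Fin n → ℤˣ, ∏ i, ε i = 1 → (∑ S, (∏ i ∈ S, (ε i : ℤ)) * c S) ^ 2 = 1) :
    ∑ S, c S * (c S + c Sᶜ) = 1 := by
  have hne : (∅ : Finset (Fin n)) ≠ Finset.univ := by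
    intro h'
    have := Finset.mem_univ (⟨0, hn⟩ : Fin n)
    rw [← h'] at this; simp at this
  -- The weight 1 + ∏ ε is 2 on sign vectors of product 1 and 0 on the others, so the sum only sees
  -- values covered by `h`.
  have h1 : ∑ ε : Fin n → ℤˣ, (1 + ∏ i, (ε i : ℤ)) *
      (∑ S, (∏ i ∈ S, (ε i : ℤ)) * c S) ^ 2 = 2 ^ n := by
    have : ∀ ε : Fin n → ℤˣ, (1 + ∏ i, (ε i : ℤ)) * (∑ S, (∏ i ∈ S, (ε i : ℤ)) * c S) ^ 2 =
        (∏ i ∈ (∅ : Finset (Fin n)), (ε i : ℤ)) * (∏ i ∈ (∅ : Finset (Fin n)), (ε i : ℤ)) +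
        (∏ i ∈ (∅ : Finset (Fin n)), (ε i : ℤ)) * ∏ i, (ε i : ℤ) := fun ε => by
      simp only [Finset.prod_empty, one_mul]
      rcases Int.units_eq_one_or (∏ i, ε i) with h1 | h1
      · rw [h ε h1, mul_one]
      · have : ∏ i, (ε i : ℤ) = -1 := by
          rw [← Units.coe_prod, h1]; rfl
        rw [this]; ring
    simp_rw [this]
    rw [Finset.sum_add_distrib, sum_signs_prod_mul_prod, sum_signs_prod_mul_prod, if_pos rfl,
      if_neg hne, add_zero]
  have h2 : ∀ ε : Fin n → ℤˣ, (1 + ∏ i, (ε i : ℤ)) * (∑ S, (∏ i ∈ S, (ε i : ℤ)) * c S) ^ 2 =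
      ∑ S, ∑ T, c S * c T * ((∏ i ∈ S, (ε i : ℤ)) * (∏ i ∈ T, (ε i : ℤ)) +
        (∏ i ∈ S, (ε i : ℤ)) * (∏ i ∈ Tᶜ, (ε i : ℤ))) := fun ε => by
    rw [sq, Finset.sum_mul_sum, Finset.mul_sum]
    refine Finset.sum_congr rfl fun S _ => ?_
    rw [Finset.mul_sum]
    refine Finset.sum_congr rfl fun T _ => ?_
    -- Multiplying by the full product turns the character of T into that of its complement; this is
    -- where c Sᶜ comes from.
    have e : (∏ i, (ε i : ℤ)) * ∏ i ∈ T, (ε i : ℤ) = ∏ i ∈ Tᶜ, (ε i : ℤ) := by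
      rw [← Finset.prod_mul_prod_compl T, mul_right_comm, ← Finset.prod_mul_distrib]
      simp [← Units.val_mul]
    rw [← e]; ring
  have h3 : ∑ ε : Fin n → ℤˣ, (1 + ∏ i, (ε i : ℤ)) *
      (∑ S, (∏ i ∈ S, (ε i : ℤ)) * c S) ^ 2 = 2 ^ n * ∑ S, c S * (c S + c Sᶜ) := by
    simp_rw [h2]
    rw [Finset.sum_comm, Finset.mul_sum]
    refine Finset.sum_congr rfl fun S _ => ?_
    rw [Finset.sum_comm]
    simp_rw [← Finset.mul_sum, Finset.sum_add_distrib, sum_signs_prod_mul_prod]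
    have e : ∀ T : Finset (Fin n), (S = Tᶜ) ↔ (Sᶜ = T) := fun T => eq_compl_comm.trans eq_comm
    simp_rw [mul_add, Finset.sum_add_distrib, e]
    simp
    ring
  have h4 : (2 : ℤ) ^ n ≠ 0 := by positivity
  exact mul_left_cancel₀ h4 (by rw [← h3, h1, mul_one])

/-- The matrix with rows `B i` for `i ∈ S` and `A i` for `i ∉ S`. -/
def mixedRows {n : ℕ} (A B : Matrix (Fin n) (Fin n) ℤ) (S : Finset (Fin n)) :
    Matrix (Fin n) (Fin n) ℤ :=
  Matrix.of fun i k => if i ∈ S then B i k else A i k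

theorem mixedRows_apply {n : ℕ} (A B : Matrix (Fin n) (Fin n) ℤ) (S : Finset (Fin n))
    (i k : Fin n) : mixedRows A B S i k = if i ∈ S then B i k else A i k := rfl

/-- The determinant of the matrix with rows `B i` for `i ∈ S` and `A i` for `i ∉ S`. -/
def mixedDet {n : ℕ} (A B : Matrix (Fin n) (Fin n) ℤ) (S : Finset (Fin n)) : ℤ :=
  (mixedRows A B S).det

theorem piecewise_eq_mixedRows {n : ℕ} (A B : Fin n → Fin n → ℤ) (S : Finset (Fin n)) :
    S.piecewise B A = mixedRows A B S := by
  funext i k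
  by_cases hi : i ∈ S
  · rw [Finset.piecewise_eq_of_mem _ _ _ hi]; exact (if_pos hi).symm
  · rw [Finset.piecewise_eq_of_notMem _ _ _ hi]; exact (if_neg hi).symm

/-- Multilinearity of the determinant in the rows. -/
theorem det_add_signs {n : ℕ} (A B : Matrix (Fin n) (Fin n) ℤ) (ε : Fin n → ℤˣ) :
    Matrix.det (Matrix.of fun i k => A i k + (ε i : ℤ) * B i k) =
      ∑ S, (∏ i ∈ S, (ε i : ℤ)) * mixedDet A B S := by
  let A' : Fin n → Fin n → ℤ := A
  let B' : Fin n → Fin n → ℤ := B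
  have h := (Matrix.detRowAlternating (n := Fin n) (R := ℤ)).toMultilinearMap.map_add_univ
    (fun i => (ε i : ℤ) • B' i) A'
  have e : (fun i => (ε i : ℤ) • B' i) + A' = fun i k => A i k + (ε i : ℤ) * B i k := by
    funext i k; exact add_comm _ _
  rw [e] at h
  refine h.trans (Finset.sum_congr rfl fun S _ => ?_)
  have h2 := (Matrix.detRowAlternating (n := Fin n) (R := ℤ)).toMultilinearMap.map_piecewise_smul
    (fun i => (ε i : ℤ)) (S.piecewise B' A') S
  have h3 : mixedDet A B S = (Matrix.detRowAlternating (n := Fin n) (R := ℤ)).toMultilinearMap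
      (S.piecewise B' A') := by
    rw [piecewise_eq_mixedRows A' B']; rfl
  rw [h3, ← smul_eq_mul]
  refine Eq.trans ?_ h2
  congr 1
  funext i k
  by_cases hi : i ∈ S <;> simp [hi]

/-- Adding `h` to its reindexing by complements gives Σ (c S + c Sᶜ)² = 2, where S and Sᶜ are
distinct and contribute equally. -/
theorem sq_add_compl_le_one {n : ℕ} (hn : 0 < n) (c : Finset (Fin n) → ℤ)
    (h : ∑ S, c S * (c S + c Sᶜ) = 1) (S : Finset (Fin n)) : (c S + c Sᶜ) ^ 2 ≤ 1 := by
  have hne : S ≠ Sᶜ := fun h' => by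
    have := Finset.mem_compl (s := S) (a := ⟨0, hn⟩)
    rw [← h'] at this; tauto
  have h2 : ∑ S, c Sᶜ * (c S + c Sᶜ) = 1 := by
    rw [← h]
    refine Fintype.sum_equiv (Equiv.ofBijective compl compl_bijective) _ _ fun S => ?_
    simp [add_comm]
  have h3 : ∑ S, (c S + c Sᶜ) ^ 2 = 2 := by
    rw [show (2 : ℤ) = 1 + 1 by rfl]
    nth_rewrite 2 [← h]
    rw [← h2, ← Finset.sum_add_distrib]
    exact Finset.sum_congr rfl fun S _ => by ring
  have h4 : ∑ T ∈ {S, Sᶜ}, (c T + c Tᶜ) ^ 2 ≤ ∑ T, (c T + c Tᶜ) ^ 2 :=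
    Finset.sum_le_sum_of_subset_of_nonneg (Finset.subset_univ _) fun _ _ _ => sq_nonneg _
  rw [Finset.sum_pair hne, h3, compl_compl, add_comm (c Sᶜ)] at h4
  linarith

theorem mixedDet_swap_of_mem {n : ℕ} (A B : Matrix (Fin n) (Fin n) ℤ) {S : Finset (Fin n)}
    {p q : Fin n} (hp : p ∈ S) (hq : q ∈ S) (hpq : p ≠ q) :
    mixedDet A (B.submatrix (Equiv.swap p q) id) S = - mixedDet A B S := by
  have := Matrix.det_permute (Equiv.swap p q) (mixedRows A B S)
  rw [Equiv.Perm.sign_swap hpq] at this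
  rw [mixedDet, mixedDet]
  refine Eq.trans ?_ (this.trans (by simp))
  congr 1
  ext i k
  by_cases h1 : i = p
  · subst h1; simp [hp, hq, mixedRows_apply]
  by_cases h2 : i = q
  · subst h2; simp [hp, hq, mixedRows_apply]
  by_cases hi : i ∈ S <;> simp [mixedRows_apply, hi, Equiv.swap_apply_of_ne_of_ne h1 h2]

theorem mixedDet_swap_of_notMem {n : ℕ} (A B : Matrix (Fin n) (Fin n) ℤ) {S : Finset (Fin n)}
    {p q : Fin n} (hp : p ∉ S) (hq : q ∉ S) :
    mixedDet A (B.submatrix (Equiv.swap p q) id) S = mixedDet A B S := by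
  rw [mixedDet, mixedDet]
  congr 1
  ext i k
  by_cases hi : i ∈ S
  · have h1 : i ≠ p := fun h => hp (h ▸ hi)
    have h2 : i ≠ q := fun h => hq (h ▸ hi)
    simp [mixedRows_apply, hi, Equiv.swap_apply_of_ne_of_ne h1 h2]
  · simp [mixedRows_apply, hi]

/-- For every matching of the rows of `A` with those of `B`, exactly one choice of one row from
each pair is a basis of `ℤⁿ ⊗ ℚ`, and that choice is a basis of `ℤⁿ`. -/
def UniqueTransversal {n : ℕ} (A B : Matrix (Fin n) (Fin n) ℤ) : Prop :=
  ∀ σ : Equiv.Perm (Fin n), ∑ S, mixedDet A (B.submatrix σ id) S ^ 2 = 1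

/-- Let x, y be the determinants for S and Sᶜ. Then (x + y)² ≤ 1. Exchanging two partners inside S
changes the sign of x but not y, so (x − y)² ≤ 1 as well. Hence x² + y² ≤ 1, so xy = 0 and the mixed
terms drop out of Parseval's identity. -/
theorem uniqueTransversal_of_even {n : ℕ} (hn : 3 ≤ n) (A B : Matrix (Fin n) (Fin n) ℤ)
    (h : ∀ (σ : Equiv.Perm (Fin n)) (ε : Fin n → ℤˣ), ∏ i, ε i = 1 →
      IsUnit (Matrix.det (Matrix.of fun i k => A i k + (ε i : ℤ) * B (σ i) k))) :
    UniqueTransversal A B := by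
  have h1 : ∀ σ : Equiv.Perm (Fin n), ∑ S, mixedDet A (B.submatrix σ id) S *
      (mixedDet A (B.submatrix σ id) S + mixedDet A (B.submatrix σ id) Sᶜ) = 1 := fun σ => by
    refine sum_mul_add_compl_eq_one (by omega) _ fun ε hε => ?_
    rw [← det_add_signs]
    exact Int.isUnit_iff.1 (h σ ε hε) |>.elim (fun h => by
      erw [h]; rfl) (fun h => by erw [h]; rfl)
  intro σ
  have h2 : ∀ S, mixedDet A (B.submatrix σ id) S * mixedDet A (B.submatrix σ id) Sᶜ = 0 := by
    intro S
    have e1 := sq_add_compl_le_one (by omega) _ (h1 σ) S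
    have e2 : (mixedDet A (B.submatrix σ id) S - mixedDet A (B.submatrix σ id) Sᶜ) ^ 2 ≤ 1 := by
      have key : ∀ T : Finset (Fin n), 1 < T.card →
          (mixedDet A (B.submatrix σ id) T - mixedDet A (B.submatrix σ id) Tᶜ) ^ 2 ≤ 1 := by
        intro T hT
        obtain ⟨p, hp, q, hq, hpq⟩ := Finset.one_lt_card.1 hT
        have e := sq_add_compl_le_one (by omega) _ (h1 (σ * Equiv.swap p q)) T
        have e3 : B.submatrix (σ * Equiv.swap p q) id =
          (B.submatrix σ id).submatrix (Equiv.swap p q) id := rfl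
        rw [e3, mixedDet_swap_of_mem _ _ hp hq hpq,
          mixedDet_swap_of_notMem _ _ (by simpa using hp) (by simpa using hq)] at e
        calc _ = _ := by ring
          _ ≤ _ := e
      -- Since n ≥ 3, at least one of S and Sᶜ has two elements to exchange.
      have hc := Finset.card_add_card_compl S
      rw [Fintype.card_fin] at hc
      by_cases hS : 1 < S.card
      · exact key S hS
      · have := key Sᶜ (by omega)
        rw [compl_compl] at this
        calc _ = _ := by ring
          _ ≤ _ := this
    generalize mixedDet A (B.submatrix σ id) S = x at *
    generalize mixedDet A (B.submatrix σ id) Sᶜ = y at *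
    have e4 : x ^ 2 + y ^ 2 ≤ 1 := by nlinarith
    by_contra hxy
    have hx : x ≠ 0 := left_ne_zero_of_mul hxy
    have hy : y ≠ 0 := right_ne_zero_of_mul hxy
    have := Int.one_le_abs hx
    have := Int.one_le_abs hy
    nlinarith [sq_abs x, sq_abs y]
  rw [← h1 σ]
  exact Finset.sum_congr rfl fun S _ => by rw [mul_add, h2, add_zero, sq]

theorem UniqueTransversal.exists_isUnit {n : ℕ} {A B : Matrix (Fin n) (Fin n) ℤ}
    (h : UniqueTransversal A B) (σ : Equiv.Perm (Fin n)) :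
    ∃ S, IsUnit (mixedDet A (B.submatrix σ id) S) := by
  obtain ⟨S, -, hS⟩ := Finset.exists_ne_zero_of_sum_ne_zero ((h σ).trans_ne one_ne_zero)
  have h2 := Finset.single_le_sum (f := fun S => mixedDet A (B.submatrix σ id) S ^ 2)
    (fun S _ => sq_nonneg _) (Finset.mem_univ S)
  rw [h σ] at h2
  refine ⟨S, Int.isUnit_iff_abs_eq.2 (le_antisymm ?_ (Int.one_le_abs fun h => hS (by simp [h])))⟩
  exact (sq_le_one_iff_abs_le_one _).1 h2

theorem UniqueTransversal.eq_of_ne_zero {n : ℕ} {A B : Matrix (Fin n) (Fin n) ℤ}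
    (h : UniqueTransversal A B) (σ : Equiv.Perm (Fin n)) {S T : Finset (Fin n)}
    (hS : mixedDet A (B.submatrix σ id) S ≠ 0) (hT : mixedDet A (B.submatrix σ id) T ≠ 0) :
    S = T := by
  by_contra hne
  have h4 : ∑ U ∈ {S, T}, mixedDet A (B.submatrix σ id) U ^ 2 ≤
      ∑ U, mixedDet A (B.submatrix σ id) U ^ 2 :=
    Finset.sum_le_sum_of_subset_of_nonneg (Finset.subset_univ _) fun _ _ _ => sq_nonneg _
  rw [Finset.sum_pair hne, h σ] at h4
  have h1 := Int.one_le_abs hS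
  have h2 := Int.one_le_abs hT
  nlinarith [sq_abs (mixedDet A (B.submatrix σ id) S), sq_abs (mixedDet A (B.submatrix σ id) T)]

/-- Choosing rows of A on S is choosing rows of B on the complement for the inverse matching;
relabelling the rows costs only a sign. -/
theorem UniqueTransversal.symm {n : ℕ} {A B : Matrix (Fin n) (Fin n) ℤ}
    (h : UniqueTransversal A B) : UniqueTransversal B A := by
  intro σ
  rw [← h σ⁻¹]
  let e : Finset (Fin n) ≃ Finset (Fin n) :=
    (Equiv.ofBijective compl compl_bijective).trans (Equiv.finsetCongr σ)
  refine Fintype.sum_equiv e _ _ fun S => ?_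
  have h2 : mixedRows B (A.submatrix σ id) S =
      (mixedRows A (B.submatrix (σ⁻¹ : Equiv.Perm (Fin n)) id) (e S)).submatrix σ id := by
    ext i k
    by_cases hi : i ∈ S <;> simp [hi, mixedRows_apply, e]
  rw [mixedDet, mixedDet, h2, Matrix.det_permute, mul_pow]
  simp [← Units.val_pow_eq_pow_val]

end Lattice

/-! ### Normal form of a pair of matrices with unique transversals -/

section LatticeNormalForm

theorem mixedDet_ne_zero {n : ℕ} {A B : Matrix (Fin n) (Fin n) ℤ} {S : Finset (Fin n)}
    (h : ∀ v : Fin n → ℤ, (∀ i ∈ S, ∑ k, B i k * v k = 0) → (∀ i ∉ S, ∑ k, A i k * v k = 0) →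
      v = 0) : mixedDet A B S ≠ 0 := by
  intro h0
  obtain ⟨v, hv, hM⟩ := Matrix.exists_mulVec_eq_zero_iff.2 h0
  refine hv (h v (fun i hi => ?_) fun i hi => ?_)
  all_goals
    have := congrFun hM i
    simpa [Matrix.mulVec, dotProduct, mixedRows_apply, hi] using this

theorem mixedRows_mul {n : ℕ} (A B F : Matrix (Fin n) (Fin n) ℤ) (S : Finset (Fin n)) :
    mixedRows (A * F) (B * F) S = mixedRows A B S * F := by
  ext i k
  by_cases hi : i ∈ S <;> simp [mixedRows_apply, Matrix.mul_apply, hi]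

/-- A change of basis of ℤⁿ multiplies all transversal determinants by the same sign. -/
theorem UniqueTransversal.mul_right {n : ℕ} {A B : Matrix (Fin n) (Fin n) ℤ}
    (h : UniqueTransversal A B) {F : Matrix (Fin n) (Fin n) ℤ} (hF : IsUnit F.det) :
    UniqueTransversal (A * F) (B * F) := by
  intro σ
  rw [← h σ]
  refine Finset.sum_congr rfl fun S _ => ?_
  have e : (B * F).submatrix σ id = B.submatrix σ id * F := by
    ext i k; simp [Matrix.mul_apply]
  rw [mixedDet, e, mixedRows_mul, Matrix.det_mul, mul_pow]
  rcases Int.isUnit_iff.1 hF with h | h <;> simp [h, mixedDet]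

theorem sum_one_apply_mul {n : ℕ} (i : Fin n) (v : Fin n → ℤ) :
    ∑ k, (1 : Matrix (Fin n) (Fin n) ℤ) i k * v k = v i :=
  congrFun (Matrix.one_mulVec v) i

/-- `A` and `B` are in normal form with respect to `S` if the basis elements chosen by `S` are the
standard ones. -/
structure IsNormalized {n : ℕ} (A B : Matrix (Fin n) (Fin n) ℤ) (S : Finset (Fin n)) : Prop where
  unique : UniqueTransversal A B
  left : ∀ i ∉ S, ∀ k, A i k = (1 : Matrix (Fin n) (Fin n) ℤ) i k
  right : ∀ i ∈ S, ∀ k, B i k = (1 : Matrix (Fin n) (Fin n) ℤ) i k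

variable {n : ℕ} {A B : Matrix (Fin n) (Fin n) ℤ} {S : Finset (Fin n)}

theorem IsNormalized.symm (h : IsNormalized A B S) : IsNormalized B A Sᶜ where
  unique := h.unique.symm
  left i hi := h.right i (by simpa using hi)
  right i hi := h.left i (by simpa using hi)

/-- Exchange the partners of i and l. Then S is still a transversal. If `A i l` were nonzero, `A i`
could replace its new partner, the unit vector e_l, so S without i would be a second transversal. -/
theorem IsNormalized.left_eq_zero (h : IsNormalized A B S) {i l : Fin n} (hi : i ∈ S)
    (hl : l ∈ S) : A i l = 0 := by
  by_contra hne
  have hσ : ∀ p, Equiv.swap i l p ∈ S ↔ p ∈ S := fun p => by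
    rw [Equiv.swap_apply_def]; split_ifs with h1 h2
    · subst h1; simp [hi, hl]
    · subst h2; simp [hi, hl]
    · rfl
  have e := h.unique.eq_of_ne_zero (Equiv.swap i l) (S := S) (T := S.erase i) ?_ ?_
  · have := Finset.notMem_erase i S
    rw [← e] at this
    exact this hi
  · refine mixedDet_ne_zero fun v h1 h2 => funext fun p => ?_
    by_cases hp : p ∈ S
    · have := h1 (Equiv.swap i l p) ((hσ p).2 hp)
      simp only [Matrix.submatrix_apply, Equiv.swap_apply_self, id, h.right p hp] at this
      rwa [sum_one_apply_mul] at this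
    · have := h2 p hp
      simp only [h.left p hp] at this
      rwa [sum_one_apply_mul] at this
  · refine mixedDet_ne_zero fun v h1 h2 => ?_
    have key : ∀ p, p ≠ l → v p = 0 := fun p hpl => by
      by_cases hp : p ∈ S
      · have := h1 (Equiv.swap i l p) (Finset.mem_erase.2 ⟨fun h' => hpl ?_, (hσ p).2 hp⟩)
        · simp only [Matrix.submatrix_apply, Equiv.swap_apply_self, id, h.right p hp] at this
          rwa [sum_one_apply_mul] at this
        · rw [Equiv.swap_apply_eq_iff] at h'; simpa using h'
      · have := h2 p fun h' => hp (Finset.mem_of_mem_erase h')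
        simp only [h.left p hp] at this
        rwa [sum_one_apply_mul] at this
    funext p
    by_cases hp : p = l
    · have := h2 i (Finset.notMem_erase i S)
      rw [Finset.sum_eq_single l (fun b _ hb => by rw [key b hb, mul_zero]) (by simp)] at this
      rw [hp]; exact (mul_eq_zero.1 this).resolve_left hne
    · exact key p hp

theorem IsNormalized.right_eq_zero (h : IsNormalized A B S) {j l : Fin n} (hj : j ∉ S)
    (hl : l ∉ S) : B j l = 0 :=
  h.symm.left_eq_zero (by simpa using hj) (by simpa using hl)

/-- Match `A i'` with `B j` = e_j and `A i` = e_i with `B j'`. Then `A i'` has no coordinates in S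
but a nonzero one at i, and `B j'` has a nonzero one at j. Replacing e_j by `A i'` and e_i by `B j'`
gives a second transversal. -/
theorem IsNormalized.left_or_right (h : IsNormalized A B S) {i i' j j' : Fin n} (hi' : i' ∈ S)
    (hi : i ∉ S) (hj' : j' ∉ S) (hj : j ∈ S) (hA : A i' i ≠ 0) (hB : B j' j ≠ 0) : False := by
  let σ : Equiv.Perm (Fin n) := Equiv.swap i' j * Equiv.swap i j'
  have hij : i' ≠ i := fun h => hi (h ▸ hi')
  have hij' : i' ≠ j' := fun h => hj' (h ▸ hi')
  have hji : j ≠ i := fun h => hi (h ▸ hj)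
  have hjj : j ≠ j' := fun h => hj' (h ▸ hj)
  have h1σ : ∀ p ∈ S, σ p = Equiv.swap i' j p := fun p hp => by
    have : p ≠ i := fun h => hi (h ▸ hp)
    have : p ≠ j' := fun h => hj' (h ▸ hp)
    simp [σ, *, Equiv.swap_apply_of_ne_of_ne]
  have h2σ : ∀ p ∉ S, σ p = Equiv.swap i j' p := fun p hp => by
    have : p ≠ i' := fun h => hp (h ▸ hi')
    have : p ≠ j := fun h => hp (h ▸ hj)
    simp only [σ, Equiv.Perm.mul_apply]
    refine Equiv.swap_apply_of_ne_of_ne ?_ ?_ <;> rw [Equiv.swap_apply_def] <;> split_ifs <;>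
      simp_all [eq_comm]
  have hσ : ∀ p ∈ S, Equiv.swap i' j p ∈ S := fun p hp => by
    rw [Equiv.swap_apply_def]; split_ifs <;> assumption
  have e := h.unique.eq_of_ne_zero σ (S := S) (T := insert i (S.erase i')) ?_ ?_
  · exact hi (e ▸ Finset.mem_insert_self _ _)
  · refine mixedDet_ne_zero fun v h1 h2 => funext fun p => ?_
    by_cases hp : p ∈ S
    · have := h1 (Equiv.swap i' j p) (hσ p hp)
      simp only [Matrix.submatrix_apply, h1σ _ (hσ p hp), Equiv.swap_apply_self, id,
        h.right p hp] at this
      rwa [sum_one_apply_mul] at this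
    · have := h2 p hp
      simp only [h.left p hp] at this
      rwa [sum_one_apply_mul] at this
  · refine mixedDet_ne_zero fun v h1 h2 => ?_
    have k1 : ∀ p, p ≠ i → p ≠ j → v p = 0 := fun p hpi hpj => by
      by_cases hp : p ∈ S
      · have := h1 (Equiv.swap i' j p) (Finset.mem_insert_of_mem
          (Finset.mem_erase.2 ⟨fun h' => hpj ?_, hσ p hp⟩))
        · simp only [Matrix.submatrix_apply, h1σ _ (hσ p hp), Equiv.swap_apply_self, id,
            h.right p hp] at this
          rwa [sum_one_apply_mul] at this
        · rw [Equiv.swap_apply_eq_iff] at h'; simpa using h'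
      · have := h2 p fun h' => (Finset.mem_insert.1 h').elim hpi
          fun h' => hp (Finset.mem_of_mem_erase h')
        simp only [h.left p hp] at this
        rwa [sum_one_apply_mul] at this
    have k2 : v i = 0 := by
      have := h2 i' (by simp [hij])
      rw [Finset.sum_eq_single i (fun b _ hb => ?_) (by simp)] at this
      · exact (mul_eq_zero.1 this).resolve_left hA
      · by_cases hbj : b = j
        · subst hbj; rw [h.left_eq_zero hi' hj, zero_mul]
        · rw [k1 b hb hbj, mul_zero]
    have k3 : v j = 0 := by
      have := h1 i (Finset.mem_insert_self _ _)
      rw [Finset.sum_eq_single j (fun b _ hb => ?_) (by simp)] at this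
      · simp only [Matrix.submatrix_apply, h2σ i hi, Equiv.swap_apply_left, id] at this
        exact (mul_eq_zero.1 this).resolve_left hB
      · by_cases hbi : b = i
        · rw [hbi, k2, mul_zero]
        · rw [k1 b hbi hb, mul_zero]
    funext p
    by_cases hpi : p = i
    · rw [hpi, k2]; rfl
    by_cases hpj : p = j
    · rw [hpj, k3]; rfl
    exact k1 p hpi hpj

/-- If the rows of `A` chosen by `S` vanish, then `S` is the transversal for every matching. -/
theorem IsNormalized.isUnit_mixedDet (h : IsNormalized A B S) (hA : ∀ i ∈ S, ∀ k, A i k = 0)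
    (σ : Equiv.Perm (Fin n)) : IsUnit (mixedDet A (B.submatrix σ id) S) := by
  obtain ⟨T, hT⟩ := h.unique.exists_isUnit σ
  have hST : S ⊆ T := fun i hi => by
    by_contra hiT
    refine hT.ne_zero (Matrix.det_eq_zero_of_row_eq_zero i fun k => ?_)
    simp [mixedRows_apply, hiT, hA i hi]
  have hB : ∀ i, ∀ l ∉ S, B i l = 0 := fun i l hl => by
    by_cases hi : i ∈ S
    · rw [h.right i hi, Matrix.one_apply_ne]
      exact fun h => hl (h ▸ hi)
    · exact h.right_eq_zero hi hl
  -- All rows of B are supported in S, so more than |S| of them are dependent; each term of the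
  -- determinant then contains a zero entry.
  have hcard : T.card ≤ S.card := by
    by_contra! hlt
    refine hT.ne_zero ?_
    rw [mixedDet, Matrix.det_apply]
    refine Finset.sum_eq_zero fun π _ => ?_
    have : ∃ i ∈ T, π⁻¹ i ∉ S := by
      by_contra! hc
      exact absurd (Finset.card_le_card_of_injOn _ hc (π⁻¹).injective.injOn) (by omega)
    obtain ⟨i, hi, hiS⟩ := this
    rw [Finset.prod_eq_zero (Finset.mem_univ (π⁻¹ i)), smul_zero]
    rw [Equiv.Perm.inv_def, Equiv.apply_symm_apply, mixedRows_apply, if_pos hi, Matrix.submatrix_apply]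
    exact hB _ _ hiS
  rwa [Finset.eq_of_subset_of_card_le hST hcard]

/-- Exchanging the partners of j and l puts `B j` in place of e_l in the identity matrix, and the
resulting determinant is this entry. -/
theorem IsNormalized.isUnit_right (h : IsNormalized A B S) (hA : ∀ i ∈ S, ∀ k, A i k = 0)
    {j l : Fin n} (hj : j ∉ S) (hl : l ∈ S) : IsUnit (B j l) := by
  have := h.isUnit_mixedDet hA (Equiv.swap j l)
  rw [mixedDet] at this
  have e : mixedRows A (B.submatrix (Equiv.swap j l) id) S =
      (1 : Matrix (Fin n) (Fin n) ℤ).updateRow l (B j) := by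
    ext i k
    rw [mixedRows_apply, Matrix.updateRow_apply]
    by_cases hil : i = l
    · subst hil; simp [hl]
    rw [if_neg hil]
    split_ifs with hi
    · have : i ≠ j := fun h => hj (h ▸ hi)
      simp [Equiv.swap_apply_of_ne_of_ne this hil, h.right i hi]
    · exact h.left i hi k
  rwa [e, ← Matrix.cramer_transpose_apply, Matrix.transpose_one, Matrix.cramer_one] at this

/-- The entries of B in rows j, j' and columns l, l' are all ±1, so this 2 × 2 minor is even.
Putting `B j`, `B j'` in place of e_l, e_l' produces a transversal matrix that kills e_l + e_l'
modulo 2, although its determinant is a unit. -/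
theorem IsNormalized.not_two_two (h : IsNormalized A B S) (hA : ∀ i ∈ S, ∀ k, A i k = 0)
    {j j' l l' : Fin n} (hj : j ∉ S) (hj' : j' ∉ S) (hl : l ∈ S) (hl' : l' ∈ S)
    (hjj : j ≠ j') (hll : l ≠ l') : False := by
  have hu := h.isUnit_mixedDet hA (Equiv.swap j l * Equiv.swap j' l')
  rw [mixedDet] at hu
  set M := mixedRows A (B.submatrix (Equiv.swap j l * Equiv.swap j' l' : Equiv.Perm _) id) S
  have h2 : (M.map (Int.castRingHom (ZMod 2))).det = 0 := by
    rw [← Matrix.exists_mulVec_eq_zero_iff]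
    refine ⟨Pi.single l 1 + Pi.single l' 1, fun h0 => ?_, ?_⟩
    · have := congrFun h0 l
      simp [hll] at this
    · have odd : ∀ j l, j ∉ S → l ∈ S → ((B j l : ℤ) : ZMod 2) = 1 := fun j l hj hl => by
        rcases Int.isUnit_iff.1 (h.isUnit_right hA hj hl) with h | h <;> rw [h] <;> decide
      have hlj : l ≠ j := fun h => hj (h ▸ hl)
      have hlj' : l ≠ j' := fun h => hj' (h ▸ hl)
      have hlj2 : l' ≠ j := fun h => hj (h ▸ hl')
      have hlj3 : l' ≠ j' := fun h => hj' (h ▸ hl')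
      funext i
      rw [Matrix.mulVec_add, Matrix.mulVec_single_one, Matrix.mulVec_single_one]
      simp only [Pi.add_apply, Matrix.col_apply, Matrix.map_apply, Pi.zero_apply, M,
        mixedRows_apply]
      split_ifs with hi
      · by_cases hil : i = l
        · subst hil
          have : (Equiv.swap j i * Equiv.swap j' l') i = j := by
            simp [Equiv.swap_apply_of_ne_of_ne, *]
          simp only [Matrix.submatrix_apply, this, id, eq_intCast, odd j _ hj hl,
            odd j _ hj hl']
          decide
        by_cases hil' : i = l'
        · subst hil'
          have : (Equiv.swap j l * Equiv.swap j' i) i = j' := by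
            simp only [Equiv.Perm.mul_apply, Equiv.swap_apply_right]
            exact Equiv.swap_apply_of_ne_of_ne hjj.symm hlj'.symm
          simp only [Matrix.submatrix_apply, this, id, eq_intCast, odd j' _ hj' hl,
            odd j' _ hj' hl']
          decide
        have hij : i ≠ j := fun h => hj (h ▸ hi)
        have hij' : i ≠ j' := fun h => hj' (h ▸ hi)
        have : (Equiv.swap j l * Equiv.swap j' l') i = i := by
          simp [Equiv.swap_apply_of_ne_of_ne, *]
        simp only [Matrix.submatrix_apply, this, id, h.right i hi]
        simp [hil, hil']
      · have h1 : i ≠ l := fun h => hi (h ▸ hl)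
        have h1' : i ≠ l' := fun h => hi (h ▸ hl')
        simp [h.left i hi, h1, h1']
  have h3 : (M.map (Int.castRingHom (ZMod 2))).det = ((M.det : ℤ) : ZMod 2) := by
    have := RingHom.map_det (Int.castRingHom (ZMod 2)) M
    exact this.symm
  rw [h3] at h2
  rcases Int.isUnit_iff.1 hu with h | h <;> rw [h] at h2 <;> revert h2 <;> decide

/-- `A` has only one nonzero row `ζ`, the rows of `B` are `n - 1` vectors that together with `ζ`
form a basis, and a signed sum of these. -/
def IsFirstType (A B : Matrix (Fin n) (Fin n) ℤ) : Prop :=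
  ∃ (i₀ : Fin n) (σ : Equiv.Perm (Fin n)) (c : Fin n → ℤˣ), (∀ i ≠ i₀, ∀ k, A i k = 0) ∧
    (∀ k, B (σ i₀) k = ∑ l ∈ Finset.univ.erase i₀, (c l : ℤ) * B (σ l) k) ∧
    IsUnit (Matrix.of fun i k => if i = i₀ then A i k else B (σ i) k).det

/-- The rows of `A` are equal up to sign, and together with `n - 1` rows of `B` they form a basis;
the remaining row of `B` is zero. -/
def IsSecondType (A B : Matrix (Fin n) (Fin n) ℤ) : Prop :=
  ∃ (i₀ : Fin n) (σ : Equiv.Perm (Fin n)) (c : Fin n → ℤˣ), (∀ k, B (σ i₀) k = 0) ∧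
    (∀ i k, A i k = (c i : ℤ) * A i₀ k) ∧
    IsUnit (Matrix.of fun i k => if i = i₀ then A i k else B (σ i) k).det

theorem IsFirstType.mul_right (h : IsFirstType A B) {F : Matrix (Fin n) (Fin n) ℤ}
    (hF : IsUnit F.det) : IsFirstType (A * F) (B * F) := by
  obtain ⟨i₀, σ, c, h1, h2, h3⟩ := h
  refine ⟨i₀, σ, c, fun i hi k => ?_, fun k => ?_, ?_⟩
  · simp [Matrix.mul_apply, h1 i hi]
  · simp_rw [Matrix.mul_apply, h2, Finset.mul_sum, Finset.sum_mul]
    rw [Finset.sum_comm]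
    exact Finset.sum_congr rfl fun _ _ => Finset.sum_congr rfl fun _ _ => by ring
  · convert h3.mul hF
    rw [← Matrix.det_mul]
    congr 1
    ext i k
    by_cases hi : i = i₀ <;> simp [Matrix.mul_apply, hi]

theorem IsSecondType.mul_right (h : IsSecondType A B) {F : Matrix (Fin n) (Fin n) ℤ}
    (hF : IsUnit F.det) : IsSecondType (A * F) (B * F) := by
  obtain ⟨i₀, σ, c, h1, h2, h3⟩ := h
  refine ⟨i₀, σ, c, fun k => ?_, fun i k => ?_, ?_⟩
  · simp [Matrix.mul_apply, h1]
  · simp_rw [Matrix.mul_apply, h2 i, Finset.mul_sum]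
    exact Finset.sum_congr rfl fun _ _ => by ring
  · convert h3.mul hF
    rw [← Matrix.det_mul]
    congr 1
    ext i k
    by_cases hi : i = i₀ <;> simp [Matrix.mul_apply, hi]

/-- By `not_two_two`, S or its complement has at most one element. If one is empty, a matrix
vanishes. If the complement is {j}, only `A j` is nonzero and `B j` is a signed sum of the other
unit vectors. If S = {l}, every row of B is ±e_l. -/
theorem IsNormalized.type_of_left (h : IsNormalized A B S) (hA : ∀ i ∈ S, ∀ k, A i k = 0) :
    A = 0 ∨ B = 0 ∨ IsFirstType A B ∨ IsSecondType B A := by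
  by_cases h0 : S = ∅
  · right; left
    ext j l
    exact h.right_eq_zero (by simp [h0]) (by simp [h0])
  by_cases h1 : Sᶜ = ∅
  · left
    ext i k
    rw [Finset.compl_eq_empty_iff] at h1
    exact hA i (by simp [h1]) k
  obtain ⟨l, hl⟩ := Finset.nonempty_iff_ne_empty.2 h0
  obtain ⟨j, hj⟩ := Finset.nonempty_iff_ne_empty.2 h1
  rw [Finset.mem_compl] at hj
  have hc : ∀ j l : Fin n, ∃ c : ℤˣ, j ∉ S → l ∈ S → B j l = c := fun j l => by
    by_cases hjl : j ∉ S ∧ l ∈ S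
    · obtain ⟨c, hc⟩ := h.isUnit_right hA hjl.1 hjl.2
      exact ⟨c, fun _ _ => hc.symm⟩
    · exact ⟨1, fun h1 h2 => absurd ⟨h1, h2⟩ hjl⟩
  choose c hc using hc
  by_cases hj1 : ∀ j' ∉ S, j = j'
  · right; right; left
    have hmem : ∀ i, i ∈ S ↔ i ≠ j := fun i =>
      ⟨fun hi h => hj (h ▸ hi), fun hi => by_contra fun h' => hi (hj1 i h').symm⟩
    refine ⟨j, 1, c j, fun i hi => hA i ((hmem i).2 hi), fun k => ?_, ?_⟩
    · have : ∀ l ∈ Finset.univ.erase j, (c j l : ℤ) * B ((1 : Equiv.Perm (Fin n)) l) k =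
          if l = k then (c j l : ℤ) else 0 := fun l hl => by
        have hl := (hmem l).2 (Finset.ne_of_mem_erase hl)
        rw [Equiv.Perm.one_apply, h.right l hl, Matrix.one_apply]
        split_ifs <;> simp
      rw [Finset.sum_congr rfl this, Finset.sum_ite_eq', Equiv.Perm.one_apply]
      by_cases hk : k = j
      · subst hk; simp [h.right_eq_zero hj hj]
      · simp [hk, hc j k hj ((hmem k).2 hk)]
    · have : (Matrix.of fun i k => if i = j then A i k else B ((1 : Equiv.Perm (Fin n)) i) k) =
          (1 : Matrix (Fin n) (Fin n) ℤ) := by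
        ext i k
        by_cases hi : i = j
        · subst hi; simp [h.left i hj]
        · simp [hi, h.right i ((hmem i).2 hi)]
      rw [this]; simp
  by_cases hl1 : ∀ l' ∈ S, l = l'
  · right; right; right
    have hmem : ∀ i, i ∉ S ↔ i ≠ l := fun i =>
      ⟨fun hi h => hi (h ▸ hl), fun hi => fun h' => hi (hl1 i h').symm⟩
    have hBl : ∀ k, B l k = (1 : Matrix (Fin n) (Fin n) ℤ) l k := h.right l hl
    refine ⟨l, 1, fun i => if i = l then 1 else c i l, fun k => hA l hl k, fun i k => ?_, ?_⟩
    · by_cases hi : i = l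
      · subst hi; simp
      · have hi' := (hmem i).2 hi
        simp only [hBl, if_neg hi]
        by_cases hk : k = l
        · subst hk; simp [hc i k hi' hl]
        · rw [h.right_eq_zero hi' ((hmem k).2 hk), Matrix.one_apply_ne (Ne.symm hk), mul_zero]
    · have : (Matrix.of fun i k => if i = l then B i k else A ((1 : Equiv.Perm (Fin n)) i) k) =
          (1 : Matrix (Fin n) (Fin n) ℤ) := by
        ext i k
        by_cases hi : i = l
        · subst hi; simp [hBl]
        · simp [hi, h.left i ((hmem i).2 hi)]
      rw [this]; simp
  push Not at hj1 hl1
  obtain ⟨j', hj', hjj⟩ := hj1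
  obtain ⟨l', hl', hll⟩ := hl1
  exact (h.not_two_two hA hj hj' hl hl' hjj hll).elim

theorem UniqueTransversal.type (h : UniqueTransversal A B) :
    A = 0 ∨ B = 0 ∨ (IsFirstType A B ∨ IsSecondType A B) ∨
      (IsFirstType B A ∨ IsSecondType B A) := by
  obtain ⟨S, hS⟩ := h.exists_isUnit 1
  rw [show B.submatrix (1 : Equiv.Perm (Fin n)) id = B from rfl, mixedDet] at hS
  -- The transversal of the identity matching becomes the standard basis; the resulting type is
  -- carried back by E.
  set E := mixedRows A B S
  have hEF : E⁻¹ * E = 1 := Matrix.nonsing_inv_mul _ hS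
  have hF : IsUnit (E⁻¹).det := by simpa using hS
  have hrow : mixedRows (A * E⁻¹) (B * E⁻¹) S = 1 := by
    rw [mixedRows_mul, Matrix.mul_nonsing_inv _ hS]
  have hN : IsNormalized (A * E⁻¹) (B * E⁻¹) S := by
    refine ⟨h.mul_right hF, fun i hi k => ?_, fun i hi k => ?_⟩
    all_goals rw [← hrow, mixedRows_apply]; simp [hi]
  have hA : A = A * E⁻¹ * E := by rw [Matrix.mul_assoc, hEF, Matrix.mul_one]
  have hB : B = B * E⁻¹ * E := by rw [Matrix.mul_assoc, hEF, Matrix.mul_one]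
  have key : A * E⁻¹ = 0 ∨ B * E⁻¹ = 0 ∨
      (IsFirstType (A * E⁻¹) (B * E⁻¹) ∨ IsSecondType (A * E⁻¹) (B * E⁻¹)) ∨
      (IsFirstType (B * E⁻¹) (A * E⁻¹) ∨ IsSecondType (B * E⁻¹) (A * E⁻¹)) := by
    by_cases h1 : ∀ i ∈ S, ∀ k, (A * E⁻¹) i k = 0
    · have := hN.type_of_left h1
      tauto
    · have h2 : ∀ j ∈ Sᶜ, ∀ k, (B * E⁻¹) j k = 0 := by
        push Not at h1
        obtain ⟨i', hi', i, hi⟩ := h1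
        intro j' hj' j
        by_contra hne
        rw [Finset.mem_compl] at hj'
        exact hN.left_or_right hi' (fun h' => hi (hN.left_eq_zero hi' h')) hj'
          (by_contra fun h' => hne (hN.right_eq_zero hj' h')) hi hne
      have := hN.symm.type_of_left h2
      tauto
  rw [hA, hB]
  rcases key with h | h | (h | h) | (h | h)
  · left; rw [h, Matrix.zero_mul]
  · right; left; rw [h, Matrix.zero_mul]
  · exact Or.inr (Or.inr (Or.inl (Or.inl (h.mul_right hS))))
  · exact Or.inr (Or.inr (Or.inl (Or.inr (h.mul_right hS))))
  · exact Or.inr (Or.inr (Or.inr (Or.inl (h.mul_right hS))))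
  · exact Or.inr (Or.inr (Or.inr (Or.inr (h.mul_right hS))))

end LatticeNormalForm

/-! ### Characters of tori -/

section Characters

/-- Some Fourier coefficient of χ is nonzero, since otherwise the series would give χ(1) = 0.
Translating the integral by y multiplies the n-th coefficient by e^{−2πiny} χ(y), which must
therefore be 1. -/
theorem circle_hom_eq_zpow (χ : Circle →* Circle) (hχ : Continuous χ) :
    ∃ m : ℤ, ∀ z, χ z = z ^ m := by
  have : Fact ((0 : ℝ) < 1) := ⟨one_pos⟩
  let f : C(AddCircle (1 : ℝ), ℂ) :=
    ⟨fun x => (χ (AddCircle.toCircle x) : ℂ),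
      continuous_subtype_val.comp (hχ.comp AddCircle.continuous_toCircle)⟩
  have hf : ∀ x y, f (x + y) = f x * f y := fun x y => by
    simp [f, AddCircle.toCircle_add]
  obtain ⟨n, hn⟩ : ∃ n, fourierCoeff f n ≠ 0 := by
    by_contra! hc
    have h0 : fourierCoeff f = 0 := funext hc
    have h1 := has_pointwise_sum_fourier_series_of_summable (f := f)
      (by rw [h0]; exact summable_zero) 0
    simp only [h0, Pi.zero_apply, zero_smul] at h1
    have h2 := h1.unique hasSum_zero
    simp [f] at h2
  have key : ∀ y, (fourier (-n) y : ℂ) * f y = 1 := fun y => by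
    have h1 : fourierCoeff f n = (fourier (-n) y : ℂ) * f y * fourierCoeff f n := by
      simp only [fourierCoeff]
      rw [← MeasureTheory.integral_const_mul,
        ← MeasureTheory.integral_add_right_eq_self
          (fun t : AddCircle (1 : ℝ) => (fourier (-n) t : ℂ) • f t) y]
      congr 1
      funext t
      rw [hf]
      simp only [fourier_apply, smul_eq_mul, smul_add, AddCircle.toCircle_add, Circle.coe_mul]
      ring
    exact mul_right_cancel₀ hn (by rw [← h1, one_mul])
  refine ⟨n, fun z => ?_⟩
  obtain ⟨x, rfl⟩ := (AddCircle.homeomorphCircle (T := 1) one_ne_zero).surjective z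
  rw [AddCircle.homeomorphCircle_apply, ← AddCircle.toCircle_zsmul]
  have := key x
  rw [fourier_apply, neg_smul, AddCircle.toCircle_neg] at this
  have h2 : (AddCircle.toCircle (n • x))⁻¹ * χ (AddCircle.toCircle x) = 1 := by
    ext; simpa [f] using this
  exact (inv_mul_eq_one.1 h2).symm

theorem zpow_sum_eq_prod {ι : Type*} (z : Circle) (f : ι → ℤ) (s : Finset ι) :
    z ^ ∑ i ∈ s, f i = ∏ i ∈ s, z ^ f i := by
  classical
  induction s using Finset.induction_on with
  | empty => simp
  | insert a s ha ih => rw [Finset.sum_insert ha, Finset.prod_insert ha, zpow_add, ih]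

/-- The endomorphism of the torus `(S¹)ⁿ` given by an integral matrix. -/
noncomputable def charMap {n : ℕ} (A : Matrix (Fin n) (Fin n) ℤ) :
    (Fin n → Circle) →* (Fin n → Circle) where
  toFun z i := ∏ k, z k ^ A i k
  map_one' := by ext; simp
  map_mul' z w := by ext i; simp [mul_zpow, Finset.prod_mul_distrib]

variable {n : ℕ}

theorem charMap_apply (A : Matrix (Fin n) (Fin n) ℤ) (z : Fin n → Circle) (i : Fin n) :
    charMap A z i = ∏ k, z k ^ A i k := rfl

theorem exists_eq_charMap (s : (Fin n → Circle) →* (Fin n → Circle)) (hs : Continuous s) :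
    ∃ A, s = charMap A := by
  have h : ∀ i k, ∃ m : ℤ, ∀ z, s (Pi.mulSingle k z) i = z ^ m := fun i k =>
    circle_hom_eq_zpow (((Pi.evalMonoidHom _ i).comp s).comp (MonoidHom.mulSingle (fun _ => Circle) k))
      ((continuous_apply i).comp (hs.comp ((continuous_const (y := (1 : Fin n → Circle))).update k continuous_id)))
  choose A hA using h
  refine ⟨Matrix.of A, MonoidHom.ext fun z => funext fun i => ?_⟩
  rw [charMap_apply]
  conv_lhs => rw [← Finset.univ_prod_mulSingle z, map_prod, Finset.prod_apply]
  exact Finset.prod_congr rfl fun k _ => hA i k (z k)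

theorem charMap_mul (A B : Matrix (Fin n) (Fin n) ℤ) (z : Fin n → Circle) :
    charMap (A * B) z = charMap A (charMap B z) := by
  funext i
  simp_rw [charMap_apply, ← Finset.prod_zpow, Matrix.mul_apply]
  rw [Finset.prod_comm]
  refine Finset.prod_congr rfl fun k _ => ?_
  simp_rw [← zpow_mul]
  rw [zpow_sum_eq_prod]
  exact Finset.prod_congr rfl fun l _ => by rw [mul_comm]

theorem charMap_one (z : Fin n → Circle) : charMap 1 z = z := by
  funext i
  rw [charMap_apply, Finset.prod_eq_single i (fun k _ hk => by
    rw [Matrix.one_apply_ne hk.symm, zpow_zero]) (by simp)]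
  simp

theorem charMap_surjective {A : Matrix (Fin n) (Fin n) ℤ} (hA : IsUnit A.det) :
    Function.Surjective (charMap A) := fun z =>
  ⟨charMap A⁻¹ z, by rw [← charMap_mul, Matrix.mul_nonsing_inv _ hA, charMap_one]⟩

/-- A prime p dividing the determinant gives a kernel vector modulo p, that is, a nontrivial
p-torsion point in the kernel. -/
theorem isUnit_det_of_charMap {A : Matrix (Fin n) (Fin n) ℤ}
    (h : ∀ z, charMap A z = 1 → z = 1) : IsUnit A.det := by
  by_contra hu
  rw [Int.isUnit_iff_natAbs_eq] at hu
  obtain ⟨p, hp, hdvd⟩ := Nat.exists_prime_and_dvd hu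
  have := Fact.mk hp
  have h0 : (A.map (Int.castRingHom (ZMod p))).det = 0 := by
    rw [← RingHom.mapMatrix_apply, ← RingHom.map_det, eq_intCast,
      ZMod.intCast_zmod_eq_zero_iff_dvd]
    exact Int.natCast_dvd.2 hdvd
  obtain ⟨v, hv, hAv⟩ := Matrix.exists_mulVec_eq_zero_iff.2 h0
  refine hv (funext fun k => ?_)
  have h1 := h (fun k => ZMod.toCircle (v k)) (funext fun i => ?_)
  · exact ZMod.injective_toCircle ((congrFun h1 k).trans (AddChar.map_zero_eq_one _).symm)
  · rw [charMap_apply]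
    simp_rw [← AddChar.map_zsmul_eq_zpow]
    have hsum := map_prod (AddChar.toMonoidHom (ZMod.toCircle (N := p)))
      (fun k => Multiplicative.ofAdd (A i k • v k)) Finset.univ
    simp only [AddChar.toMonoidHom_apply, toAdd_ofAdd, toAdd_prod] at hsum
    rw [← hsum, Pi.one_apply, ← AddChar.map_zero_eq_one (ZMod.toCircle (N := p))]
    congr 1
    have := congrFun hAv i
    simpa [Matrix.mulVec, dotProduct] using this

end Characters

/-! ### Free tori in terms of a standard maximal torus -/

section Abstract

/-- The action of a signed permutation on the torus `(S¹)ⁿ`. -/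
noncomputable def weylAct {n : ℕ} (σ : Equiv.Perm (Fin n)) (ε : Fin n → ℤˣ) :
    (Fin n → Circle) →* (Fin n → Circle) where
  toFun s i := s (σ i) ^ (ε i : ℤ)
  map_one' := by ext; simp
  map_mul' s t := by ext; simp [mul_zpow]

theorem weylAct_apply {n : ℕ} (σ : Equiv.Perm (Fin n)) (ε : Fin n → ℤˣ) (s : Fin n → Circle)
    (i : Fin n) : weylAct σ ε s i = s (σ i) ^ (ε i : ℤ) := rfl

theorem zpow_units_zpow_units {G : Type*} [Group G] (z : G) (c : ℤˣ) :
    (z ^ (c : ℤ)) ^ (c : ℤ) = z := by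
  rw [← zpow_mul, ← Units.val_mul, Int.units_mul_self, Units.val_one, zpow_one]

/-- The transposition that moves `i₀` to the last place. -/
def toLast {n : ℕ} (i₀ : Fin n) : Equiv.Perm (Fin n) :=
  Equiv.swap i₀ ⟨n - 1, by have := i₀.2; omega⟩

theorem toLast_apply_eq_iff {n : ℕ} (i₀ i : Fin n) :
    toLast i₀ i = i₀ ↔ ¬ (i : ℕ) < n - 1 := by
  have h1 : toLast i₀ i = i₀ ↔ i = ⟨n - 1, by have := i₀.2; omega⟩ := by
    rw [toLast, Equiv.swap_apply_eq_iff, Equiv.swap_apply_left]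
  rw [h1, Fin.ext_iff]
  have := i.2
  simp only
  omega

theorem toLast_toLast {n : ℕ} (i₀ i : Fin n) : toLast i₀ (toLast i₀ i) = i :=
  Equiv.swap_apply_self _ _ _

theorem prod_toLast {n : ℕ} (i₀ : Fin n) (f : Fin n → Circle) :
    ∏ j : Fin (n - 1), f (toLast i₀ ⟨j, by omega⟩) = ∏ l ∈ Finset.univ.erase i₀, f l := by
  obtain ⟨m, rfl⟩ : ∃ m, n = m + 1 := ⟨n - 1, by have := i₀.2; omega⟩
  have h1 := Fin.prod_univ_castSucc fun i => f (toLast i₀ i)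
  have h2 : toLast i₀ (Fin.last m) = i₀ := (toLast_apply_eq_iff i₀ _).2 (by simp)
  rw [Equiv.prod_comp, ← Finset.prod_erase_mul _ _ (Finset.mem_univ i₀), h2] at h1
  exact (mul_right_cancel h1).symm

theorem charMap_eq_one {n : ℕ} {A : Matrix (Fin n) (Fin n) ℤ} {i : Fin n}
    (h : ∀ k, A i k = 0) (z : Fin n → Circle) : charMap A z i = 1 := by
  simp [charMap_apply, h]

theorem IsFirstType.exists_param {n : ℕ} {A B : Matrix (Fin n) (Fin n) ℤ}
    (h : IsFirstType A B) : ∃ (σ τ : Equiv.Perm (Fin n)) (ε δ : Fin n → ℤˣ)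
      (θ : (Fin n → Circle) → Circle × (Fin (n - 1) → Circle)), Function.Surjective θ ∧
      ∀ z, (weylAct σ ε (charMap A z), weylAct τ δ (charMap B z)) = paramP1 n (θ z) := by
  obtain ⟨i₀, σ, c, h1, h2, h3⟩ := h
  have h2' : ∀ z, charMap B z (σ i₀) =
      ∏ l ∈ Finset.univ.erase i₀, charMap B z (σ l) ^ (c l : ℤ) := fun z => by
    simp_rw [charMap_apply, h2, zpow_sum_eq_prod, ← Finset.prod_zpow]
    rw [Finset.prod_comm]
    exact Finset.prod_congr rfl fun l _ => Finset.prod_congr rfl fun k _ => by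
      rw [← zpow_mul, mul_comm]
  refine ⟨toLast i₀, (toLast i₀).trans σ, 1,
    -- The signs −c turn the signed sum relation among the rows of B into the condition that the
    -- coordinates have product 1.
    fun i => if toLast i₀ i = i₀ then 1 else - c (toLast i₀ i),
    fun z => (charMap A z i₀, fun j => charMap B z (σ (toLast i₀ ⟨j, by omega⟩)) ^
      (- c (toLast i₀ ⟨j, by omega⟩) : ℤ)), ?_, fun z => Prod.ext ?_ ?_⟩
  · rintro ⟨ζ, w⟩
    obtain ⟨z, hz⟩ := charMap_surjective h3 fun l =>
      appendLast w ζ (toLast i₀ l) ^ (if l = i₀ then 1 else - (c l : ℤ))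
    have hz' : ∀ l, (if l = i₀ then charMap A z l else charMap B z (σ l)) =
        appendLast w ζ (toLast i₀ l) ^ (if l = i₀ then 1 else - (c l : ℤ)) := fun l => by
      rw [← congrFun hz l]
      simp only [charMap_apply, Matrix.of_apply]
      split_ifs <;> rfl
    refine ⟨z, Prod.ext ?_ (funext fun j => ?_)⟩
    · have := hz' i₀
      have h4 : ¬ ((toLast i₀ i₀ : Fin n) : ℕ) < n - 1 := by
        rw [← toLast_apply_eq_iff i₀, toLast_toLast]
      simpa [appendLast, h4] using this
    · have := hz' (toLast i₀ ⟨j, by omega⟩)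
      have h4 : toLast i₀ ⟨j, by omega⟩ ≠ i₀ := by
        rw [Ne, toLast_apply_eq_iff]; simp
      simp only [h4, if_false, toLast_toLast] at this
      simp only [this]
      simp [appendLast, zpow_units_zpow_units]
  · funext i
    simp only [weylAct_apply, paramP1, MonoidHom.coe_mk, OneHom.coe_mk, appendLast]
    by_cases hi : (i : ℕ) < n - 1
    · rw [dif_pos hi, charMap_eq_one (h1 _ (by rw [Ne, toLast_apply_eq_iff]; exact not_not.2 hi))]
      simp
    · rw [dif_neg hi, (toLast_apply_eq_iff i₀ i).2 hi]
      simp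
  · funext i
    simp only [weylAct_apply, paramP1, MonoidHom.coe_mk, OneHom.coe_mk, appendLast,
      Equiv.trans_apply]
    by_cases hi : (i : ℕ) < n - 1
    · have h4 : ¬ toLast i₀ i = i₀ := by rw [toLast_apply_eq_iff]; exact not_not.2 hi
      simp [hi, h4]
    · rw [dif_neg hi, (toLast_apply_eq_iff i₀ i).2 hi, h2',
        ← prod_toLast i₀ fun l => charMap B z (σ l) ^ (c l : ℤ)]
      simp

theorem IsSecondType.exists_param {n : ℕ} {A B : Matrix (Fin n) (Fin n) ℤ}
    (h : IsSecondType A B) : ∃ (σ τ : Equiv.Perm (Fin n)) (ε δ : Fin n → ℤˣ)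
      (θ : (Fin n → Circle) → Circle × (Fin (n - 1) → Circle)), Function.Surjective θ ∧
      ∀ z, (weylAct σ ε (charMap A z), weylAct τ δ (charMap B z)) = paramP2 n (θ z) := by
  obtain ⟨i₀, σ, c, h1, h2, h3⟩ := h
  have h2' : ∀ z i, charMap A z i = charMap A z i₀ ^ (c i : ℤ) := fun z i => by
    simp_rw [charMap_apply, h2 i, ← Finset.prod_zpow, ← zpow_mul]
    exact Finset.prod_congr rfl fun k _ => by rw [mul_comm]
  refine ⟨1, (toLast i₀).trans σ, c, 1,
    fun z => (charMap A z i₀, fun j => charMap B z (σ (toLast i₀ ⟨j, by omega⟩))), ?_,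
    fun z => Prod.ext ?_ ?_⟩
  · rintro ⟨ζ, w⟩
    obtain ⟨z, hz⟩ := charMap_surjective h3 fun l => appendLast w ζ (toLast i₀ l)
    have hz' : ∀ l, (if l = i₀ then charMap A z l else charMap B z (σ l)) =
        appendLast w ζ (toLast i₀ l) := fun l => by
      rw [← congrFun hz l]
      simp only [charMap_apply, Matrix.of_apply]
      split_ifs <;> rfl
    refine ⟨z, Prod.ext ?_ (funext fun j => ?_)⟩
    · have := hz' i₀
      have h4 : ¬ ((toLast i₀ i₀ : Fin n) : ℕ) < n - 1 := by
        rw [← toLast_apply_eq_iff i₀, toLast_toLast]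
      simpa [appendLast, h4] using this
    · have := hz' (toLast i₀ ⟨j, by omega⟩)
      have h4 : toLast i₀ ⟨j, by omega⟩ ≠ i₀ := by
        rw [Ne, toLast_apply_eq_iff]; simp
      simp only [h4, if_false, toLast_toLast] at this
      simp only [this]
      simp [appendLast]
  · funext i
    simp only [weylAct_apply, paramP2, MonoidHom.coe_mk, OneHom.coe_mk, Equiv.Perm.one_apply]
    rw [h2' z i, zpow_units_zpow_units]
  · funext i
    simp only [weylAct_apply, paramP2, MonoidHom.coe_mk, OneHom.coe_mk, appendLast,
      Equiv.trans_apply, Pi.one_apply, Units.val_one, zpow_one]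
    by_cases hi : (i : ℕ) < n - 1
    · rw [dif_pos hi]
    · rw [dif_neg hi, (toLast_apply_eq_iff i₀ i).2 hi, charMap_eq_one h1]

/-! ### Formal properties of freeness and conjugacy -/

section Subgroups

variable {G : Type*} [Group G] {T T' : Subgroup (G × G)}

theorem actsFreely_iff : ActsFreely T ↔ ∀ u ∈ T, ∀ x : G, u.1 * x = x * u.2 → u = 1 := by
  simp only [ActsFreely, biquotientAct, mul_inv_eq_iff_eq_mul]

theorem ActsOnOneSide.actsFreely (h : ActsOnOneSide T) : ActsFreely T := by
  rw [actsFreely_iff]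
  intro u hu x hx
  rcases h with h | h
  · have h2 := h u hu
    rw [h2, mul_one, mul_eq_right] at hx
    exact Prod.ext hx h2
  · have h2 := h u hu
    rw [h2, one_mul, left_eq_mul] at hx
    exact Prod.ext h2 hx

theorem IsConjSubgroup.actsFreely (h : IsConjSubgroup T T') (hT : ActsFreely T) :
    ActsFreely T' := by
  obtain ⟨k, rfl⟩ := h
  rw [actsFreely_iff] at hT ⊢
  rintro _ ⟨u, hu, rfl⟩ x hx
  rw [hT u hu (k.1⁻¹ * x * k.2), map_one]
  simp only [MulEquiv.toMonoidHom_eq_coe, MonoidHom.coe_coe, MulAut.conj_apply, Prod.fst_mul,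
    Prod.snd_mul, Prod.fst_inv, Prod.snd_inv] at hx
  calc u.1 * (k.1⁻¹ * x * k.2) = k.1⁻¹ * (k.1 * u.1 * k.1⁻¹ * x) * k.2 := by group
    _ = _ := by rw [hx]; group

theorem mem_swapSides {u : G × G} : u ∈ swapSides T ↔ (u.2, u.1) ∈ T := by
  constructor
  · rintro ⟨v, hv, rfl⟩; exact hv
  · exact fun h => ⟨_, h, rfl⟩

theorem ActsFreely.swapSides (hT : ActsFreely T) : ActsFreely (swapSides T) := by
  rw [actsFreely_iff] at hT ⊢
  intro u hu x hx
  have := hT _ (mem_swapSides.1 hu) x⁻¹ (by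
    calc u.2 * x⁻¹ = x⁻¹ * (x * u.2) * x⁻¹ := by group
      _ = x⁻¹ * u.1 := by rw [← hx]; group)
  exact Prod.ext (congrArg Prod.snd this) (congrArg Prod.fst this)

theorem IsConjUpToSwap.actsFreely (h : IsConjUpToSwap T T') (hT : ActsFreely T) :
    ActsFreely T' :=
  h.elim (fun h => h.actsFreely hT) fun h => h.actsFreely hT.swapSides

theorem isConjSubgroup_iff : IsConjSubgroup T T' ↔ ∃ k : G × G, ∀ u, u ∈ T' ↔ k⁻¹ * u * k ∈ T := by
  refine exists_congr fun k => ?_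
  have : ∀ u, u ∈ T.map (MulAut.conj k).toMonoidHom ↔ k⁻¹ * u * k ∈ T := fun u => by
    constructor
    · rintro ⟨v, hv, rfl⟩
      simpa [mul_assoc] using hv
    · exact fun h => ⟨_, h, by simp [mul_assoc]⟩
  simp_rw [SetLike.ext_iff, this]

theorem IsConjSubgroup.swapSides_left (h : IsConjSubgroup T (swapSides T')) :
    IsConjSubgroup (swapSides T) T' := by
  obtain ⟨k, hk⟩ := isConjSubgroup_iff.1 h
  exact isConjSubgroup_iff.2 ⟨k.swap, fun u => by
    rw [mem_swapSides]
    exact mem_swapSides.symm.trans (hk (u.2, u.1))⟩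

theorem mapBoth_range {H K : Type*} [Group H] [Group K] (ι : H →* G) (φ : K →* H × H) :
    mapBoth ι φ.range = ((ι.prodMap ι).comp φ).range := by
  rw [mapBoth, MonoidHom.range_comp]

theorem mapBoth_mapBoth {H K : Type*} [Group H] [Group K] (ι : H →* G) (κ : K →* H)
    (S : Subgroup (K × K)) : mapBoth ι (mapBoth κ S) = mapBoth (ι.comp κ) S := by
  rw [mapBoth, mapBoth, mapBoth, Subgroup.map_map]; rfl

theorem mapBoth_id : mapBoth (MonoidHom.id G) T = T := by
  rw [mapBoth]
  exact Subgroup.map_id T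

theorem swapSides_range {K : Type*} [Group K] (φ : K →* G × G) :
    swapSides φ.range = (((MonoidHom.snd G G).prod (MonoidHom.fst G G)).comp φ).range := by
  rw [swapSides, MonoidHom.map_range]; rfl

theorem isConjSubgroup_range {H K : Type*} [Group H] [Group K] {φ : H →* G × G}
    {ψ : K →* G × G} (θ : K → H) (hθ : Function.Surjective θ) (k : G × G)
    (h : ∀ z, ψ z = k * φ (θ z) * k⁻¹) : IsConjSubgroup φ.range ψ.range := by
  refine ⟨k, SetLike.ext fun u => ⟨?_, ?_⟩⟩
  · rintro ⟨z, rfl⟩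
    exact ⟨φ (θ z), ⟨_, rfl⟩, (h z).symm⟩
  · rintro ⟨_, ⟨y, rfl⟩, rfl⟩
    obtain ⟨z, rfl⟩ := hθ y
    exact ⟨z, h z⟩

theorem actsFreely_of_mapBoth {G' : Type*} [Group G'] {j : G →* G'}
    (hj : Function.Injective j) (hT : ActsFreely (mapBoth j T)) : ActsFreely T := by
  rw [actsFreely_iff] at hT ⊢
  intro u hu x hx
  have := hT (j u.1, j u.2) ⟨u, hu, rfl⟩ (j x) (by simp only; rw [← map_mul, hx, map_mul])
  rw [Prod.mk_eq_one, map_eq_one_iff j hj, map_eq_one_iff j hj] at this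
  exact Prod.ext this.1 this.2

end Subgroups

/-! ### Classification relative to a standard torus -/

section Model

variable {G G' : Type*} [Group G] [TopologicalSpace G] [Group G'] {n : ℕ}

/-- `ι` parametrizes a maximal torus of `G`, whose Weyl group contains the even signed permutations
and, after `G` is embedded in `G'` by `j`, consists of all signed permutations. -/
structure IsStandardTorus (ι : (Fin n → Circle) →* G) (j : G →* G') : Prop where
  isEmbedding : Topology.IsEmbedding ι
  injective : Function.Injective j
  exists_conj : ∀ φ : (Fin n → Circle) →* G, Continuous φ →
    ∃ g, ∀ z, ∃ s, φ z = g * ι s * g⁻¹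
  conj_even : ∀ (σ : Equiv.Perm (Fin n)) (ε : Fin n → ℤˣ), ∏ i, ε i = 1 →
    ∃ g, ∀ s, ι (weylAct σ ε s) = g * ι s * g⁻¹
  conj : ∀ (σ : Equiv.Perm (Fin n)) (ε : Fin n → ℤˣ),
    ∃ g, ∀ s, j (ι (weylAct σ ε s)) = g * j (ι s) * g⁻¹
  weyl : ∀ s t g, g * j (ι s) = j (ι t) * g → ∃ σ ε, t = weylAct σ ε s

variable {ι : (Fin n → Circle) →* G} {j : G →* G'}

theorem IsStandardTorus.exists_charMap [IsTopologicalGroup G] (h : IsStandardTorus ι j)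
    (φ : (Fin n → Circle) →* G) (hφ : Continuous φ) :
    ∃ g A, ∀ z, φ z = g * ι (charMap A z) * g⁻¹ := by
  obtain ⟨g, hg⟩ := h.exists_conj φ hφ
  choose s hs using hg
  have hs' : ∀ z, ι (s z) = g⁻¹ * φ z * g := fun z => by rw [hs]; group
  let S : (Fin n → Circle) →* (Fin n → Circle) := MonoidHom.mk' s fun z w =>
    h.isEmbedding.injective (by rw [map_mul, hs', hs', hs', map_mul]; group)
  have hS : Continuous S := by
    rw [h.isEmbedding.continuous_iff]
    have : ι ∘ S = fun z => g⁻¹ * φ z * g := funext hs'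
    rw [this]
    fun_prop
  obtain ⟨A, hA⟩ := exists_eq_charMap S hS
  exact ⟨g, A, fun z => by rw [← hA]; exact hs z⟩

/-- If the sides are conjugate, the n − 1 ones on the left force n − 1 right coordinates to be 1.
The last one is then 1 because their product is 1. -/
theorem IsStandardTorus.actsFreely_paramP1 (h : IsStandardTorus ι j) (hn : 0 < n) :
    ActsFreely (mapBoth (j.comp ι) (paramP1 n).range) := by
  rw [actsFreely_iff]
  rintro _ ⟨_, ⟨⟨z, w⟩, rfl⟩, rfl⟩ x hx
  obtain ⟨σ, ε, hσ⟩ := h.weyl _ _ x hx.symm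
  let last : Fin n := ⟨n - 1, by omega⟩
  have hlt : ∀ i, i ≠ last → (i : ℕ) < n - 1 := fun i hi => by
    have := i.2
    have : (i : ℕ) ≠ n - 1 := fun h => hi (Fin.ext h)
    omega
  have h1 : ∀ i, ((paramP1 n (z, w)).1 i) = (paramP1 n (z, w)).2 (σ i) ^ (ε i : ℤ) :=
    fun i => congrFun hσ i
  have hprod : ∏ i, (paramP1 n (z, w)).2 i = 1 := by
    obtain ⟨m, rfl⟩ : ∃ m, n = m + 1 := ⟨n - 1, by omega⟩
    rw [Fin.prod_univ_castSucc]
    simp [paramP1, appendLast]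
  have h2 : ∀ i, i ≠ last → (paramP1 n (z, w)).2 (σ i) = 1 := fun i hi => by
    have := h1 i
    rw [show (paramP1 n (z, w)).1 i = 1 by simp [paramP1, appendLast, hlt i hi]] at this
    rw [← zpow_units_zpow_units ((paramP1 n (z, w)).2 (σ i)) (ε i), ← this, one_zpow]
  have h3 : (paramP1 n (z, w)).2 (σ last) = 1 := by
    rw [← Equiv.prod_comp σ, Finset.prod_eq_single last (fun b _ hb => h2 b hb) (by simp)]
      at hprod
    exact hprod
  have h4 : ∀ i, (paramP1 n (z, w)).2 (σ i) = 1 := fun i => by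
    by_cases hi : i = last
    · rw [hi, h3]
    · exact h2 i hi
  have h5 : paramP1 n (z, w) = 1 := by
    refine Prod.ext (funext fun i => ?_) (funext fun i => ?_)
    · rw [h1, h4, one_zpow]; rfl
    · rw [← σ.apply_symm_apply i, h4]; rfl
  rw [h5, map_one]

/-- If the sides are conjugate, the coordinate 1 on the right forces z = 1, and then all right
coordinates are 1. -/
theorem IsStandardTorus.actsFreely_paramP2 (h : IsStandardTorus ι j) (hn : 0 < n) :
    ActsFreely (mapBoth (j.comp ι) (paramP2 n).range) := by
  rw [actsFreely_iff]
  rintro _ ⟨_, ⟨⟨z, w⟩, rfl⟩, rfl⟩ x hx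
  obtain ⟨σ, ε, hσ⟩ := h.weyl _ _ x hx.symm
  let last : Fin n := ⟨n - 1, by omega⟩
  have h1 : ∀ i, z = (paramP2 n (z, w)).2 (σ i) ^ (ε i : ℤ) := fun i => congrFun hσ i
  have hz : z = 1 := by
    rw [h1 (σ.symm last), Equiv.apply_symm_apply,
      show (paramP2 n (z, w)).2 last = 1 by simp [paramP2, appendLast, last], one_zpow]
  have h4 : ∀ i, (paramP2 n (z, w)).2 (σ i) = 1 := fun i => by
    rw [← zpow_units_zpow_units ((paramP2 n (z, w)).2 (σ i)) (ε i), ← h1 i, hz, one_zpow]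
  have h5 : paramP2 n (z, w) = 1 := by
    refine Prod.ext (funext fun i => hz) (funext fun i => ?_)
    rw [← σ.apply_symm_apply i, h4]; rfl
  rw [h5, map_one]

/-- The tori that occur in the classification. -/
def IsListed (ι : (Fin n → Circle) →* G) (j : G →* G') (T : Subgroup (G × G)) : Prop :=
  ActsOnOneSide T ∨
    IsConjUpToSwap (mapBoth (j.comp ι) (paramP1 n).range) (mapBoth j T) ∨
    IsConjUpToSwap (mapBoth (j.comp ι) (paramP2 n).range) (mapBoth j T)

theorem IsStandardTorus.actsFreely_of_isListed (h : IsStandardTorus ι j) (hn : 0 < n)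
    {T : Subgroup (G × G)} (hT : IsListed ι j T) : ActsFreely (mapBoth j T) := by
  rcases hT with hT | hT | hT
  · refine ActsOnOneSide.actsFreely (hT.imp ?_ ?_)
    all_goals
      rintro hT _ ⟨u, hu, rfl⟩
      simp [hT u hu]
  · exact hT.actsFreely (h.actsFreely_paramP1 hn)
  · exact hT.actsFreely (h.actsFreely_paramP2 hn)

/-- A pair of conjugates of the standard torus whose matrices are of a known type is conjugate to
the corresponding standard pair. -/
theorem IsStandardTorus.isConjSubgroup (h : IsStandardTorus ι j) {k : ℕ}
    {ψ : (Fin n → Circle) →* G × G} {gL gR : G'} {A B : Matrix (Fin n) (Fin n) ℤ}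
    (hL : ∀ z, j (ψ z).1 = gL * j (ι (charMap A z)) * gL⁻¹)
    (hR : ∀ z, j (ψ z).2 = gR * j (ι (charMap B z)) * gR⁻¹)
    (p : Circle × (Fin k → Circle) →* (Fin n → Circle) × (Fin n → Circle))
    (hp : ∃ (σ τ : Equiv.Perm (Fin n)) (ε δ : Fin n → ℤˣ)
      (θ : (Fin n → Circle) → Circle × (Fin k → Circle)), Function.Surjective θ ∧
      ∀ z, (weylAct σ ε (charMap A z), weylAct τ δ (charMap B z)) = p (θ z)) :
    IsConjSubgroup (mapBoth (j.comp ι) p.range) (mapBoth j ψ.range) := by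
  obtain ⟨σ, τ, ε, δ, θ, hθ, hp⟩ := hp
  obtain ⟨a, ha⟩ := h.conj σ ε
  obtain ⟨b, hb⟩ := h.conj τ δ
  rw [mapBoth_range, mapBoth_range]
  refine isConjSubgroup_range θ hθ (gL * a⁻¹, gR * b⁻¹) fun z => ?_
  refine Prod.ext ?_ ?_
  · simp only [MonoidHom.comp_apply, MonoidHom.prodMap, MonoidHom.prod_apply,
      MonoidHom.coe_fst, MonoidHom.coe_snd, Prod.fst_mul, Prod.fst_inv, hL, ← hp z, ha]
    group
  · simp only [MonoidHom.comp_apply, MonoidHom.prodMap, MonoidHom.prod_apply,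
      MonoidHom.coe_fst, MonoidHom.coe_snd, Prod.snd_mul, Prod.snd_inv, hR, ← hp z, hb]
    group

theorem charMap_zero {z : Fin n → Circle} : charMap 0 z = 1 := by
  funext i; simp [charMap_apply]

/-- Freeness is used only in G and through even Weyl elements; conjugacy to a listed torus is
obtained in G'. -/
theorem IsStandardTorus.isListed [IsTopologicalGroup G] (h : IsStandardTorus ι j) (hn : 3 ≤ n)
    {T : Subgroup (G × G)} (hT : IsTorus n T) (hfree : ActsFreely T) : IsListed ι j T := by
  obtain ⟨φ, hφ, hinj, rfl⟩ := hT
  rw [actsFreely_iff] at hfree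
  obtain ⟨gL, A, hL⟩ := h.exists_charMap ((MonoidHom.fst G G).comp φ) (continuous_fst.comp hφ)
  obtain ⟨gR, B, hR⟩ := h.exists_charMap ((MonoidHom.snd G G).comp φ) (continuous_snd.comp hφ)
  simp only [MonoidHom.comp_apply, MonoidHom.coe_fst, MonoidHom.coe_snd] at hL hR
  have hdet : ∀ (σ : Equiv.Perm (Fin n)) (ε : Fin n → ℤˣ), ∏ i, ε i = 1 →
      IsUnit (Matrix.det (Matrix.of fun i k => B i k + (ε i : ℤ) * (-A) (σ i) k)) := by
    intro σ ε hε
    refine isUnit_det_of_charMap fun z hz => ?_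
    have hw : charMap B z = weylAct σ ε (charMap A z) := by
      funext i
      have := congrFun hz i
      simp only [charMap_apply, Matrix.of_apply, zpow_add, Finset.prod_mul_distrib,
        Matrix.neg_apply, mul_neg, zpow_neg, Finset.prod_inv_distrib, Pi.one_apply,
        mul_inv_eq_one] at this
      simp only [charMap_apply, weylAct_apply, ← Finset.prod_zpow, this, ← zpow_mul]
      exact Finset.prod_congr rfl fun k _ => by rw [mul_comm]
    obtain ⟨g, hg⟩ := h.conj_even σ ε hε
    have := hfree (φ z) ⟨z, rfl⟩ (gL * g⁻¹ * gR⁻¹) (by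
      rw [hL, hR, hw, hg]; group)
    exact hinj (this.trans (map_one φ).symm)
  -- The lattice argument was applied to B and −A. Passing from A to −A inverts all coordinates,
  -- which for SO(2n) with n odd is a conjugation only in O(2n).
  obtain ⟨e, he⟩ := h.conj 1 (fun _ => -1)
  have hneg : ∀ z, charMap (-A) z = weylAct 1 (fun _ => -1) (charMap A z) := fun z => by
    funext i; simp [charMap_apply, weylAct_apply]
  have hL' : ∀ z, j (φ z).1 = (j gL * e⁻¹) * j (ι (charMap (-A) z)) * (j gL * e⁻¹)⁻¹ :=
    fun z => by
      rw [hneg, he, hL, map_mul, map_mul, map_inv]; group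
  have hR' : ∀ z, j (φ z).2 = j gR * j (ι (charMap B z)) * (j gR)⁻¹ := fun z => by
    rw [hR, map_mul, map_mul, map_inv]
  have hswap : ∀ {P : Subgroup (G' × G')},
      IsConjSubgroup P (mapBoth j (((MonoidHom.snd G G).prod (MonoidHom.fst G G)).comp φ).range) →
      IsConjUpToSwap P (mapBoth j φ.range) := fun hP => by
    refine Or.inr (IsConjSubgroup.swapSides_left ?_)
    rw [mapBoth_range] at hP ⊢
    rwa [swapSides_range]
  rcases (uniqueTransversal_of_even hn B (-A) hdet).type with h0 | h0 | (h1 | h1) | (h1 | h1)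
  · refine Or.inl (Or.inl ?_)
    rintro _ ⟨z, rfl⟩
    rw [hR, h0, charMap_zero, map_one, mul_one, mul_inv_cancel]
  · refine Or.inl (Or.inr ?_)
    rintro _ ⟨z, rfl⟩
    rw [hL, neg_eq_zero.1 h0, charMap_zero, map_one, mul_one, mul_inv_cancel]
  · exact Or.inr (Or.inl (hswap (h.isConjSubgroup hR' hL' _ h1.exists_param)))
  · exact Or.inr (Or.inr (hswap (h.isConjSubgroup hR' hL' _ h1.exists_param)))
  · exact Or.inr (Or.inl (Or.inl (h.isConjSubgroup hL' hR' _ h1.exists_param)))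
  · exact Or.inr (Or.inr (Or.inl (h.isConjSubgroup hL' hR' _ h1.exists_param)))

theorem IsStandardTorus.actsFreely_iff_isListed [IsTopologicalGroup G]
    (h : IsStandardTorus ι j) (hn : 3 ≤ n) {T : Subgroup (G × G)} (hT : IsTorus n T) :
    ActsFreely T ↔ IsListed ι j T :=
  ⟨h.isListed hn hT, fun hl =>
    actsFreely_of_mapBoth h.injective (h.actsFreely_of_isListed (by omega) hl)⟩

end Model

end Abstract

/-! ### Simultaneous diagonalization -/

section JointEigenvector

/-- Induction on dim W: unless every operator is scalar on W, an eigenspace of a nonscalar one is a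
smaller nonzero subspace, invariant by commutativity. -/
theorem exists_joint_eigenvector {V K : Type*} [AddCommGroup V] [Module ℂ V]
    [FiniteDimensional ℂ V] (f : K → Module.End ℂ V) (hf : ∀ a b, Commute (f a) (f b))
    (W : Submodule ℂ V) (hW : W ≠ ⊥) (hinv : ∀ a, ∀ w ∈ W, f a w ∈ W) :
    ∃ v ∈ W, v ≠ 0 ∧ ∀ a, ∃ c : ℂ, f a v = c • v := by
  induction h : Module.finrank ℂ W using Nat.strong_induction_on generalizing W with
  | _ d ih =>
  by_cases hs : ∀ a, ∃ c : ℂ, ∀ w ∈ W, f a w = c • w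
  · obtain ⟨v, hv, hv0⟩ := W.ne_bot_iff.1 hW
    exact ⟨v, hv, hv0, fun a => (hs a).imp fun c hc => hc v hv⟩
  push Not at hs
  obtain ⟨a, ha⟩ := hs
  have := Submodule.nontrivial_iff_ne_bot.2 hW
  obtain ⟨c, hc⟩ := Module.End.exists_eigenvalue ((f a).restrict (hinv a))
  obtain ⟨⟨w, hw⟩, hwc, hw0⟩ := hc.exists_hasEigenvector
  rw [Module.End.mem_eigenspace_iff] at hwc
  have hwc' : f a w = c • w := congrArg Subtype.val hwc
  let W' := W ⊓ Module.End.eigenspace (f a) c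
  have hw' : w ∈ W' := ⟨hw, Module.End.mem_eigenspace_iff.2 hwc'⟩
  have hlt : W' < W := by
    refine lt_of_le_of_ne inf_le_left fun he => ?_
    obtain ⟨u, hu, hu'⟩ := ha c
    rw [← he] at hu
    exact hu' (Module.End.mem_eigenspace_iff.1 hu.2)
  obtain ⟨v, hv, hv0⟩ := ih _ (h ▸ Submodule.finrank_lt_finrank_of_lt hlt) W'
    (W'.ne_bot_iff.2 ⟨w, hw', fun h0 => hw0 (Subtype.ext h0)⟩)
    (fun b u hu => ⟨hinv b u hu.1, by
      change f b u ∈ Module.End.eigenspace (f a) c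
      rw [Module.End.mem_eigenspace_iff, ← Module.End.mul_apply, (hf a b).eq,
        Module.End.mul_apply, Module.End.mem_eigenspace_iff.1 hu.2, map_smul]⟩) rfl
  exact ⟨v, hv.1, hv0⟩

end JointEigenvector

section Diagonalization

theorem star_dotProduct_self {D : Type*} [NormedDivisionRing D] [StarRing D] [NormedAlgebra ℝ D]
    {n : ℕ} (hN : ∀ x : D, star x * x = algebraMap ℝ D (‖x‖ ^ 2))
    (v : Fin n → D) : star v ⬝ᵥ v = algebraMap ℝ D (∑ k, ‖v k‖ ^ 2) := by
  simp [dotProduct, hN]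

theorem star_mulVec_dotProduct_mulVec {D : Type*} [NormedDivisionRing D] [StarRing D] {n : ℕ}
    {A : Matrix (Fin n) (Fin n) D} (hA : star A * A = 1)
    (v w : Fin n → D) : star (A *ᵥ v) ⬝ᵥ (A *ᵥ w) = star v ⬝ᵥ w := by
  rw [Matrix.star_mulVec, Matrix.dotProduct_mulVec, Matrix.vecMul_vecMul,
    ← Matrix.star_eq_conjTranspose, hA, Matrix.vecMul_one]

variable {D : Type*} [NormedDivisionRing D] [StarRing D] [NormedAlgebra ℝ D] [StarModule ℝ D]
  [FiniteDimensional ℝ D] {n : ℕ} {K : Type*}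

/-- The vectors orthogonal to the given eigenvectors form an invariant complex subspace, so the
joint eigenvector theorem applies to it. -/
theorem exists_unit_eigenvector (c : ℂ →ₐ[ℝ] D)
    (hN : ∀ x : D, star x * x = algebraMap ℝ D (‖x‖ ^ 2))
    (φ : K → Matrix (Fin n) (Fin n) D) (hφ : ∀ z, star (φ z) * φ z = 1)
    (hcomm : ∀ z w, Commute (φ z) (φ w)) {r : ℕ} (hr : r < n) (v : Fin r → Fin n → D)
    (hv : ∀ i, v i ≠ 0) (hv' : ∀ i z, ∃ a : ℂ, φ z *ᵥ v i = fun k => v i k * c a) :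
    ∃ w : Fin n → D, star w ⬝ᵥ w = 1 ∧ (∀ i, star (v i) ⬝ᵥ w = 0) ∧
      ∀ z, ∃ a : ℂ, φ z *ᵥ w = fun k => w k * c a := by
  -- Scalars act on the right, so that left multiplication by matrices is complex linear even when D
  -- is noncommutative.
  let _ : Module ℂ (Fin n → D) :=
    { smul := fun a w k => w k * c a
      one_smul := fun w => funext fun k => by
        change w k * c 1 = w k; rw [map_one, mul_one]
      mul_smul := fun a b w => funext fun k => by
        change w k * c (a * b) = w k * c b * c a; rw [mul_comm, map_mul, mul_assoc]
      smul_zero := fun a => funext fun k => zero_mul _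
      smul_add := fun a v w => funext fun k => add_mul _ _ _
      add_smul := fun a b w => funext fun k => by
        change w k * c (a + b) = w k * c a + w k * c b; rw [map_add, mul_add]
      zero_smul := fun w => funext fun k => by
        change w k * c 0 = 0; rw [map_zero, mul_zero] }
  have hsmul : ∀ (a : ℂ) (w : Fin n → D), a • w = fun k => w k * c a := fun _ _ => rfl
  have : IsScalarTower ℝ ℂ (Fin n → D) := ⟨fun t a w => by
    rw [hsmul, hsmul]
    funext k
    rw [map_smul, Pi.smul_apply, mul_smul_comm]⟩
  have : FiniteDimensional ℂ (Fin n → D) := Module.Finite.of_restrictScalars_finite ℝ ℂ _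
  let f : K → Module.End ℂ (Fin n → D) := fun z =>
    { toFun := fun w => φ z *ᵥ w
      map_add' := Matrix.mulVec_add _
      map_smul' := fun a w => by
        rw [hsmul, RingHom.id_apply, hsmul]
        funext k
        simp [Matrix.mulVec, dotProduct, Finset.sum_mul, mul_assoc] }
  let W : Submodule ℂ (Fin n → D) :=
    { carrier := {w | ∀ i, star (v i) ⬝ᵥ w = 0}
      add_mem' := fun ha hb i => by rw [dotProduct_add, ha i, hb i, add_zero]
      zero_mem' := fun i => dotProduct_zero _
      smul_mem' := fun a w hw i => by
        have := congrArg (· * c a) (hw i)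
        simpa [hsmul, dotProduct, Finset.sum_mul, mul_assoc] using this }
  have hW : W ≠ ⊥ := by
    let L : (Fin n → D) →ₗ[ℝ] (Fin r → D) :=
      { toFun := fun w i => star (v i) ⬝ᵥ w
        map_add' := fun a b => funext fun i => dotProduct_add _ _ _
        map_smul' := fun t w => funext fun i => dotProduct_smul _ _ _ }
    have hL : LinearMap.ker L ≠ ⊥ := LinearMap.ker_ne_bot_of_finrank_lt (by
      simp only [Module.finrank_pi_fintype, Finset.sum_const, Finset.card_univ, Fintype.card_fin,
        smul_eq_mul]
      exact Nat.mul_lt_mul_of_pos_right hr Module.finrank_pos)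
    obtain ⟨w, hw, hw0⟩ := (Submodule.ne_bot_iff _).1 hL
    exact W.ne_bot_iff.2 ⟨w, fun i => congrFun hw i, hw0⟩
  obtain ⟨w, hw, hw0, hwe⟩ := exists_joint_eigenvector f (fun z z' => LinearMap.ext fun w => by
    change φ z *ᵥ (φ z' *ᵥ w) = φ z' *ᵥ (φ z *ᵥ w)
    rw [Matrix.mulVec_mulVec, Matrix.mulVec_mulVec, (hcomm z z').eq]) W hW (fun z w hw i => by
    obtain ⟨a, ha⟩ := hv' i z
    have h1 : star (φ z *ᵥ v i) ⬝ᵥ (φ z *ᵥ w) = 0 := by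
      rw [star_mulVec_dotProduct_mulVec (hφ z)]; exact hw i
    have ha0 : a ≠ 0 := fun h0 => hv i (by
      have h2 : φ z *ᵥ v i = 0 := by rw [ha, h0]; funext k; simp
      calc v i = star (φ z) *ᵥ (φ z *ᵥ v i) := by
            rw [Matrix.mulVec_mulVec, hφ, Matrix.one_mulVec]
        _ = 0 := by rw [h2, Matrix.mulVec_zero])
    rw [ha] at h1
    have h2 : star (c a) * (star (v i) ⬝ᵥ (φ z *ᵥ w)) = 0 := by
      rw [← h1]; simp [dotProduct, Finset.mul_sum, mul_assoc]
    refine (mul_eq_zero.1 h2).resolve_left fun h => ha0 ?_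
    rw [star_eq_zero] at h
    exact (map_eq_zero c).1 h)
  have hpos : 0 < ∑ k, ‖w k‖ ^ 2 := by
    obtain ⟨k, hk⟩ := Function.ne_iff.1 hw0
    exact Finset.sum_pos' (fun _ _ => by positivity) ⟨k, Finset.mem_univ k, by
      have : 0 < ‖w k‖ := norm_pos_iff.2 hk
      positivity⟩
  refine ⟨(Real.sqrt (∑ k, ‖w k‖ ^ 2))⁻¹ • w, ?_, fun i => ?_, fun z => ?_⟩
  · rw [star_smul, smul_dotProduct, dotProduct_smul, star_dotProduct_self hN, smul_smul,
      Algebra.algebraMap_eq_smul_one, smul_smul]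
    rw [star_trivial, ← mul_inv, Real.mul_self_sqrt hpos.le, inv_mul_cancel₀ hpos.ne', one_smul]
  · rw [dotProduct_smul, hw i, smul_zero]
  · obtain ⟨a, ha⟩ := hwe z
    refine ⟨a, ?_⟩
    rw [Matrix.mulVec_smul, show φ z *ᵥ w = fun k => w k * c a from ha]
    funext k
    simp

theorem exists_orthonormal_eigenvectors (c : ℂ →ₐ[ℝ] D)
    (hN : ∀ x : D, star x * x = algebraMap ℝ D (‖x‖ ^ 2))
    (φ : K → Matrix (Fin n) (Fin n) D) (hφ : ∀ z, star (φ z) * φ z = 1)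
    (hcomm : ∀ z w, Commute (φ z) (φ w)) (r : ℕ) (hr : r ≤ n) :
    ∃ v : Fin r → Fin n → D, (∀ i j, star (v i) ⬝ᵥ v j = if i = j then 1 else 0) ∧
      ∀ i z, ∃ a : ℂ, φ z *ᵥ v i = fun k => v i k * c a := by
  induction r with
  | zero => exact ⟨fun i => i.elim0, fun i => i.elim0, fun i => i.elim0⟩
  | succ r ih =>
    obtain ⟨v, hv, hv'⟩ := ih (by omega)
    obtain ⟨w, hw, hvw, hw'⟩ := exists_unit_eigenvector c hN φ hφ hcomm (by omega) v
      (fun i h0 => by simpa [h0] using hv i i) hv'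
    refine ⟨Fin.cons w v, fun i j => ?_, fun i => ?_⟩
    · refine Fin.cases ?_ (fun i => ?_) i <;> refine Fin.cases ?_ (fun j => ?_) j
      · simpa using hw
      · have : star w ⬝ᵥ v j = star (star (v j) ⬝ᵥ w) := by
          simp [dotProduct]
        simp [this, hvw, (Fin.succ_ne_zero j).symm]
      · simpa using hvw i
      · simpa using hv i j
    · refine Fin.cases ?_ (fun i => ?_) i
      · simpa using hw'
      · simpa using hv' i

/-- A commuting family of unitary matrices over `ℂ` or `ℍ` can be diagonalized with entries in
the unit circle. -/
theorem exists_unitary_diagonalization (c : ℂ →ₐ[ℝ] D) (hc : ∀ a, c (star a) = star (c a))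
    (hN : ∀ x : D, star x * x = algebraMap ℝ D (‖x‖ ^ 2))
    (φ : K → unitary (Matrix (Fin n) (Fin n) D)) (hcomm : ∀ z w, Commute (φ z) (φ w)) :
    ∃ g : unitary (Matrix (Fin n) (Fin n) D), ∀ z, ∃ s : Fin n → Circle,
      (φ z : Matrix (Fin n) (Fin n) D) * g = g * Matrix.diagonal fun i => c (s i) := by
  have hu : ∀ z, star (φ z : Matrix (Fin n) (Fin n) D) * φ z = 1 := fun z =>
    Unitary.star_mul_self_of_mem (φ z).2
  obtain ⟨v, hv, hv'⟩ := exists_orthonormal_eigenvectors c hN (fun z => (φ z).1) hu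
    (fun z w => congrArg Subtype.val (hcomm z w).eq) n le_rfl
  let g : Matrix (Fin n) (Fin n) D := Matrix.of fun k i => v i k
  have hg : star g * g = 1 := by
    ext i j
    rw [Matrix.one_apply, ← hv i j]
    simp [Matrix.mul_apply, dotProduct, g, Matrix.star_apply]
  have hg' : g * star g = 1 := mul_eq_one_comm.1 hg
  refine ⟨⟨g, Unitary.mem_iff.2 ⟨hg, hg'⟩⟩, fun z => ?_⟩
  choose a ha using fun i => hv' i z
  have h1 : (φ z : Matrix (Fin n) (Fin n) D) * g = g * Matrix.diagonal fun i => c (a i) := by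
    ext k i
    rw [Matrix.mul_diagonal]
    exact congrFun (ha i) k
  have hnorm : ∀ i, ‖a i‖ = 1 := fun i => by
    have h2 := star_mulVec_dotProduct_mulVec (hu z) (v i) (v i)
    rw [ha i, hv, if_pos rfl] at h2
    have h3 : star (c (a i)) * (star (v i) ⬝ᵥ v i) * c (a i) = 1 := by
      rw [← h2]; simp [dotProduct, Finset.mul_sum, Finset.sum_mul, mul_assoc]
    rw [hv, if_pos rfl, mul_one, ← hc, ← map_mul, ← map_one c] at h3
    have h4 := c.toRingHom.injective h3
    rw [Complex.star_def, Complex.conj_mul'] at h4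
    have h5 : ‖a i‖ ^ 2 = 1 := by exact_mod_cast h4
    exact (pow_eq_one_iff_of_nonneg (norm_nonneg _) two_ne_zero).1 h5
  exact ⟨fun i => ⟨a i, by simp [Submonoid.unitSphere, hnorm i]⟩, h1⟩

end Diagonalization

/-! ### Normal form of commuting orthogonal matrices -/

section RealNormalForm

variable {m : Type*} [Fintype m] [DecidableEq m] {K : Type*} [CommGroup K]

/-- `x` and `y` are orthonormal and span a plane on which each `φ z` acts by a rotation. -/
def IsRotationPair (φ : K →* Matrix m m ℝ) (x y : m → ℝ) : Prop :=
  x ⬝ᵥ x = 1 ∧ y ⬝ᵥ y = 1 ∧ x ⬝ᵥ y = 0 ∧ ∀ z, ∃ a : Circle,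
    φ z *ᵥ x = (a : ℂ).re • x + (a : ℂ).im • y ∧ φ z *ᵥ y = -(a : ℂ).im • x + (a : ℂ).re • y

theorem exists_ne_zero_orthogonal {m : Type*} [Fintype m] {ι : Type*} [Fintype ι]
    (u : ι → m → ℝ)
    (hcard : Fintype.card ι < Fintype.card m) : ∃ w ≠ 0, ∀ i, u i ⬝ᵥ w = 0 := by
  let L : (m → ℝ) →ₗ[ℝ] (ι → ℝ) :=
    { toFun := fun w i => u i ⬝ᵥ w
      map_add' := fun a b => funext fun i => dotProduct_add _ _ _
      map_smul' := fun t w => funext fun i => dotProduct_smul _ _ _ }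
  have hL : LinearMap.ker L ≠ ⊥ := LinearMap.ker_ne_bot_of_finrank_lt (by
    rwa [Module.finrank_fintype_fun_eq_card, Module.finrank_fintype_fun_eq_card])
  obtain ⟨w, hw, hw0⟩ := (Submodule.ne_bot_iff _).1 hL
  exact ⟨w, hw0, fun i => congrFun hw i⟩

theorem exists_smul_dotProduct_eq_one {m : Type*} [Fintype m] {p : m → ℝ} (hp : p ≠ 0) :
    ∃ t : ℝ, (t • p) ⬝ᵥ (t • p) = 1 := by
  have h : 0 < p ⬝ᵥ p := lt_of_le_of_ne (Finset.sum_nonneg fun i _ => mul_self_nonneg _)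
    (Ne.symm (fun h => hp (dotProduct_self_eq_zero.1 h)))
  refine ⟨(Real.sqrt (p ⬝ᵥ p))⁻¹, ?_⟩
  rw [smul_dotProduct, dotProduct_smul, smul_eq_mul, smul_eq_mul, ← mul_assoc, ← mul_inv,
    Real.mul_self_sqrt h.le, inv_mul_cancel₀ h.ne']

theorem mulVec_dotProduct_mulVec {A : Matrix m m ℝ} (hA : Aᵀ * A = 1) (v w : m → ℝ) :
    (A *ᵥ v) ⬝ᵥ (A *ᵥ w) = v ⬝ᵥ w := by
  rw [Matrix.dotProduct_mulVec, Matrix.vecMul_mulVec, hA, Matrix.vecMul_one]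

/-- Take a joint eigenvector v of the complexification, with eigenvalues c z. The bilinear square q
of v satisfies (c z)² q = q. If q = 0, the real and imaginary parts of v span a rotation plane;
otherwise (c z)² = 1 for all z. -/
theorem exists_rotationPair_or_fixed (hdiv : ∀ z : K, ∃ w, z = w * w) (φ : K →* Matrix m m ℝ)
    (hφ : ∀ z, (φ z)ᵀ * φ z = 1) {ι : Type*} [Fintype ι] (u : ι → m → ℝ)
    (hcard : Fintype.card ι < Fintype.card m)
    (hinv : ∀ z w, (∀ i, u i ⬝ᵥ w = 0) → ∀ i, u i ⬝ᵥ (φ z *ᵥ w) = 0) :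
    (∃ x y, IsRotationPair φ x y ∧ (∀ i, u i ⬝ᵥ x = 0) ∧ ∀ i, u i ⬝ᵥ y = 0) ∨
      ∃ p, p ⬝ᵥ p = 1 ∧ (∀ i, u i ⬝ᵥ p = 0) ∧ ∀ z, φ z *ᵥ p = p := by
  let re : (m → ℂ) → m → ℝ := fun w k => (w k).re
  let im : (m → ℂ) → m → ℝ := fun w k => (w k).im
  have re_smul : ∀ (a : ℂ) w, re (a • w) = a.re • re w - a.im • im w := fun a w => by
    funext k; simp [re, im]
  have im_smul : ∀ (a : ℂ) w, im (a • w) = a.re • im w + a.im • re w := fun a w => by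
    funext k; simp [re, im]
  have re_add : ∀ v w, re (v + w) = re v + re w := fun v w => by funext k; simp [re]
  have im_add : ∀ v w, im (v + w) = im v + im w := fun v w => by funext k; simp [im]
  have hext : ∀ v w, re v = re w → im v = im w → v = w := fun v w h1 h2 =>
    funext fun k => Complex.ext (congrFun h1 k) (congrFun h2 k)
  let f : K → Module.End ℂ (m → ℂ) := fun z =>
    { toFun := fun w k => ⟨(φ z *ᵥ re w) k, (φ z *ᵥ im w) k⟩
      map_add' := fun v w => by
        refine hext _ _ ?_ ?_
        · rw [re_add]; change φ z *ᵥ re (v + w) = φ z *ᵥ re v + φ z *ᵥ re w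
          rw [re_add, Matrix.mulVec_add]
        · rw [im_add]; change φ z *ᵥ im (v + w) = φ z *ᵥ im v + φ z *ᵥ im w
          rw [im_add, Matrix.mulVec_add]
      map_smul' := fun a w => by
        refine hext _ _ ?_ ?_
        · rw [RingHom.id_apply, re_smul]
          change φ z *ᵥ re (a • w) = a.re • (φ z *ᵥ re w) - a.im • (φ z *ᵥ im w)
          rw [re_smul, Matrix.mulVec_sub, Matrix.mulVec_smul, Matrix.mulVec_smul]
        · rw [RingHom.id_apply, im_smul]
          change φ z *ᵥ im (a • w) = a.re • (φ z *ᵥ im w) + a.im • (φ z *ᵥ re w)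
          rw [im_smul, Matrix.mulVec_add, Matrix.mulVec_smul, Matrix.mulVec_smul] }
  have ref : ∀ z w, re (f z w) = φ z *ᵥ re w := fun _ _ => rfl
  have imf : ∀ z w, im (f z w) = φ z *ᵥ im w := fun _ _ => rfl
  have fmul : ∀ z z' w, f z (f z' w) = f (z * z') w := fun z z' w =>
    hext _ _ (by rw [ref, ref, ref, Matrix.mulVec_mulVec, map_mul])
      (by rw [imf, imf, imf, Matrix.mulVec_mulVec, map_mul])
  let W : Submodule ℂ (m → ℂ) :=
    { carrier := {w | ∀ i, u i ⬝ᵥ re w = 0 ∧ u i ⬝ᵥ im w = 0}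
      add_mem' := fun {v w} hv hw i => by
        rw [re_add, im_add, dotProduct_add, dotProduct_add, (hv i).1, (hw i).1, (hv i).2,
          (hw i).2, add_zero, and_self]
      zero_mem' := fun i => ⟨dotProduct_zero _, dotProduct_zero _⟩
      smul_mem' := fun a w hw i => by
        rw [re_smul, im_smul, dotProduct_sub, dotProduct_add, dotProduct_smul, dotProduct_smul,
          dotProduct_smul, dotProduct_smul, (hw i).1, (hw i).2]
        simp }
  have hW : W ≠ ⊥ := by
    obtain ⟨w, hw0, hw⟩ := exists_ne_zero_orthogonal u hcard
    refine W.ne_bot_iff.2 ⟨fun k => w k, fun i => ⟨hw i, dotProduct_zero _⟩, fun h0 => hw0 ?_⟩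
    funext k
    simpa using congrFun h0 k
  obtain ⟨v, hv, hv0, hve⟩ := exists_joint_eigenvector f
    (fun z z' => LinearMap.ext fun w => by
      rw [Module.End.mul_apply, Module.End.mul_apply, fmul, fmul, mul_comm]) W hW
    (fun z w hw i => ⟨hinv z _ (fun i => (hw i).1) i, hinv z _ (fun i => (hw i).2) i⟩)
  choose c hc using hve
  have hre : ∀ z, φ z *ᵥ re v = (c z).re • re v - (c z).im • im v := fun z => by
    rw [← ref, hc, re_smul]
  have him : ∀ z, φ z *ᵥ im v = (c z).re • im v + (c z).im • re v := fun z => by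
    rw [← imf, hc, im_smul]
  have hrr := fun z => mulVec_dotProduct_mulVec (hφ z) (re v) (re v)
  have hri := fun z => mulVec_dotProduct_mulVec (hφ z) (re v) (im v)
  have hii := fun z => mulVec_dotProduct_mulVec (hφ z) (im v) (im v)
  simp only [hre, him, sub_dotProduct, dotProduct_sub, add_dotProduct, dotProduct_add,
    smul_dotProduct, dotProduct_smul, smul_eq_mul, dotProduct_comm (im v) (re v)] at hrr hri hii
  have hne : ¬ (re v = 0 ∧ im v = 0) := fun h0 => hv0 (hext _ _ h0.1 h0.2)
  have haa : 0 ≤ re v ⬝ᵥ re v := Finset.sum_nonneg fun i _ => mul_self_nonneg _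
  have hbb : 0 ≤ im v ⬝ᵥ im v := Finset.sum_nonneg fun i _ => mul_self_nonneg _
  have hpos : 0 < re v ⬝ᵥ re v + im v ⬝ᵥ im v := by
    refine lt_of_le_of_ne (by positivity) fun h0 => hne ⟨?_, ?_⟩
    · exact dotProduct_self_eq_zero.1 (by linarith)
    · exact dotProduct_self_eq_zero.1 (by linarith)
  have hnorm : ∀ z, (c z).re * (c z).re + (c z).im * (c z).im = 1 := fun z => by
    have h1 := hrr z
    have h2 := hii z
    have : ((c z).re * (c z).re + (c z).im * (c z).im) * (re v ⬝ᵥ re v + im v ⬝ᵥ im v) =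
        1 * (re v ⬝ᵥ re v + im v ⬝ᵥ im v) := by linarith
    exact mul_right_cancel₀ hpos.ne' this
  let q : ℂ := ⟨re v ⬝ᵥ re v - im v ⬝ᵥ im v, 2 * (re v ⬝ᵥ im v)⟩
  have hq : ∀ z, c z * c z * q = q := fun z => by
    have h1 := hrr z
    have h2 := hii z
    have h3 := hri z
    apply Complex.ext <;> simp [q] <;> linarith
  by_cases hq0 : q = 0
  · left
    have h1 : re v ⬝ᵥ re v = im v ⬝ᵥ im v := sub_eq_zero.1 (congrArg Complex.re hq0)
    have h2 : re v ⬝ᵥ im v = 0 := by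
      have := congrArg Complex.im hq0
      simpa [q] using this
    have hr0 : re v ≠ 0 := fun h0 => by
      rw [← h1, h0, dotProduct_zero] at hpos; linarith
    obtain ⟨t, ht⟩ := exists_smul_dotProduct_eq_one hr0
    -- The minus sign gives the plane the orientation in which φ z rotates by c z rather than its
    -- conjugate.
    refine ⟨t • re v, (-t) • im v, ⟨ht, ?_, ?_, fun z => ?_⟩, fun i => ?_, fun i => ?_⟩
    · rw [← ht]
      simp only [smul_dotProduct, dotProduct_smul, smul_eq_mul, h1]
      ring
    · simp only [smul_dotProduct, dotProduct_smul, smul_eq_mul, h2]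
      ring
    · have hcn : ‖c z‖ = 1 := by
        rw [← sq_eq_sq₀ (norm_nonneg _) zero_le_one, Complex.sq_norm, Complex.normSq_apply,
          hnorm, one_pow]
      refine ⟨⟨c z, by simp [Submonoid.unitSphere, hcn]⟩, ?_, ?_⟩
      · rw [Matrix.mulVec_smul, hre]
        change _ = (c z).re • _ + (c z).im • _
        module
      · rw [Matrix.mulVec_smul, him]
        change _ = -(c z).im • _ + (c z).re • _
        module
    · rw [dotProduct_smul, (hv i).1, smul_zero]
    · rw [dotProduct_smul, (hv i).2, smul_zero]
  · right
    -- Each element is a square, so its eigenvalue is the square of ±1.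
    have hc1 : ∀ z, c z = 1 := fun z => by
      obtain ⟨w, rfl⟩ := hdiv z
      have h1 : c w * c w = 1 := mul_right_cancel₀ hq0 (by rw [hq, one_mul])
      have h2 : c (w * w) • v = (1 : ℂ) • v := by
        rw [← h1, ← hc, ← fmul, hc, map_smul, hc, smul_smul]
      exact smul_left_injective ℂ hv0 h2
    have hre' : ∀ z, φ z *ᵥ re v = re v := fun z => by
      rw [hre, hc1]; simp
    have him' : ∀ z, φ z *ᵥ im v = im v := fun z => by
      rw [him, hc1]; simp
    by_cases hr : re v = 0
    · obtain ⟨t, ht⟩ := exists_smul_dotProduct_eq_one fun hi => hne ⟨hr, hi⟩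
      exact ⟨_, ht, fun i => by rw [dotProduct_smul, (hv i).2, smul_zero], fun z => by
        rw [Matrix.mulVec_smul, him']⟩
    · obtain ⟨t, ht⟩ := exists_smul_dotProduct_eq_one hr
      exact ⟨_, ht, fun i => by rw [dotProduct_smul, (hv i).1, smul_zero], fun z => by
        rw [Matrix.mulVec_smul, hre']⟩

/-- If only a fixed vector is found, search again orthogonally to it: two fixed vectors form a plane
with rotation angle 0. -/
theorem exists_rotationPair (hdiv : ∀ z : K, ∃ w, z = w * w) (φ : K →* Matrix m m ℝ)
    (hφ : ∀ z, (φ z)ᵀ * φ z = 1) {ι : Type*} [Fintype ι] (u : ι → m → ℝ)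
    (hcard : Fintype.card ι + 2 ≤ Fintype.card m)
    (hinv : ∀ z w, (∀ i, u i ⬝ᵥ w = 0) → ∀ i, u i ⬝ᵥ (φ z *ᵥ w) = 0) :
    ∃ x y, IsRotationPair φ x y ∧ (∀ i, u i ⬝ᵥ x = 0) ∧ ∀ i, u i ⬝ᵥ y = 0 := by
  rcases exists_rotationPair_or_fixed hdiv φ hφ u (by omega) hinv with h | ⟨p, hp1, hpu, hpφ⟩
  · exact h
  have hcard' : Fintype.card (Option ι) < Fintype.card m := by
    rw [Fintype.card_option]; omega
  rcases exists_rotationPair_or_fixed hdiv φ hφ (fun o : Option ι => o.elim p u) hcard'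
    (fun z w hw => by
      rintro (_ | i)
      · have h1 := mulVec_dotProduct_mulVec (hφ z) p w
        rw [hpφ] at h1
        exact h1.trans (hw none)
      · exact hinv z w (fun i => hw (some i)) i) with ⟨x, y, h, hx, hy⟩ | ⟨q, hq1, hqu, hqφ⟩
  · exact ⟨x, y, h, fun i => hx (some i), fun i => hy (some i)⟩
  · exact ⟨p, q, ⟨hp1, hq1, hqu none, fun z => ⟨1, by simp [hpφ], by simp [hqφ]⟩⟩, hpu,
      fun i => hqu (some i)⟩

theorem IsRotationPair.orthogonal {φ : K →* Matrix m m ℝ} (hφ : ∀ z, (φ z)ᵀ * φ z = 1)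
    {x y : m → ℝ} (h : IsRotationPair φ x y) (z : K) {w : m → ℝ} (hx : x ⬝ᵥ w = 0)
    (hy : y ⬝ᵥ w = 0) : x ⬝ᵥ (φ z *ᵥ w) = 0 ∧ y ⬝ᵥ (φ z *ᵥ w) = 0 := by
  obtain ⟨a, h1, h2⟩ := h.2.2.2 z
  have e1 := mulVec_dotProduct_mulVec (hφ z) x w
  have e2 := mulVec_dotProduct_mulVec (hφ z) y w
  rw [h1, hx, add_dotProduct, smul_dotProduct, smul_dotProduct, smul_eq_mul, smul_eq_mul] at e1
  rw [h2, hy, add_dotProduct, smul_dotProduct, smul_dotProduct, smul_eq_mul, smul_eq_mul] at e2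
  have ha : (a : ℂ).re * (a : ℂ).re + (a : ℂ).im * (a : ℂ).im = 1 := by
    rw [← Complex.normSq_apply, Circle.normSq_coe]
  constructor
  · linear_combination (a : ℂ).re * e1 - (a : ℂ).im * e2 - (x ⬝ᵥ (φ z *ᵥ w)) * ha
  · linear_combination (a : ℂ).im * e1 + (a : ℂ).re * e2 - (y ⬝ᵥ (φ z *ᵥ w)) * ha

theorem exists_rotationPairs (hdiv : ∀ z : K, ∃ w, z = w * w) (φ : K →* Matrix m m ℝ)
    (hφ : ∀ z, (φ z)ᵀ * φ z = 1) (r : ℕ) (hr : 2 * r ≤ Fintype.card m) :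
    ∃ x y : Fin r → m → ℝ, (∀ i, IsRotationPair φ (x i) (y i)) ∧
      ∀ i j, i ≠ j → x i ⬝ᵥ x j = 0 ∧ y i ⬝ᵥ y j = 0 ∧ x i ⬝ᵥ y j = 0 := by
  induction r with
  | zero => exact ⟨fun i => i.elim0, fun i => i.elim0, fun i => i.elim0, fun i => i.elim0⟩
  | succ r ih =>
    obtain ⟨x, y, h1, h2⟩ := ih (by omega)
    obtain ⟨x', y', h', hx', hy'⟩ := exists_rotationPair hdiv φ hφ (Sum.elim x y)
      (by rw [Fintype.card_sum, Fintype.card_fin]; omega) (fun z w hw => by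
        have key := fun i => (h1 i).orthogonal hφ z (hw (Sum.inl i)) (hw (Sum.inr i))
        rintro (i | i)
        · exact (key i).1
        · exact (key i).2)
    have hxx := fun i => hx' (Sum.inl i)
    have hyx := fun i => hx' (Sum.inr i)
    have hxy := fun i => hy' (Sum.inl i)
    have hyy := fun i => hy' (Sum.inr i)
    simp only [Sum.elim_inl, Sum.elim_inr] at hxx hyx hxy hyy
    refine ⟨Fin.cons x' x, Fin.cons y' y, fun i => ?_, fun i j => ?_⟩
    · refine Fin.cases ?_ (fun i => ?_) i
      · simpa using h'
      · simpa using h1 i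
    · refine Fin.cases ?_ (fun i => ?_) i <;> refine Fin.cases ?_ (fun j => ?_) j
      · exact fun h => absurd rfl h
      · intro _
        simp only [Fin.cons_zero, Fin.cons_succ]
        rw [dotProduct_comm x' (x j), dotProduct_comm y' (y j), dotProduct_comm x' (y j)]
        exact ⟨hxx j, hyy j, hyx j⟩
      · intro _
        simp only [Fin.cons_zero, Fin.cons_succ]
        exact ⟨hxx i, hyy i, hxy i⟩
      · intro hij
        simpa using h2 i j fun h => hij (by rw [h])

end RealNormalForm

/-! ### The standard torus of `Sp(n)` -/

section WeylGroup

/-- Both cardinalities equal the sum of the entries p i k with a i = b k = c, computed by rows and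
by columns. -/
theorem card_fiber_eq_of_doublyStochastic {m : Type*} [Fintype m] (p : Matrix m m ℝ)
    (hrow : ∀ i, ∑ k, p i k = 1) (hcol : ∀ k, ∑ i, p i k = 1) (a b : m → ℝ)
    (h : ∀ i k, p i k ≠ 0 → a i = b k) (c : ℝ) :
    (Finset.univ.filter fun i => a i = c).card = (Finset.univ.filter fun k => b k = c).card := by
  have h1 : ((Finset.univ.filter fun i => a i = c).card : ℝ) =
      ∑ i, ∑ k, if a i = c then p i k else 0 := by
    rw [Finset.card_eq_sum_ones, Nat.cast_sum, Finset.sum_filter]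
    refine Finset.sum_congr rfl fun i _ => ?_
    split_ifs
    · rw [hrow, Nat.cast_one]
    · simp
  have h2 : ((Finset.univ.filter fun k => b k = c).card : ℝ) =
      ∑ k, ∑ i, if b k = c then p i k else 0 := by
    rw [Finset.card_eq_sum_ones, Nat.cast_sum, Finset.sum_filter]
    refine Finset.sum_congr rfl fun i _ => ?_
    split_ifs
    · rw [hcol, Nat.cast_one]
    · simp
  have h3 : ((Finset.univ.filter fun i => a i = c).card : ℝ) =
      (Finset.univ.filter fun k => b k = c).card := by
    rw [h1, h2, Finset.sum_comm]
    refine Finset.sum_congr rfl fun k _ => Finset.sum_congr rfl fun i _ => ?_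
    by_cases hp : p i k = 0
    · simp [hp]
    · rw [h i k hp]
  exact_mod_cast h3

theorem circle_eq_or_eq_inv {z w : Circle} (h : (z : ℂ).re = (w : ℂ).re) : z = w ∨ z = w⁻¹ := by
  have h1 := Circle.normSq_coe z
  have h2 := Circle.normSq_coe w
  rw [Complex.normSq_apply] at h1 h2
  have h3 : (z : ℂ).im * (z : ℂ).im = (w : ℂ).im * (w : ℂ).im := by rw [h] at h1; linarith
  rcases mul_self_eq_mul_self_iff.1 h3 with h4 | h4
  · exact Or.inl (Circle.ext (Complex.ext h h4))
  · refine Or.inr (Circle.ext (Complex.ext ?_ ?_))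
    · rw [Circle.coe_inv_eq_conj, Complex.conj_re, h]
    · rw [Circle.coe_inv_eq_conj, Complex.conj_im, h4]

theorem exists_weylAct_of_card_eq {n : ℕ} (s t : Fin n → Circle)
    (h : ∀ c : ℝ, (Finset.univ.filter fun i => (t i : ℂ).re = c).card =
      (Finset.univ.filter fun i => (s i : ℂ).re = c).card) : ∃ σ ε, t = weylAct σ ε s := by
  let e : ∀ c : ℝ, {i // (t i : ℂ).re = c} ≃ {i // (s i : ℂ).re = c} := fun c =>
    Fintype.equivOfCardEq (by
      rw [Fintype.card_subtype, Fintype.card_subtype, h])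
  let σ := Equiv.ofFiberEquiv (f := fun i => (t i : ℂ).re) (g := fun i => (s i : ℂ).re) e
  have hσ : ∀ i, (t i : ℂ).re = (s (σ i) : ℂ).re := fun i => (Equiv.ofFiberEquiv_map e i).symm
  have : ∀ i, ∃ ε : ℤˣ, t i = s (σ i) ^ (ε : ℤ) := fun i => by
    rcases circle_eq_or_eq_inv (hσ i) with h | h
    · exact ⟨1, by simpa using h⟩
    · exact ⟨-1, by simpa using h⟩
  choose ε hε using this
  exact ⟨σ, ε, funext hε⟩

theorem circle_zpow_units_re (z : Circle) (ε : ℤˣ) : ((z ^ (ε : ℤ) : Circle) : ℂ).re = (z : ℂ).re := by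
  rcases Int.units_eq_one_or ε with h | h <;> subst h <;> simp

theorem circle_zpow_units_im (z : Circle) (ε : ℤˣ) :
    ((z ^ (ε : ℤ) : Circle) : ℂ).im = (ε : ℤ) * (z : ℂ).im := by
  rcases Int.units_eq_one_or ε with h | h <;> subst h <;> simp

end WeylGroup

section Symplectic

variable {n : ℕ}

/-- The standard torus of `Sp(n)`. -/
noncomputable def torusSp (n : ℕ) : (Fin n → Circle) →* SpGrp n := (uToSp n).comp (diagU n)

theorem coe_torusSp (s : Fin n → Circle) : (torusSp n s : Matrix (Fin n) (Fin n) ℍ[ℝ]) =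
    Matrix.diagonal fun i => Quaternion.ofComplex (s i : ℂ) := by
  change (Matrix.diagonal fun i => (s i : ℂ)).map Quaternion.ofComplex = _
  rw [Matrix.diagonal_map (map_zero _)]

theorem ofComplex_injective : Function.Injective (Quaternion.ofComplex : ℂ →ₐ[ℝ] ℍ[ℝ]) :=
  (Quaternion.ofComplex : ℂ →ₐ[ℝ] ℍ[ℝ]).toRingHom.injective

theorem continuous_ofComplex : Continuous (Quaternion.ofComplex : ℂ →ₐ[ℝ] ℍ[ℝ]) :=
  LinearMap.continuous_of_finiteDimensional (Quaternion.ofComplex : ℂ →ₐ[ℝ] ℍ[ℝ]).toLinearMap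

theorem quaternion_star_mul_self (x : ℍ[ℝ]) : star x * x = algebraMap ℝ ℍ[ℝ] (‖x‖ ^ 2) := by
  rw [Quaternion.star_mul_self, Quaternion.normSq_eq_norm_mul_self, sq]; rfl

theorem quaternion_self_mul_star (x : ℍ[ℝ]) : x * star x = algebraMap ℝ ℍ[ℝ] (‖x‖ ^ 2) := by
  rw [Quaternion.self_mul_star, Quaternion.normSq_eq_norm_mul_self, sq]; rfl

theorem ofComplex_star (a : ℂ) :
    (Quaternion.ofComplex (star a) : ℍ[ℝ]) = star (Quaternion.ofComplex a) := by
  ext <;> simp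

theorem isEmbedding_torusSp : Topology.IsEmbedding (torusSp n) := by
  refine (Continuous.isClosedEmbedding ?_ ?_).isEmbedding
  · refine Continuous.subtype_mk ?_ _
    change Continuous fun s : Fin n → Circle => (torusSp n s : Matrix (Fin n) (Fin n) ℍ[ℝ])
    simp_rw [coe_torusSp]
    refine Continuous.matrix_diagonal (continuous_pi fun i => ?_)
    exact continuous_ofComplex.comp (continuous_subtype_val.comp (continuous_apply i))
  · intro s t h
    have h1 := congrArg Subtype.val h
    rw [coe_torusSp, coe_torusSp, Matrix.diagonal_injective.eq_iff] at h1
    exact funext fun i => Circle.ext (ofComplex_injective (congrFun h1 i))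

instance : StarModule ℝ ℍ[ℝ] := ⟨fun t x => by ext <;> simp⟩

/-- The quaternion `1` or `j`, according to a sign. -/
noncomputable def signQuat (ε : ℤˣ) : ℍ[ℝ] :=
  ⟨if ε = 1 then 1 else 0, 0, if ε = 1 then 0 else 1, 0⟩

theorem signQuat_one : signQuat 1 = 1 := by
  ext <;> simp [signQuat]

theorem signQuat_neg_one_re : (signQuat (-1)).re = 0 := by
  simp [signQuat, show (-1 : ℤˣ) ≠ 1 by decide]

theorem signQuat_neg_one_imI : (signQuat (-1)).imI = 0 := rfl

theorem signQuat_neg_one_imJ : (signQuat (-1)).imJ = 1 := by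
  simp [signQuat, show (-1 : ℤˣ) ≠ 1 by decide]

theorem signQuat_neg_one_imK : (signQuat (-1)).imK = 0 := rfl

theorem signQuat_mul_star (ε : ℤˣ) : signQuat ε * star (signQuat ε) = 1 := by
  rcases Int.units_eq_one_or ε with h | h <;> subst h
  · simp [signQuat_one]
  · ext <;> simp [signQuat_neg_one_re, signQuat_neg_one_imI, signQuat_neg_one_imJ,
      signQuat_neg_one_imK]

theorem signQuat_conj (ε : ℤˣ) (z : Circle) : (signQuat ε : ℍ[ℝ]) * Quaternion.ofComplex (z : ℂ) =
    Quaternion.ofComplex ((z ^ (ε : ℤ) : Circle) : ℂ) * signQuat ε := by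
  rcases Int.units_eq_one_or ε with h | h <;> subst h
  · simp [signQuat_one]
  · rw [Units.val_neg, Units.val_one, zpow_neg_one, Circle.coe_inv_eq_conj]
    ext <;> simp [signQuat_neg_one_re, signQuat_neg_one_imI, signQuat_neg_one_imJ,
      signQuat_neg_one_imK]

/-- A permutation matrix with entries 1 or the quaternion j works, since conjugation by j inverts
unit complex numbers. -/
theorem exists_conj_torusSp (σ : Equiv.Perm (Fin n)) (ε : Fin n → ℤˣ) :
    ∃ g : SpGrp n, ∀ s, torusSp n (weylAct σ ε s) = g * torusSp n s * g⁻¹ := by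
  let g : Matrix (Fin n) (Fin n) ℍ[ℝ] := Matrix.of fun i k => if k = σ i then signQuat (ε i) else 0
  have hg : g * star g = 1 := by
    ext1 i k
    rw [Matrix.mul_apply, Finset.sum_eq_single (σ i) (fun l _ hl => by simp [g, hl]) (by simp)]
    by_cases hik : i = k
    · subst hik; simp [g, Matrix.star_apply, signQuat_mul_star]
    · simp [g, Matrix.star_apply, hik]
  refine ⟨⟨g, Unitary.mem_iff.2 ⟨mul_eq_one_comm.1 hg, hg⟩⟩, fun s => ?_⟩
  rw [eq_mul_inv_iff_mul_eq]
  refine Subtype.ext ?_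
  change (torusSp n (weylAct σ ε s) : Matrix (Fin n) (Fin n) ℍ[ℝ]) * g = g * (torusSp n s).1
  rw [coe_torusSp, coe_torusSp]
  ext1 i k
  rw [Matrix.diagonal_mul, Matrix.mul_diagonal]
  by_cases hk : k = σ i
  · subst hk
    have hgi : g i (σ i) = signQuat (ε i) := if_pos rfl
    rw [hgi, weylAct_apply, signQuat_conj]
  · simp [g, hk]

/-- Adding the relation for the inverses replaces the diagonal entries by twice their real parts,
which are central. The doubly stochastic matrix of squared norms of the entries of g is thus
supported where the real parts agree, so these agree with multiplicity; on the circle they determine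
an element up to inversion. -/
theorem weyl_torusSp (s t : Fin n → Circle) (g : SpGrp n)
    (h : g * torusSp n s = torusSp n t * g) : ∃ σ ε, t = weylAct σ ε s := by
  have h' : g * torusSp n s⁻¹ = torusSp n t⁻¹ * g := by
    rw [map_inv, map_inv, mul_inv_eq_iff_eq_mul, mul_assoc, h, inv_mul_cancel_left]
  have key : ∀ i k, (t i : ℂ).re • (g : Matrix (Fin n) (Fin n) ℍ[ℝ]) i k =
      (s k : ℂ).re • (g : Matrix (Fin n) (Fin n) ℍ[ℝ]) i k := fun i k => by
    have e1 := congrFun (congrFun (congrArg Subtype.val h) i) k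
    have e2 := congrFun (congrFun (congrArg Subtype.val h') i) k
    rw [Submonoid.coe_mul, Submonoid.coe_mul, coe_torusSp, coe_torusSp, Matrix.diagonal_mul,
      Matrix.mul_diagonal] at e1 e2
    have hz : ∀ z : Circle, (Quaternion.ofComplex (z : ℂ) : ℍ[ℝ]) +
        Quaternion.ofComplex ((z⁻¹ : Circle) : ℂ) = algebraMap ℝ ℍ[ℝ] (2 * (z : ℂ).re) := fun z => by
      rw [Circle.coe_inv_eq_conj]
      ext <;> simp [two_mul]
    have e3 := congrArg₂ (· + ·) e1 e2
    simp only [Pi.inv_apply] at e3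
    rw [← mul_add, ← add_mul, hz, hz, ← Algebra.commutes, ← Algebra.smul_def,
      ← Algebra.smul_def, mul_smul, mul_smul] at e3
    exact (smul_right_injective _ (two_ne_zero (α := ℝ)) e3).symm
  have hsum : ∀ v : Fin n → ℍ[ℝ], ∑ k, algebraMap ℝ ℍ[ℝ] (‖v k‖ ^ 2) = 1 →
      ∑ k, ‖v k‖ ^ 2 = 1 := fun v hv => by
    rw [← map_sum, ← map_one (algebraMap ℝ ℍ[ℝ])] at hv
    exact (algebraMap ℝ ℍ[ℝ]).injective hv
  refine exists_weylAct_of_card_eq s t fun c => card_fiber_eq_of_doublyStochastic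
    (Matrix.of fun i k => ‖(g : Matrix (Fin n) (Fin n) ℍ[ℝ]) i k‖ ^ 2) (fun i => ?_) (fun k => ?_)
    (fun i => (t i : ℂ).re) (fun k => (s k : ℂ).re) (fun i k hik => ?_) c
  · refine hsum _ ?_
    have h0 : (g : Matrix (Fin n) (Fin n) ℍ[ℝ]) * star (g : Matrix (Fin n) (Fin n) ℍ[ℝ]) = 1 :=
      Unitary.mul_star_self_of_mem g.2
    have := congrFun (congrFun h0 i) i
    rw [Matrix.mul_apply, Matrix.one_apply_eq] at this
    rw [← this]
    exact Finset.sum_congr rfl fun k _ => (quaternion_self_mul_star _).symm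
  · refine hsum (fun i => (g : Matrix (Fin n) (Fin n) ℍ[ℝ]) i k) ?_
    have h0 : star (g : Matrix (Fin n) (Fin n) ℍ[ℝ]) * (g : Matrix (Fin n) (Fin n) ℍ[ℝ]) = 1 :=
      Unitary.star_mul_self_of_mem g.2
    have := congrFun (congrFun h0 k) k
    rw [Matrix.mul_apply, Matrix.one_apply_eq] at this
    rw [← this]
    exact Finset.sum_congr rfl fun k _ => (quaternion_star_mul_self _).symm
  · have hne : (g : Matrix (Fin n) (Fin n) ℍ[ℝ]) i k ≠ 0 := fun h0 => hik (by simp [h0])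
    exact smul_left_injective ℝ hne (key i k)

theorem isStandardTorus_torusSp (n : ℕ) :
    IsStandardTorus (torusSp n) (MonoidHom.id (SpGrp n)) where
  isEmbedding := isEmbedding_torusSp
  injective := Function.injective_id
  exists_conj φ _ := by
    obtain ⟨g, hg⟩ := exists_unitary_diagonalization (Quaternion.ofComplex : ℂ →ₐ[ℝ] ℍ[ℝ])
      ofComplex_star quaternion_star_mul_self φ
      (fun z w => by rw [commute_iff_eq, ← map_mul, mul_comm, map_mul])
    refine ⟨g, fun z => (hg z).imp fun s hs => ?_⟩
    rw [eq_mul_inv_iff_mul_eq]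
    refine Subtype.ext (hs.trans ?_)
    rw [Submonoid.coe_mul, coe_torusSp]
  conj_even σ ε _ := exists_conj_torusSp σ ε
  conj := exists_conj_torusSp
  weyl s t g := weyl_torusSp s t g

end Symplectic

/-! ### The standard tori of `SO(2n)` and `SO(2n+1)` -/

section Orthogonal

variable {n : ℕ}

theorem card_fiber_eq_of_orthogonal {m : Type*} [Fintype m] [DecidableEq m] {g : Matrix m m ℝ}
    (hg : g * gᵀ = 1) {X X' Y Y' : Matrix m m ℝ} (h : g * X = Y * g) (h' : g * X' = Y' * g)
    {a b : m → ℝ} (hX : X + X' = Matrix.diagonal fun i => 2 * b i)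
    (hY : Y + Y' = Matrix.diagonal fun i => 2 * a i) (c : ℝ) :
    (Finset.univ.filter fun i => a i = c).card = (Finset.univ.filter fun k => b k = c).card := by
  refine card_fiber_eq_of_doublyStochastic (Matrix.of fun i k => g i k ^ 2) (fun i => ?_)
    (fun k => ?_) a b (fun i k hik => ?_) c
  · have := congrFun (congrFun hg i) i
    rw [Matrix.mul_apply, Matrix.one_apply_eq] at this
    rw [← this]
    exact Finset.sum_congr rfl fun k _ => sq _
  · have hg' : gᵀ * g = 1 := mul_eq_one_comm.1 hg
    have := congrFun (congrFun hg' k) k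
    rw [Matrix.mul_apply, Matrix.one_apply_eq] at this
    rw [← this]
    exact Finset.sum_congr rfl fun k _ => sq _
  · have e : g * (X + X') = (Y + Y') * g := by rw [mul_add, add_mul, h, h']
    rw [hX, hY] at e
    have e2 := congrFun (congrFun e i) k
    rw [Matrix.mul_diagonal, Matrix.diagonal_mul, mul_comm] at e2
    have hne : g i k ≠ 0 := fun h0 => hik (by simp [h0])
    have := mul_right_cancel₀ hne e2
    linarith

/-- The rotation matrix with angles given by `s`. -/
noncomputable def rotMatrix (s : Fin n → Circle) : Matrix (Fin n ⊕ Fin n) (Fin n ⊕ Fin n) ℝ :=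
  Matrix.fromBlocks (Matrix.diagonal fun i => (s i : ℂ).re) (-Matrix.diagonal fun i => (s i : ℂ).im)
    (Matrix.diagonal fun i => (s i : ℂ).im) (Matrix.diagonal fun i => (s i : ℂ).re)

theorem realMatrix_diagonal (s : Fin n → Circle) :
    realMatrix n (Matrix.diagonal fun i => (s i : ℂ)) = rotMatrix s := by
  rw [realMatrix, rotMatrix, Matrix.diagonal_map Complex.zero_re,
    Matrix.diagonal_map Complex.zero_im]

theorem rotMatrix_add_inv (s : Fin n → Circle) : rotMatrix s + rotMatrix s⁻¹ =
    Matrix.diagonal fun i => 2 * Sum.elim (fun i => (s i : ℂ).re) (fun i => (s i : ℂ).re) i := by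
  have h1 : ∀ z : Circle, ((z⁻¹ : Circle) : ℂ).re = (z : ℂ).re := fun z => by
    rw [Circle.coe_inv_eq_conj, Complex.conj_re]
  have h2 : ∀ z : Circle, ((z⁻¹ : Circle) : ℂ).im = -(z : ℂ).im := fun z => by
    rw [Circle.coe_inv_eq_conj, Complex.conj_im]
  ext (i | i) (k | k) <;> simp only [rotMatrix, Matrix.add_apply, Matrix.fromBlocks_apply₁₁,
    Matrix.fromBlocks_apply₁₂, Matrix.fromBlocks_apply₂₁, Matrix.fromBlocks_apply₂₂,
    Matrix.diagonal_apply, Matrix.neg_apply, Pi.inv_apply, h1, h2, Sum.elim_inl, Sum.elim_inr,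
    Sum.inl.injEq, Sum.inr.injEq, reduceCtorEq, if_false] <;> split_ifs <;> ring

theorem rotMatrix_injective : Function.Injective (rotMatrix (n := n)) := by
  intro s t h
  rw [rotMatrix, rotMatrix, Matrix.fromBlocks_inj] at h
  obtain ⟨h1, -, h2, -⟩ := h
  rw [Matrix.diagonal_injective.eq_iff] at h1 h2
  exact funext fun i => Circle.ext (Complex.ext (congrFun h1 i) (congrFun h2 i))

theorem continuous_rotMatrix : Continuous (rotMatrix (n := n)) := by
  have h1 : Continuous fun s : Fin n → Circle => Matrix.diagonal fun i => (s i : ℂ).re :=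
    Continuous.matrix_diagonal (continuous_pi fun i =>
      Complex.continuous_re.comp (continuous_subtype_val.comp (continuous_apply i)))
  have h2 : Continuous fun s : Fin n → Circle => Matrix.diagonal fun i => (s i : ℂ).im :=
    Continuous.matrix_diagonal (continuous_pi fun i =>
      Complex.continuous_im.comp (continuous_subtype_val.comp (continuous_apply i)))
  exact Continuous.matrix_fromBlocks h1 h2.neg h2 h1

/-- The orthogonal matrix that realizes a signed permutation of the planes. -/
def weylMatrix (σ : Equiv.Perm (Fin n)) (ε : Fin n → ℤˣ) :
    Matrix (Fin n ⊕ Fin n) (Fin n ⊕ Fin n) ℝ :=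
  Matrix.fromBlocks ((1 : Matrix (Fin n) (Fin n) ℝ).submatrix σ id) 0 0
    (Matrix.diagonal (fun i => ((ε i : ℤ) : ℝ)) * (1 : Matrix (Fin n) (Fin n) ℝ).submatrix σ id)

theorem sign_cast_mul_self (u : ℤˣ) : ((u : ℤ) : ℝ) * ((u : ℤ) : ℝ) = 1 := by
  rw [← Int.cast_mul, ← Units.val_mul, Int.units_mul_self]; simp

theorem submatrix_one_mul_diagonal (σ : Equiv.Perm (Fin n)) (d : Fin n → ℝ) :
    (1 : Matrix (Fin n) (Fin n) ℝ).submatrix σ id * Matrix.diagonal d =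
      Matrix.diagonal (d ∘ σ) * (1 : Matrix (Fin n) (Fin n) ℝ).submatrix σ id := by
  ext i k
  rw [Matrix.mul_diagonal, Matrix.diagonal_mul, Matrix.submatrix_apply, id, Matrix.one_apply]
  split_ifs with h
  · rw [← h]; simp
  · simp

theorem weylMatrix_mul_transpose (σ : Equiv.Perm (Fin n)) (ε : Fin n → ℤˣ) :
    weylMatrix σ ε * (weylMatrix σ ε)ᵀ = 1 := by
  have h : (1 : Matrix (Fin n) (Fin n) ℝ).submatrix σ id *
      ((1 : Matrix (Fin n) (Fin n) ℝ).submatrix σ id)ᵀ = 1 := by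
    rw [Matrix.transpose_submatrix, ← Matrix.submatrix_mul _ _ _ _ _ Function.bijective_id,
      Matrix.transpose_one, Matrix.one_mul, Matrix.submatrix_one_equiv]
  have h2 : Matrix.diagonal (fun i => ((ε i : ℤ) : ℝ)) * Matrix.diagonal (fun i => ((ε i : ℤ) : ℝ))
      = 1 := by
    simp [Matrix.diagonal_mul_diagonal, sign_cast_mul_self]
  have h3 : ∀ E P : Matrix (Fin n) (Fin n) ℝ, P * Pᵀ = 1 → E * Eᵀ = 1 →
      (E * P) * (E * P)ᵀ = 1 := fun E P hP hE => by
    rw [Matrix.transpose_mul, Matrix.mul_assoc, ← Matrix.mul_assoc P, hP, Matrix.one_mul, hE]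
  rw [weylMatrix, Matrix.fromBlocks_transpose, Matrix.fromBlocks_multiply, h,
    h3 _ _ h (by rw [Matrix.diagonal_transpose, h2])]
  simp

theorem det_weylMatrix (σ : Equiv.Perm (Fin n)) (ε : Fin n → ℤˣ) :
    (weylMatrix σ ε).det = ((∏ i, ε i : ℤˣ) : ℤ) := by
  rw [weylMatrix, Matrix.det_fromBlocks_zero₂₁, Matrix.det_mul, Matrix.det_diagonal,
    Matrix.det_permute, Matrix.det_one, mul_one, mul_left_comm, sign_cast_mul_self, mul_one]
  simp

theorem weylMatrix_mul_rotMatrix (σ : Equiv.Perm (Fin n)) (ε : Fin n → ℤˣ) (s : Fin n → Circle) :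
    rotMatrix (weylAct σ ε s) * weylMatrix σ ε = weylMatrix σ ε * rotMatrix s := by
  have hre : (fun i => (weylAct σ ε s i : ℂ).re) = (fun i => (s i : ℂ).re) ∘ σ := by
    funext i; rw [weylAct_apply, circle_zpow_units_re]; rfl
  have h1 : Matrix.diagonal (fun i => (weylAct σ ε s i : ℂ).im) *
      Matrix.diagonal (fun i => ((ε i : ℤ) : ℝ)) =
      Matrix.diagonal ((fun i => (s i : ℂ).im) ∘ σ) := by
    rw [Matrix.diagonal_mul_diagonal]
    congr 1; funext i
    rw [weylAct_apply, circle_zpow_units_im, mul_right_comm, sign_cast_mul_self, one_mul]; rfl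
  have h2 : Matrix.diagonal (fun i => ((ε i : ℤ) : ℝ)) *
      Matrix.diagonal ((fun i => (s i : ℂ).im) ∘ σ) =
      Matrix.diagonal (fun i => (weylAct σ ε s i : ℂ).im) := by
    rw [Matrix.diagonal_mul_diagonal]
    congr 1; funext i
    rw [weylAct_apply, circle_zpow_units_im]; rfl
  have h3 : ∀ d : Fin n → ℝ, Matrix.diagonal d * Matrix.diagonal (fun i => ((ε i : ℤ) : ℝ)) =
      Matrix.diagonal (fun i => ((ε i : ℤ) : ℝ)) * Matrix.diagonal d := fun d => by
    simp_rw [Matrix.diagonal_mul_diagonal, mul_comm]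
  rw [rotMatrix, rotMatrix, weylMatrix, Matrix.fromBlocks_multiply, Matrix.fromBlocks_multiply,
    hre]
  simp only [Matrix.mul_zero, Matrix.zero_mul, add_zero, zero_add, neg_zero, Matrix.mul_neg, Matrix.neg_mul,
    Matrix.mul_assoc, submatrix_one_mul_diagonal]
  rw [← Matrix.mul_assoc (Matrix.diagonal fun i => (weylAct σ ε s i : ℂ).im), h1,
    ← Matrix.mul_assoc _ _ (Matrix.submatrix _ _ _), h3, Matrix.mul_assoc,
    ← Matrix.mul_assoc (Matrix.diagonal fun i => ((ε i : ℤ) : ℝ))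
      (Matrix.diagonal ((fun i => (s i : ℂ).im) ∘ σ)), h2]

theorem card_filter_sum_elim (f : Fin n → ℝ) (c : ℝ) :
    (Finset.univ.filter fun i => Sum.elim f f i = c).card =
      2 * (Finset.univ.filter fun i => f i = c).card := by
  simp only [Finset.card_filter, Fintype.sum_sum_type, Sum.elim_inl, Sum.elim_inr, two_mul]
  rfl

end Orthogonal

section SpecialOrthogonal

instance {m : Type*} [Fintype m] [DecidableEq m] :
    IsTopologicalGroup (Matrix.specialOrthogonalGroup m ℝ) where
  continuous_inv := by
    refine Continuous.subtype_mk ?_ _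
    exact (continuous_subtype_val (p := fun A => A ∈
      Matrix.specialOrthogonalGroup m ℝ)).matrix_transpose

variable {n : ℕ}

/-- The standard torus of `SO(2n)`. -/
noncomputable def torusSOEven (n : ℕ) : (Fin n → Circle) →* SOEvenGrp n :=
  (uToSOEven n).comp (diagU n)

/-- The standard torus of `SO(2n+1)`. -/
noncomputable def torusSOOdd (n : ℕ) : (Fin n → Circle) →* SOOddGrp n :=
  (uToSOOdd n).comp (diagU n)

theorem coe_torusSOEven (s : Fin n → Circle) : (torusSOEven n s).1 = rotMatrix s :=
  realMatrix_diagonal s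

theorem coe_torusSOOdd (s : Fin n → Circle) :
    (torusSOOdd n s).1 = Matrix.fromBlocks (rotMatrix s) 0 0 1 := by
  rw [← coe_torusSOEven]; rfl

theorem isEmbedding_torusSOEven : Topology.IsEmbedding (torusSOEven n) := by
  refine (Continuous.isClosedEmbedding ?_ ?_).isEmbedding
  · refine Continuous.subtype_mk ?_ _
    exact continuous_rotMatrix.congr fun s => (coe_torusSOEven s).symm
  · intro s t h
    have h1 := congrArg Subtype.val h
    rw [coe_torusSOEven, coe_torusSOEven] at h1
    exact rotMatrix_injective h1

theorem isEmbedding_torusSOOdd : Topology.IsEmbedding (torusSOOdd n) := by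
  refine (Continuous.isClosedEmbedding ?_ ?_).isEmbedding
  · refine Continuous.subtype_mk ?_ _
    refine Continuous.congr ?_ fun s => (coe_torusSOOdd s).symm
    exact Continuous.matrix_fromBlocks continuous_rotMatrix continuous_const continuous_const
      continuous_const
  · intro s t h
    have h1 := congrArg Subtype.val h
    rw [coe_torusSOOdd, coe_torusSOOdd, Matrix.fromBlocks_inj] at h1
    exact rotMatrix_injective h1.1

theorem exists_conj_torusSOEven (σ : Equiv.Perm (Fin n)) (ε : Fin n → ℤˣ) (hε : ∏ i, ε i = 1) :
    ∃ g, ∀ s, torusSOEven n (weylAct σ ε s) = g * torusSOEven n s * g⁻¹ := by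
  refine ⟨⟨weylMatrix σ ε, Matrix.mem_specialOrthogonalGroup_iff.2
    ⟨(Matrix.mem_orthogonalGroup_iff _ _).2 (weylMatrix_mul_transpose σ ε), by
      rw [det_weylMatrix, hε]; simp⟩⟩, fun s => ?_⟩
  rw [eq_mul_inv_iff_mul_eq]
  refine Subtype.ext ?_
  rw [Submonoid.coe_mul, Submonoid.coe_mul, coe_torusSOEven, coe_torusSOEven]
  exact weylMatrix_mul_rotMatrix σ ε s

theorem exists_conj_torusOEven (σ : Equiv.Perm (Fin n)) (ε : Fin n → ℤˣ) :
    ∃ g, ∀ s, soEvenToOEven n (torusSOEven n (weylAct σ ε s)) =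
      g * soEvenToOEven n (torusSOEven n s) * g⁻¹ := by
  refine ⟨⟨weylMatrix σ ε, (Matrix.mem_orthogonalGroup_iff _ _).2
    (weylMatrix_mul_transpose σ ε)⟩, fun s => ?_⟩
  rw [eq_mul_inv_iff_mul_eq]
  refine Subtype.ext ?_
  rw [Submonoid.coe_mul, Submonoid.coe_mul]
  change (torusSOEven n (weylAct σ ε s)).1 * _ = _ * (torusSOEven n s).1
  rw [coe_torusSOEven, coe_torusSOEven]
  exact weylMatrix_mul_rotMatrix σ ε s

theorem exists_conj_torusSOOdd (σ : Equiv.Perm (Fin n)) (ε : Fin n → ℤˣ) :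
    ∃ g, ∀ s, torusSOOdd n (weylAct σ ε s) = g * torusSOOdd n s * g⁻¹ := by
  -- The extra diagonal entry corrects the determinant, so odd sign changes are available in
  -- SO(2n+1).
  let d : Matrix Unit Unit ℝ := Matrix.diagonal fun _ => ((∏ i, ε i : ℤˣ) : ℤ)
  have hd : d * dᵀ = 1 := by
    rw [Matrix.diagonal_transpose, Matrix.diagonal_mul_diagonal, ← Matrix.diagonal_one]
    congr 1; funext _; exact sign_cast_mul_self _
  let g : Matrix ((Fin n ⊕ Fin n) ⊕ Unit) ((Fin n ⊕ Fin n) ⊕ Unit) ℝ :=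
    Matrix.fromBlocks (weylMatrix σ ε) 0 0 d
  have hg : g * gᵀ = 1 := by
    simp only [g]
    rw [Matrix.fromBlocks_transpose, Matrix.fromBlocks_multiply, weylMatrix_mul_transpose, hd]
    simp
  have hdet : g.det = 1 := by
    simp only [g, d]
    rw [Matrix.det_fromBlocks_zero₂₁, det_weylMatrix, Matrix.det_unique, Matrix.diagonal_apply_eq,
      sign_cast_mul_self]
  refine ⟨⟨g, Matrix.mem_specialOrthogonalGroup_iff.2
    ⟨(Matrix.mem_orthogonalGroup_iff _ _).2 hg, hdet⟩⟩, fun s => ?_⟩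
  rw [eq_mul_inv_iff_mul_eq]
  refine Subtype.ext ?_
  rw [Submonoid.coe_mul, Submonoid.coe_mul, coe_torusSOOdd, coe_torusSOOdd]
  simp only [g]
  rw [Matrix.fromBlocks_multiply, Matrix.fromBlocks_multiply, weylMatrix_mul_rotMatrix]
  simp

theorem weyl_torusOEven (s t : Fin n → Circle) (g : OEvenGrp n)
    (h : g * soEvenToOEven n (torusSOEven n s) = soEvenToOEven n (torusSOEven n t) * g) :
    ∃ σ ε, t = weylAct σ ε s := by
  have h' : g * soEvenToOEven n (torusSOEven n s⁻¹) =
      soEvenToOEven n (torusSOEven n t⁻¹) * g := by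
    rw [map_inv, map_inv, map_inv, map_inv, mul_inv_eq_iff_eq_mul, mul_assoc, h,
      inv_mul_cancel_left]
  have hm : ∀ s t, g * soEvenToOEven n (torusSOEven n s) = soEvenToOEven n (torusSOEven n t) * g →
      g.1 * rotMatrix s = rotMatrix t * g.1 := fun s t h => by
    have := congrArg Subtype.val h
    rw [Submonoid.coe_mul, Submonoid.coe_mul] at this
    change g.1 * (torusSOEven n s).1 = (torusSOEven n t).1 * g.1 at this
    rwa [coe_torusSOEven, coe_torusSOEven] at this
  refine exists_weylAct_of_card_eq s t fun c => ?_
  have := card_fiber_eq_of_orthogonal ((Matrix.mem_orthogonalGroup_iff _ _).1 g.2) (hm _ _ h)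
    (hm _ _ h') (rotMatrix_add_inv s) (rotMatrix_add_inv t) c
  rw [card_filter_sum_elim, card_filter_sum_elim] at this
  omega

theorem weyl_torusSOOdd (s t : Fin n → Circle) (g : SOOddGrp n)
    (h : g * torusSOOdd n s = torusSOOdd n t * g) : ∃ σ ε, t = weylAct σ ε s := by
  have h' : g * torusSOOdd n s⁻¹ = torusSOOdd n t⁻¹ * g := by
    rw [map_inv, map_inv, mul_inv_eq_iff_eq_mul, mul_assoc, h, inv_mul_cancel_left]
  have hm : ∀ s t, g * torusSOOdd n s = torusSOOdd n t * g →
      g.1 * Matrix.fromBlocks (rotMatrix s) 0 0 1 =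
        Matrix.fromBlocks (rotMatrix t) 0 0 1 * g.1 := fun s t h => by
    have := congrArg Subtype.val h
    rwa [Submonoid.coe_mul, Submonoid.coe_mul, coe_torusSOOdd, coe_torusSOOdd] at this
  have hadd : ∀ s : Fin n → Circle, Matrix.fromBlocks (rotMatrix s) 0 0 (1 : Matrix Unit Unit ℝ) +
      Matrix.fromBlocks (rotMatrix s⁻¹) 0 0 1 = Matrix.diagonal fun i => 2 *
        Sum.elim (Sum.elim (fun i => (s i : ℂ).re) (fun i => (s i : ℂ).re)) (fun _ => 1) i :=
    fun s => by
      rw [Matrix.fromBlocks_add, rotMatrix_add_inv, add_zero, add_zero, ← Matrix.diagonal_one,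
        Matrix.diagonal_add, Matrix.fromBlocks_diagonal]
      congr 1
      funext i
      rcases i with i | i
      · rfl
      · norm_num
  refine exists_weylAct_of_card_eq s t fun c => ?_
  have := card_fiber_eq_of_orthogonal ((Matrix.mem_orthogonalGroup_iff _ _).1
    (Matrix.mem_specialOrthogonalGroup_iff.1 g.2).1) (hm _ _ h) (hm _ _ h') (hadd s) (hadd t) c
  have hc : ∀ f : Fin n ⊕ Fin n → ℝ, (Finset.univ.filter fun i : (Fin n ⊕ Fin n) ⊕ Unit =>
      Sum.elim f (fun _ => 1) i = c).card =
        (Finset.univ.filter fun i => f i = c).card + if (1 : ℝ) = c then 1 else 0 := fun f => by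
    simp only [Finset.card_filter, Fintype.sum_sum_type, Sum.elim_inl, Sum.elim_inr,
      Fintype.sum_unique]
    rfl
  rw [hc, hc, card_filter_sum_elim, card_filter_sum_elim] at this
  omega

theorem circle_exists_sqrt (z : Fin n → Circle) : ∃ w, z = w * w := by
  refine ⟨fun i => Circle.exp (Complex.arg (z i) / 2), funext fun i => ?_⟩
  rw [Pi.mul_apply, ← Circle.exp_add, add_halves, Circle.exp_arg]

end SpecialOrthogonal

/-! ### Conjugation into the standard tori of SO(2n) and SO(2n+1) -/

section SpecialOrthogonalNormalForm

variable {n : ℕ} {K m : Type*} [CommGroup K] [Fintype m] [DecidableEq m]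

theorem exists_orthonormal_mul_rotMatrix (hdiv : ∀ z : K, ∃ w, z = w * w)
    (φ : K →* Matrix m m ℝ) (hφ : ∀ z, (φ z)ᵀ * φ z = 1) (hn : 2 * n ≤ Fintype.card m) :
    ∃ X : Matrix m (Fin n ⊕ Fin n) ℝ, Xᵀ * X = 1 ∧ ∀ z, ∃ s : Fin n → Circle, φ z * X = X * rotMatrix s := by
  obtain ⟨x, y, h1, h2⟩ := exists_rotationPairs hdiv φ hφ n hn
  refine ⟨Matrix.of fun k i => Sum.elim x y i k, ?_, fun z => ?_⟩
  · ext i j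
    change Sum.elim x y i ⬝ᵥ Sum.elim x y j = _
    rcases i with i | i <;> rcases j with j | j <;> simp only [Sum.elim_inl, Sum.elim_inr] <;>
      by_cases hij : i = j
    · subst hij; rw [Matrix.one_apply_eq]; exact (h1 i).1
    · rw [Matrix.one_apply_ne (by simpa using hij)]; exact (h2 i j hij).1
    · subst hij; rw [Matrix.one_apply_ne (by simp)]; exact (h1 i).2.2.1
    · rw [Matrix.one_apply_ne (by simp)]; exact (h2 i j hij).2.2
    · subst hij; rw [Matrix.one_apply_ne (by simp), dotProduct_comm]; exact (h1 i).2.2.1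
    · rw [Matrix.one_apply_ne (by simp), dotProduct_comm]; exact (h2 j i (Ne.symm hij)).2.2
    · subst hij; rw [Matrix.one_apply_eq]; exact (h1 i).2.1
    · rw [Matrix.one_apply_ne (by simpa using hij)]; exact (h2 i j hij).2.1
  · choose s hs using fun i => (h1 i).2.2.2 z
    refine ⟨s, ?_⟩
    ext k i
    change (φ z *ᵥ Sum.elim x y i) k = _
    rw [Matrix.mul_apply, Fintype.sum_sum_type]
    rcases i with i | i
    · rw [Sum.elim_inl, (hs i).1]
      simp [rotMatrix, Matrix.diagonal_apply, mul_comm]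
    · rw [Sum.elim_inr, (hs i).2]
      simp [rotMatrix, Matrix.diagonal_apply, mul_comm]

/-- The line orthogonal to the n rotation planes is invariant, so each element acts on it by ±1, and
each square by 1. -/
theorem exists_orthonormal_fixed (hdiv : ∀ z : K, ∃ w, z = w * w)
    (φ : K →* Matrix m m ℝ) (hφ : ∀ z, (φ z)ᵀ * φ z = 1) (hn : Fintype.card m = 2 * n + 1)
    (X : Matrix m (Fin n ⊕ Fin n) ℝ) (hX : Xᵀ * X = 1) (hs : ∀ z, ∃ R : Matrix (Fin n ⊕ Fin n) (Fin n ⊕ Fin n) ℝ, φ z * X = X * R) :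
    ∃ W : Matrix m Unit ℝ, Wᵀ * W = 1 ∧ Xᵀ * W = 0 ∧ ∀ z, φ z * W = W := by
  obtain ⟨w', hw0, hw'⟩ := exists_ne_zero_orthogonal (fun i k => X k i)
    (by rw [hn]; simp; omega)
  obtain ⟨t, ht⟩ := exists_smul_dotProduct_eq_one hw0
  let W : Matrix m Unit ℝ := Matrix.of fun k _ => t * w' k
  have hW : Wᵀ * W = 1 := by
    ext i j
    exact ht
  have hXW : Xᵀ * W = 0 := by
    ext i j
    change (fun k => X k i) ⬝ᵥ (t • w') = 0
    rw [dotProduct_smul, hw', smul_zero]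
  have hWX : Wᵀ * X = 0 := by
    rw [← Matrix.transpose_transpose X, ← Matrix.transpose_mul, hXW, Matrix.transpose_zero]
  have hc : Fintype.card m = Fintype.card ((Fin n ⊕ Fin n) ⊕ Unit) := by rw [hn]; simp; omega
  have hsum : X * Xᵀ + W * Wᵀ = 1 := by
    rw [← Matrix.fromCols_mul_fromRows, Matrix.mul_eq_one_comm_of_equiv (Fintype.equivOfCardEq hc), Matrix.fromRows_mul_fromCols, hX, hW, hXW, hWX, Matrix.fromBlocks_one]
  have hiso : ∀ z {p q : Type} (A : Matrix m p ℝ) (B : Matrix m q ℝ),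
      (φ z * A)ᵀ * (φ z * B) = Aᵀ * B := fun z p q A B => by
    rw [Matrix.transpose_mul, Matrix.mul_assoc, ← Matrix.mul_assoc (φ z)ᵀ, hφ, Matrix.one_mul]
  have key : ∀ z, φ z * W = W * (Wᵀ * (φ z * W)) := fun z => by
    obtain ⟨R, hR⟩ := hs z
    have hRR : Rᵀ * R = 1 := by
      have := hiso z X X
      rwa [hR, Matrix.transpose_mul, Matrix.mul_assoc, ← Matrix.mul_assoc Xᵀ, hX,
        Matrix.one_mul] at this
    have h0 : Xᵀ * (φ z * W) = 0 := by
      have h1 := hiso z X W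
      rw [hXW, hR, Matrix.transpose_mul, Matrix.mul_assoc] at h1
      rw [← Matrix.one_mul (Xᵀ * _), ← mul_eq_one_comm.1 hRR, Matrix.mul_assoc, h1,
        Matrix.mul_zero]
    calc φ z * W = (X * Xᵀ + W * Wᵀ) * (φ z * W) := by rw [hsum, Matrix.one_mul]
      _ = _ := by rw [Matrix.add_mul, Matrix.mul_assoc, h0, Matrix.mul_zero, zero_add,
        Matrix.mul_assoc]
  refine ⟨W, hW, hXW, fun z => ?_⟩
  obtain ⟨v, rfl⟩ := hdiv z
  set C := Wᵀ * (φ v * W) with hC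
  have hCt : Cᵀ = C := by ext i j; rfl
  have hCC : C * C = 1 := by
    have := hiso v W W
    rwa [key v, ← hC, Matrix.transpose_mul, Matrix.mul_assoc, ← Matrix.mul_assoc Wᵀ, hW,
      Matrix.one_mul, hCt] at this
  rw [map_mul, Matrix.mul_assoc, key v, ← hC, ← Matrix.mul_assoc, key v, ← hC, Matrix.mul_assoc,
    hCC, Matrix.mul_one]

end SpecialOrthogonalNormalForm

section SpecialOrthogonalStandard

variable {n : ℕ}

theorem weylAct_one_involutive (ε : Fin n → ℤˣ) (s : Fin n → Circle) :
    weylAct 1 ε (weylAct 1 ε s) = s := by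
  funext i
  exact zpow_units_zpow_units (s i) (ε i)

theorem det_eq_one_or_neg_one {m : Type*} [Fintype m] [DecidableEq m] {g : Matrix m m ℝ}
    (hg : gᵀ * g = 1) : g.det = 1 ∨ g.det = -1 := by
  have := congrArg Matrix.det hg
  rwa [Matrix.det_mul, Matrix.det_transpose, Matrix.det_one, mul_self_eq_one_iff] at this

theorem coe_transpose_mul_self {m : Type*} [Fintype m] [DecidableEq m]
    (g : Matrix.specialOrthogonalGroup m ℝ) : g.1ᵀ * g.1 = 1 :=
  (Matrix.mem_orthogonalGroup_iff' _ _).1 (Matrix.mem_specialOrthogonalGroup_iff.1 g.2).1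

theorem exists_conj_into_torusSOEven (hn : 0 < n) (φ : (Fin n → Circle) →* SOEvenGrp n) :
    ∃ g, ∀ z, ∃ s, φ z = g * torusSOEven n s * g⁻¹ := by
  obtain ⟨X, hX, hφX⟩ := exists_orthonormal_mul_rotMatrix (n := n) circle_exists_sqrt
    ((Submonoid.subtype _).comp φ) (fun z => coe_transpose_mul_self (φ z))
    (by simp; omega)
  suffices h : ∃ X : Matrix (Fin n ⊕ Fin n) (Fin n ⊕ Fin n) ℝ, Xᵀ * X = 1 ∧ X.det = 1 ∧
      ∀ z, ∃ s : Fin n → Circle, (φ z).1 * X = X * rotMatrix s by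
    obtain ⟨X, hX, hdet, hφX⟩ := h
    refine ⟨⟨X, Matrix.mem_specialOrthogonalGroup_iff.2
      ⟨(Matrix.mem_orthogonalGroup_iff' _ _).2 hX, hdet⟩⟩, fun z => (hφX z).imp fun s hs => ?_⟩
    rw [eq_mul_inv_iff_mul_eq]
    refine Subtype.ext ?_
    rw [Submonoid.coe_mul, Submonoid.coe_mul, coe_torusSOEven]
    exact hs
  rcases det_eq_one_or_neg_one hX with hd | hd
  · exact ⟨X, hX, hd, hφX⟩
  -- Reversing one plane corrects the determinant of the frame at the cost of inverting one angle.
  · let ε : Fin n → ℤˣ := Pi.mulSingle ⟨0, hn⟩ (-1)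
    have hε : ∏ i, ε i = -1 := by
      rw [Finset.prod_pi_mulSingle']; simp
    refine ⟨X * weylMatrix 1 ε, ?_, ?_, fun z => ?_⟩
    · rw [Matrix.transpose_mul, Matrix.mul_assoc, ← Matrix.mul_assoc Xᵀ, hX, Matrix.one_mul]
      exact mul_eq_one_comm.1 (weylMatrix_mul_transpose 1 ε)
    · rw [Matrix.det_mul, hd, det_weylMatrix, hε]; simp
    · obtain ⟨s, hs⟩ := hφX z
      refine ⟨weylAct 1 ε s, ?_⟩
      have h1 := weylMatrix_mul_rotMatrix 1 ε (weylAct 1 ε s)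
      rw [weylAct_one_involutive] at h1
      rw [← Matrix.mul_assoc, Matrix.mul_assoc X, ← h1, ← Matrix.mul_assoc, ← hs]
      rfl

theorem exists_conj_into_torusSOOdd (φ : (Fin n → Circle) →* SOOddGrp n) :
    ∃ g, ∀ z, ∃ s, φ z = g * torusSOOdd n s * g⁻¹ := by
  have hφ := fun z => coe_transpose_mul_self (φ z)
  have hcard : Fintype.card ((Fin n ⊕ Fin n) ⊕ Unit) = 2 * n + 1 := by simp; omega
  obtain ⟨X, hX, hφX⟩ := exists_orthonormal_mul_rotMatrix (n := n) circle_exists_sqrt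
    ((Submonoid.subtype _).comp φ) hφ (by omega)
  obtain ⟨W, hW, hXW, hφW⟩ := exists_orthonormal_fixed circle_exists_sqrt
    ((Submonoid.subtype _).comp φ) hφ hcard X hX fun z => (hφX z).elim fun _ hs => ⟨_, hs⟩
  suffices h : ∃ g : Matrix ((Fin n ⊕ Fin n) ⊕ Unit) ((Fin n ⊕ Fin n) ⊕ Unit) ℝ,
      gᵀ * g = 1 ∧ g.det = 1 ∧ ∀ z, ∃ s : Fin n → Circle,
        (φ z).1 * g = g * Matrix.fromBlocks (rotMatrix s) 0 0 1 by
    obtain ⟨g, hg, hdet, hφg⟩ := h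
    refine ⟨⟨g, Matrix.mem_specialOrthogonalGroup_iff.2
      ⟨(Matrix.mem_orthogonalGroup_iff' _ _).2 hg, hdet⟩⟩, fun z => (hφg z).imp fun s hs => ?_⟩
    rw [eq_mul_inv_iff_mul_eq]
    refine Subtype.ext ?_
    rw [Submonoid.coe_mul, Submonoid.coe_mul, coe_torusSOOdd]
    exact hs
  have hWX : Wᵀ * X = 0 := by
    rw [← Matrix.transpose_transpose X, ← Matrix.transpose_mul, hXW, Matrix.transpose_zero]
  have hg : (Matrix.fromCols X W)ᵀ * Matrix.fromCols X W = 1 := by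
    rw [Matrix.transpose_fromCols, Matrix.fromRows_mul_fromCols, hX, hW, hXW, hWX,
      Matrix.fromBlocks_one]
  have hφg : ∀ z, ∃ s : Fin n → Circle, (φ z).1 * Matrix.fromCols X W =
      Matrix.fromCols X W * Matrix.fromBlocks (rotMatrix s) 0 0 1 := fun z => by
    obtain ⟨s, hs⟩ := hφX z
    refine ⟨s, ?_⟩
    rw [Matrix.mul_fromCols, Matrix.fromCols_mul_fromBlocks, Matrix.mul_zero, Matrix.mul_zero,
      add_zero, zero_add, Matrix.mul_one, ← hs]
    exact congrArg _ (hφW z)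
  rcases det_eq_one_or_neg_one hg with hd | hd
  · exact ⟨_, hg, hd, hφg⟩
  -- In odd dimension the central matrix −1 corrects the determinant.
  · refine ⟨-Matrix.fromCols X W, ?_, ?_, fun z => (hφg z).imp fun s hs => ?_⟩
    · rw [Matrix.transpose_neg, neg_mul_neg, hg]
    · rw [Matrix.det_neg, hd, hcard, pow_succ, pow_mul]; norm_num
    · rw [mul_neg, neg_mul, hs]

theorem isStandardTorus_torusSOEven (hn : 0 < n) :
    IsStandardTorus (torusSOEven n) (soEvenToOEven n) where
  isEmbedding := isEmbedding_torusSOEven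
  injective := fun _ _ h => Subtype.ext (congrArg (fun g : OEvenGrp n => g.1) h)
  exists_conj φ _ := exists_conj_into_torusSOEven hn φ
  conj_even := exists_conj_torusSOEven
  conj := exists_conj_torusOEven
  weyl s t g := weyl_torusOEven s t g

theorem isStandardTorus_torusSOOdd (n : ℕ) :
    IsStandardTorus (torusSOOdd n) (MonoidHom.id (SOOddGrp n)) where
  isEmbedding := isEmbedding_torusSOOdd
  injective := Function.injective_id
  exists_conj φ _ := exists_conj_into_torusSOOdd φ
  conj_even σ ε _ := exists_conj_torusSOOdd σ ε
  conj := exists_conj_torusSOOdd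
  weyl s t g := weyl_torusSOOdd s t g

end SpecialOrthogonalStandard

/-! ### The classification for each group, and transfer along the embeddings of U(n) -/

section Transfer

variable {n : ℕ}

theorem IsTorus.actsFreely_sp_iff (hn : 3 ≤ n) {T : Subgroup (SpGrp n × SpGrp n)}
    (hT : IsTorus n T) : ActsFreely T ↔ ActsOnOneSide T ∨
      IsConjUpToSwap (mapBoth (uToSp n) (torusP1 n)) T ∨
      IsConjUpToSwap (mapBoth (uToSp n) (torusP2 n)) T := by
  have h := (isStandardTorus_torusSp n).actsFreely_iff_isListed hn hT
  rwa [IsListed, mapBoth_id, MonoidHom.id_comp, torusSp, ← mapBoth_mapBoth,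
    ← mapBoth_mapBoth] at h

theorem IsTorus.actsFreely_soEven_iff (hn : 3 ≤ n) {T : Subgroup (SOEvenGrp n × SOEvenGrp n)}
    (hT : IsTorus n T) : ActsFreely T ↔ ActsOnOneSide T ∨
      IsConjUpToSwap (mapBoth (soEvenToOEven n) (mapBoth (uToSOEven n) (torusP1 n)))
        (mapBoth (soEvenToOEven n) T) ∨
      IsConjUpToSwap (mapBoth (soEvenToOEven n) (mapBoth (uToSOEven n) (torusP2 n)))
        (mapBoth (soEvenToOEven n) T) := by
  have h := (isStandardTorus_torusSOEven (by omega)).actsFreely_iff_isListed hn hT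
  rwa [IsListed, torusSOEven, ← mapBoth_mapBoth, ← mapBoth_mapBoth, ← mapBoth_mapBoth,
    ← mapBoth_mapBoth] at h

theorem IsTorus.actsFreely_soOdd_iff (hn : 3 ≤ n) {T : Subgroup (SOOddGrp n × SOOddGrp n)}
    (hT : IsTorus n T) : ActsFreely T ↔ ActsOnOneSide T ∨
      IsConjUpToSwap (mapBoth (uToSOOdd n) (torusP1 n)) T ∨
      IsConjUpToSwap (mapBoth (uToSOOdd n) (torusP2 n)) T := by
  have h := (isStandardTorus_torusSOOdd n).actsFreely_iff_isListed hn hT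
  rwa [IsListed, mapBoth_id, MonoidHom.id_comp, torusSOOdd, ← mapBoth_mapBoth,
    ← mapBoth_mapBoth] at h

theorem exists_conj_diagU (u : UGrp n) : ∃ h s, u = h * diagU n s * h⁻¹ := by
  obtain ⟨h, hh⟩ := exists_unitary_diagonalization (AlgHom.id ℝ ℂ) (fun _ => rfl)
    (fun x => by
      rw [Complex.star_def, Complex.conj_mul']; simp) (fun _ : Unit => u)
    (fun _ _ => Commute.refl _)
  obtain ⟨s, hs⟩ := hh ()
  refine ⟨h, s, ?_⟩
  rw [eq_mul_inv_iff_mul_eq]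
  exact Subtype.ext hs

/-- Unitary matrices are diagonalizable inside U(n), so freeness depends on G only through conjugacy
of diagonal matrices. -/
theorem actsFreely_mapBoth_iff {G : Type*} [Group G] {ι : UGrp n →* G}
    (hι : Function.Injective ι) {S : Subgroup (UGrp n × UGrp n)} :
    ActsFreely (mapBoth ι S) ↔ ∀ h k s t, (h * diagU n s * h⁻¹, k * diagU n t * k⁻¹) ∈ S →
      (∃ g, g * ι (diagU n s) = ι (diagU n t) * g) → s = 1 ∧ t = 1 := by
  have hinj : ∀ (h : UGrp n) s, h * diagU n s * h⁻¹ = 1 → s = 1 := fun h s hs => by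
    rw [mul_inv_eq_one, mul_eq_left] at hs
    have := congrArg Subtype.val hs
    have : Matrix.diagonal (fun i => (s i : ℂ)) = Matrix.diagonal fun _ => 1 := by
      rw [Matrix.diagonal_one]; exact this
    exact funext fun i => Circle.ext (by simpa using congrFun (Matrix.diagonal_injective this) i)
  rw [actsFreely_iff]
  constructor
  · rintro hS h k s t hmem ⟨g, hg⟩
    have := hS _ ⟨_, hmem, rfl⟩ (ι h * g⁻¹ * ι k⁻¹) (by
      simp only [MonoidHom.prodMap_def, MonoidHom.prod_apply, MonoidHom.comp_apply,
        MonoidHom.coe_fst, MonoidHom.coe_snd, map_mul, map_inv]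
      rw [show ι (diagU n s) = g⁻¹ * ι (diagU n t) * g by rw [mul_assoc, ← hg]; group]
      group)
    obtain ⟨h1, h2⟩ := Prod.mk_eq_one.1 this
    exact ⟨hinj h s ((map_eq_one_iff ι hι).1 h1), hinj k t ((map_eq_one_iff ι hι).1 h2)⟩
  · rintro hS _ ⟨⟨u, v⟩, hu, rfl⟩ x hx
    obtain ⟨h, s, rfl⟩ := exists_conj_diagU u
    obtain ⟨k, t, rfl⟩ := exists_conj_diagU v
    obtain ⟨rfl, rfl⟩ := hS h k s t hu ⟨ι k⁻¹ * x⁻¹ * ι h, by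
      simp only [MonoidHom.prodMap_def, MonoidHom.prod_apply, MonoidHom.comp_apply,
        MonoidHom.coe_fst, MonoidHom.coe_snd, map_mul, map_inv] at hx ⊢
      have : ι (diagU n s) = (ι h)⁻¹ * (x * (ι k * ι (diagU n t) * (ι k)⁻¹)) * x⁻¹ * ι h := by
        rw [← hx]; group
      rw [this]; group⟩
    simp

theorem uToSp_injective : Function.Injective (uToSp n) := fun A B h => by
  have h1 : quatMatrix n A.1 = quatMatrix n B.1 := congrArg Subtype.val h
  refine Subtype.ext (Matrix.ext fun i k => ofComplex_injective ?_)
  exact congrFun (congrFun h1 i) k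

theorem realMatrix_injective : Function.Injective (realMatrix n) := fun A B h => by
  rw [realMatrix, realMatrix, Matrix.fromBlocks_inj] at h
  obtain ⟨h1, -, h2, -⟩ := h
  exact Matrix.ext fun i k =>
    Complex.ext (congrFun (congrFun h1 i) k) (congrFun (congrFun h2 i) k)

theorem uToSOEven_injective : Function.Injective (uToSOEven n) := fun _ _ h =>
  Subtype.ext (realMatrix_injective (congrArg Subtype.val h))

theorem continuous_uToSOEven : Continuous (uToSOEven n) := by
  refine Continuous.subtype_mk ?_ _
  have hre : Continuous fun A : UGrp n => A.1.map Complex.re :=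
    continuous_subtype_val.matrix_map Complex.continuous_re
  have him : Continuous fun A : UGrp n => A.1.map Complex.im :=
    continuous_subtype_val.matrix_map Complex.continuous_im
  exact Continuous.matrix_fromBlocks hre him.neg him hre

theorem soEvenToOEven_injective : Function.Injective (soEvenToOEven n) := fun _ _ h =>
  Subtype.ext (congrArg (fun g : OEvenGrp n => g.1) h)

theorem soEvenToSOOdd_injective : Function.Injective (soEvenToSOOdd n) := fun A B h => by
  have h1 : Matrix.fromBlocks A.1 0 0 1 = Matrix.fromBlocks B.1 0 0 1 := congrArg Subtype.val h
  exact Subtype.ext (Matrix.fromBlocks_inj.1 h1).1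

theorem IsStandardTorus.exists_conj_iff {G G' : Type*} [Group G] [TopologicalSpace G] [Group G']
    {ι : (Fin n → Circle) →* G} {j : G →* G'} (h : IsStandardTorus ι j) (s t : Fin n → Circle) :
    (∃ g, g * j (ι s) = j (ι t) * g) ↔ ∃ σ ε, t = weylAct σ ε s := by
  constructor
  · rintro ⟨g, hg⟩
    exact h.weyl s t g hg
  · rintro ⟨σ, ε, rfl⟩
    obtain ⟨g, hg⟩ := h.conj σ ε
    exact ⟨g, by rw [hg, inv_mul_cancel_right]⟩

theorem actsFreely_mapBoth_iff_of_isStandardTorus {G G' : Type*} [Group G] [TopologicalSpace G]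
    [Group G'] {κ : UGrp n →* G} {j : G →* G'} (hκ : Function.Injective κ)
    (h : IsStandardTorus (κ.comp (diagU n)) j) {S : Subgroup (UGrp n × UGrp n)} :
    ActsFreely (mapBoth j (mapBoth κ S)) ↔
      ∀ h k s t, (h * diagU n s * h⁻¹, k * diagU n t * k⁻¹) ∈ S →
        (∃ σ ε, t = weylAct σ ε s) → s = 1 ∧ t = 1 := by
  rw [mapBoth_mapBoth, actsFreely_mapBoth_iff (h.injective.comp hκ)]
  simp only [← h.exists_conj_iff]
  rfl

theorem actsFreely_sp_iff_soOdd (S : Subgroup (UGrp n × UGrp n)) :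
    ActsFreely (mapBoth (uToSp n) S) ↔ ActsFreely (mapBoth (uToSOOdd n) S) := by
  have h1 := actsFreely_mapBoth_iff_of_isStandardTorus uToSp_injective
    (isStandardTorus_torusSp n) (S := S)
  have h2 := actsFreely_mapBoth_iff_of_isStandardTorus
    (soEvenToSOOdd_injective.comp uToSOEven_injective) (isStandardTorus_torusSOOdd n) (S := S)
  rw [mapBoth_id] at h1 h2
  exact h1.trans h2.symm

theorem IsTorus.mapBoth {H G : Type*} [Group H] [TopologicalSpace H] [Group G]
    [TopologicalSpace G] {k : ℕ} {S : Subgroup (H × H)} (hS : IsTorus k S) {κ : H →* G}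
    (hκ : Continuous κ) (hinj : Function.Injective κ) : IsTorus k (mapBoth κ S) := by
  obtain ⟨φ, hφ, hφi, rfl⟩ := hS
  refine ⟨(κ.prodMap κ).comp φ, (hκ.prodMap hκ).comp hφ, (hinj.prodMap hinj).comp hφi, ?_⟩
  rw [MonoidHom.range_comp]; rfl

/-- The criterion for Sp(n) is the one for O(2n). Freeness on SO(2n) is a priori weaker, but by the
classification it makes the torus a listed one, and those are free on O(2n). -/
theorem IsTorus.actsFreely_sp_iff_soEven (hn : 3 ≤ n) {S : Subgroup (UGrp n × UGrp n)}
    (hS : IsTorus n S) :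
    ActsFreely (_root_.mapBoth (uToSp n) S) ↔ ActsFreely (_root_.mapBoth (uToSOEven n) S) := by
  have hs := isStandardTorus_torusSOEven (n := n) (by omega)
  have h1 := actsFreely_mapBoth_iff_of_isStandardTorus uToSp_injective
    (isStandardTorus_torusSp n) (S := S)
  have h2 := actsFreely_mapBoth_iff_of_isStandardTorus uToSOEven_injective hs (S := S)
  rw [mapBoth_id] at h1
  rw [h1, ← h2]
  refine ⟨actsFreely_of_mapBoth soEvenToOEven_injective, fun h => ?_⟩
  exact hs.actsFreely_of_isListed (by omega)
    (hs.isListed hn (hS.mapBoth continuous_uToSOEven uToSOEven_injective) h)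

end Transfer

/-! ### Equivalent actions and conjugate tori -/

section Equivalence

variable {G : Type*} [Group G] [TopologicalSpace G] {T T' : Subgroup (G × G)}

theorem equivalentActions_map (e : G × G ≃ₜ* G × G) {f : G → G} (hf : IsAffineMap f)
    (h : ∀ u x, f (biquotientAct u x) = biquotientAct (e u) (f x)) :
    EquivalentActions T (T.map (e : G × G ≃* G × G).toMonoidHom) := by
  refine ⟨f, hf, { (e : G × G ≃* G × G).subgroupMap T with
    continuous_toFun := (e.continuous.comp continuous_subtype_val).subtype_mk _
    continuous_invFun := ?_ }, fun u x => h u x⟩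
  refine continuous_induced_rng.2 ((e.symm.continuous.comp continuous_subtype_val).congr ?_)
  rintro ⟨_, v, hv, rfl⟩
  change e.symm (e v) = (((e : G × G ≃* G × G).subgroupMap T).symm
    ((e : G × G ≃* G × G).subgroupMap T ⟨v, hv⟩) : G × G)
  rw [MulEquiv.symm_apply_apply]
  exact e.symm_apply_apply v

/-- Conjugation by an element of a topological group. -/
def conjContinuousMulEquiv {H : Type*} [Group H] [TopologicalSpace H] [IsTopologicalGroup H]
    (k : H) : H ≃ₜ* H where
  toMulEquiv := MulAut.conj k
  continuous_toFun := by
    change Continuous fun x => k * x * k⁻¹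
    fun_prop
  continuous_invFun := by
    change Continuous fun x => k⁻¹ * x * k
    fun_prop

theorem IsConjUpToSwap.equivalentActions [IsTopologicalGroup G] (h : IsConjUpToSwap T T') :
    EquivalentActions T T' := by
  rcases h with ⟨k, rfl⟩ | ⟨k, rfl⟩
  · refine equivalentActions_map (conjContinuousMulEquiv k)
      (f := fun x => k.1 * k.2⁻¹ * conjContinuousMulEquiv k.2 x) ⟨_, _, Or.inl fun _ => rfl⟩
      fun u x => ?_
    change k.1 * k.2⁻¹ * (k.2 * (u.1 * x * u.2⁻¹) * k.2⁻¹) =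
      k.1 * u.1 * k.1⁻¹ * (k.1 * k.2⁻¹ * (k.2 * x * k.2⁻¹)) * (k.2 * u.2 * k.2⁻¹)⁻¹
    group
  · rw [swapSides, Subgroup.map_map]
    let s : G × G ≃ₜ* G × G :=
      { (MulEquiv.prodComm : G × G ≃* G × G) with
        continuous_toFun := continuous_swap
        continuous_invFun := continuous_swap }
    refine equivalentActions_map (s.trans (conjContinuousMulEquiv k))
      (f := fun x => k.1 * k.2⁻¹ * (conjContinuousMulEquiv k.2 x)⁻¹) ⟨_, _, Or.inr fun _ => rfl⟩
      fun u x => ?_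
    change k.1 * k.2⁻¹ * (k.2 * (u.1 * x * u.2⁻¹) * k.2⁻¹)⁻¹ =
      k.1 * u.2 * k.1⁻¹ * (k.1 * k.2⁻¹ * (k.2 * x * k.2⁻¹)⁻¹) * (k.2 * u.1 * k.2⁻¹)⁻¹
    group

/-- Two two-sided translations agree only up to a central element: y = 1 identifies the left and
right discrepancies, and their common value commutes with every y. -/
theorem exists_mem_center_of_forall_mul_eq {G : Type*} [Group G] {a p q r s : G}
    (h : ∀ y : G, a * p * y * q⁻¹ = r * (a * y) * s⁻¹) :
    ∃ c ∈ Subgroup.center G, a * p = r * a * c ∧ q = s * c := by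
  have h' : ∀ y, a⁻¹ * r⁻¹ * a * p * y = y * (s⁻¹ * q) := fun y => by
    calc a⁻¹ * r⁻¹ * a * p * y = a⁻¹ * r⁻¹ * (a * p * y * q⁻¹) * q := by group
      _ = _ := by rw [h]; group
  have h1 := h' 1
  rw [mul_one, one_mul] at h1
  refine ⟨s⁻¹ * q, Subgroup.mem_center_iff.2 fun y => ?_, ?_, by group⟩
  · rw [← h', h1]
  · rw [← h1]; group

/-- The second alternative, with the sides exchanged, comes from maps that involve inversion. -/
theorem EquivalentActions.exists_mulEquiv (h : EquivalentActions T T') :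
    ∃ (a : G) (α : G ≃* G) (φ : T ≃* T'),
      (∀ u : T, ∃ c ∈ Subgroup.center G,
        a * α u.1.1 = (φ u).1.1 * a * c ∧ α u.1.2 = (φ u).1.2 * c) ∨
      (∀ u : T, ∃ c ∈ Subgroup.center G,
        a * α u.1.2 = (φ u).1.1 * a * c ∧ α u.1.1 = (φ u).1.2 * c) := by
  obtain ⟨f, ⟨a, α, hf⟩, φ, hφ⟩ := h
  refine ⟨a, α, φ, hf.imp (fun hf u => ?_) fun hf u => ?_⟩
  · refine exists_mem_center_of_forall_mul_eq fun y => ?_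
    obtain ⟨x, rfl⟩ := α.surjective y
    have := hφ u x
    rw [hf, hf, biquotientAct, biquotientAct, map_mul, map_mul, map_inv] at this
    rw [← mul_assoc, ← mul_assoc] at this
    exact this
  · refine exists_mem_center_of_forall_mul_eq fun y => ?_
    obtain ⟨x, hx⟩ := α.surjective y⁻¹
    have := hφ u x
    rw [hf, hf, biquotientAct, biquotientAct, map_mul, map_mul, map_inv, hx, mul_inv_rev,
      mul_inv_rev, inv_inv, inv_inv, ← mul_assoc, ← mul_assoc] at this
    exact this

end Equivalence

/-! ### Comparison of the two actions on Sp(n) -/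

section EquivalenceSp

variable {n : ℕ}

theorem appendLast_one_one : appendLast 1 1 = (1 : Fin n → Circle) := by
  funext i
  rw [appendLast]
  split_ifs <;> rfl

theorem eq_of_torusSp_mem_center {s : Fin n → Circle}
    (h : torusSp n s ∈ Subgroup.center (SpGrp n)) (i k : Fin n) : s i = s k := by
  obtain ⟨g, hg⟩ := exists_conj_torusSp (Equiv.swap i k) (1 : Fin n → ℤˣ)
  have h1 := hg s
  rw [Subgroup.mem_center_iff.1 h, mul_inv_cancel_right] at h1
  have h2 := congrFun (isEmbedding_torusSp.injective h1) k
  rw [weylAct_apply, Equiv.swap_apply_right] at h2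
  simpa using h2

theorem torusSp_const_mem_center {z : Circle} (hz : z * z = 1) :
    torusSp n (fun _ => z) ∈ Subgroup.center (SpGrp n) := by
  have hz' : (z : ℂ) = 1 ∨ (z : ℂ) = -1 := by
    rw [← mul_self_eq_one_iff, ← Circle.coe_mul, hz, Circle.coe_one]
  refine Subgroup.mem_center_iff.2 fun g => Subtype.ext ?_
  rw [Submonoid.coe_mul, Submonoid.coe_mul, coe_torusSp]
  ext1 i k
  rw [Matrix.mul_diagonal, Matrix.diagonal_mul]
  rcases hz' with h | h
  · simp [h]
  · rw [h, map_neg, map_one, mul_neg_one, neg_one_mul]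

theorem mapBoth_torusP1 : mapBoth (uToSp n) (torusP1 n) =
    (((torusSp n).prodMap (torusSp n)).comp (paramP1 n)).range := by
  rw [torusP1, mapBoth_mapBoth, mapBoth_range]; rfl

theorem mapBoth_torusP2 : mapBoth (uToSp n) (torusP2 n) =
    (((torusSp n).prodMap (torusSp n)).comp (paramP2 n)).range := by
  rw [torusP2, mapBoth_mapBoth, mapBoth_range]; rfl

/-- For n = 2 the pair (w, w̄) becomes (w, w) after inverting one coordinate, and (1, z) becomes (z,
1) after exchanging the two. -/
theorem isConjUpToSwap_sp_two :
    IsConjUpToSwap (mapBoth (uToSp 2) (torusP1 2)) (mapBoth (uToSp 2) (torusP2 2)) := by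
  obtain ⟨gL, hL⟩ := exists_conj_torusSp (n := 2) 1 ![1, -1]
  obtain ⟨gR, hR⟩ := exists_conj_torusSp (n := 2) (Equiv.swap 0 1) 1
  right
  rw [mapBoth_torusP1, mapBoth_torusP2, swapSides_range]
  refine isConjSubgroup_range (fun p => (p.2 0, fun _ => p.1))
    (fun p => ⟨(p.2 0, fun _ => p.1), Prod.ext rfl (funext fun i => ?_)⟩) (gL, gR) fun p => ?_
  · rw [show i = 0 from Subsingleton.elim (α := Fin 1) i 0]
  · refine Prod.ext ((congrArg _ (funext fun i => ?_)).trans (hL _))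
      ((congrArg _ (funext fun i => ?_)).trans (hR _))
    · fin_cases i <;> simp [weylAct_apply, paramP1, paramP2, appendLast]
    · fin_cases i <;> simp [weylAct_apply, paramP1, paramP2, appendLast]

/-- In P₂ⁿ a central right component is trivial, because it is constant with last coordinate 1. The
left component is scalar, and an involutive scalar is ±1, hence central. -/
theorem torusSp_mem_center_of_equivalentActions {a p q : SpGrp n} {α : SpGrp n ≃* SpGrp n}
    (hn : 0 < n) {v : SpGrp n × SpGrp n} (hv : v ∈ mapBoth (uToSp n) (torusP2 n)) (hv2 : v * v = 1)
    (h : ∃ c ∈ Subgroup.center (SpGrp n), a * α p = v.1 * a * c ∧ α q = v.2 * c) (hq : q = 1) :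
    p ∈ Subgroup.center (SpGrp n) := by
  rw [mapBoth_torusP2] at hv
  obtain ⟨⟨z, w⟩, rfl⟩ := hv
  obtain ⟨c, hc, h1, h2⟩ := h
  have hc' : c⁻¹ = torusSp n (appendLast w 1) := by
    rw [hq, map_one] at h2
    exact inv_eq_of_mul_eq_one_left h2.symm
  have hw : appendLast w 1 = (1 : Fin n → Circle) := funext fun i => by
    have := eq_of_torusSp_mem_center (hc' ▸ inv_mem hc) i ⟨n - 1, by omega⟩
    rw [this]
    simp [appendLast]
  rw [hw, map_one, inv_eq_one] at hc'
  have hz : z * z = 1 := by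
    have h3 : torusSp n (fun _ => z) * torusSp n (fun _ => z) = 1 := congrArg Prod.fst hv2
    rw [← map_mul, ← map_one (torusSp n)] at h3
    exact congrFun (isEmbedding_torusSp.injective h3) ⟨0, hn⟩
  have hcen := torusSp_const_mem_center (n := n) hz
  have h4 : α p = torusSp n fun _ => z := by
    rw [hc', mul_one] at h1
    exact mul_left_cancel (h1.trans (Subgroup.mem_center_iff.1 hcen a).symm)
  refine Subgroup.mem_center_iff.2 fun g => α.injective ?_
  rw [map_mul, map_mul, h4, Subgroup.mem_center_iff.1 hcen]

/-- On either side, P₁ⁿ contains a noncentral involution whose other component is trivial, contrary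
to the preceding property of P₂ⁿ. -/
theorem not_equivalentActions_sp (hn : 3 ≤ n) :
    ¬ EquivalentActions (mapBoth (uToSp n) (torusP1 n)) (mapBoth (uToSp n) (torusP2 n)) := by
  intro h
  obtain ⟨a, α, φ, h⟩ := h.exists_mulEquiv
  obtain ⟨z, hz1, hz⟩ : ∃ z : Circle, z ≠ 1 ∧ z * z = 1 := by
    refine ⟨Circle.exp Real.pi, fun h => ?_, ?_⟩
    · have := congrArg (fun z : Circle => (z : ℂ)) h
      simp only [Circle.coe_exp, Complex.exp_pi_mul_I, Circle.coe_one] at this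
      norm_num at this
    · rw [← Circle.exp_add, ← two_mul, Circle.exp_two_pi]
  have hsq : ∀ (p : Circle × (Fin (n - 1) → Circle)) (hp : p * p = 1)
      (hmem : ((torusSp n).prodMap (torusSp n)) (paramP1 n p) ∈ mapBoth (uToSp n) (torusP1 n)),
      (φ ⟨_, hmem⟩ : SpGrp n × SpGrp n) * φ ⟨_, hmem⟩ = 1 := fun p hp hmem => by
    rw [← Subgroup.coe_mul, ← map_mul]
    have : (⟨_, hmem⟩ * ⟨_, hmem⟩ : mapBoth (uToSp n) (torusP1 n)) = 1 := by
      refine Subtype.ext ?_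
      rw [Subgroup.coe_mul, ← map_mul, ← map_mul, hp, map_one, map_one]; rfl
    rw [this, map_one]; rfl
  have hmem : ∀ p, ((torusSp n).prodMap (torusSp n)) (paramP1 n p) ∈
      mapBoth (uToSp n) (torusP1 n) := fun p => by
    rw [mapBoth_torusP1]; exact ⟨p, rfl⟩
  rcases h with h | h
  · have hp := torusSp_mem_center_of_equivalentActions (by omega) (φ ⟨_, hmem (z, 1)⟩).2
      (hsq _ (Prod.ext hz (mul_one _)) _) (h _) (by
        change torusSp n (appendLast 1 (∏ j, _)) = 1
        simp [appendLast_one_one])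
    have := eq_of_torusSp_mem_center hp ⟨n - 1, by omega⟩ ⟨0, by omega⟩
    have h0 : 0 < n - 1 := by omega
    simp [paramP1, appendLast, h0] at this
    exact hz1 this
  -- With z = −1, the right component is diag(−1, 1, …, 1, −1). It is noncentral because n ≥ 3; for
  -- n = 2 it would be −1.
  · let w : Fin (n - 1) → Circle := fun i => if (i : ℕ) = 0 then z else 1
    have hw : w * w = 1 := funext fun i => by
      by_cases hi : (i : ℕ) = 0 <;> simp [w, hi, hz]
    have hp := torusSp_mem_center_of_equivalentActions (by omega) (φ ⟨_, hmem (1, w)⟩).2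
      (hsq _ (Prod.ext (mul_one _) hw) _) (h _) (by
        change torusSp n (appendLast 1 1) = 1
        rw [appendLast_one_one, map_one])
    have := eq_of_torusSp_mem_center hp ⟨0, by omega⟩ ⟨1, by omega⟩
    have h0 : 0 < n - 1 := by omega
    have h1 : 1 < n - 1 := by omega
    simp [paramP1, appendLast, h0, h1, w] at this
    exact hz1 this

theorem equivalentActions_sp_iff (hn : 2 ≤ n) :
    EquivalentActions (mapBoth (uToSp n) (torusP1 n)) (mapBoth (uToSp n) (torusP2 n)) ↔
      n = 2 := by
  constructor
  · intro h
    by_contra hne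
    exact not_equivalentActions_sp (by omega) h
  · rintro rfl
    exact isConjUpToSwap_sp_two.equivalentActions

end EquivalenceSp

theorem mainTheorem5 (n : ℕ) :
    -- free `n`-tori on `Sp(n)`
    (3 ≤ n → ∀ T : Subgroup (SpGrp n × SpGrp n), IsTorus n T →
      (ActsFreely T ↔
        ActsOnOneSide T ∨
        IsConjUpToSwap (mapBoth (uToSp n) (torusP1 n)) T ∨
        IsConjUpToSwap (mapBoth (uToSp n) (torusP2 n)) T)) ∧
    -- equivalence of the two actions on `Sp(n)`
    (2 ≤ n →
      (EquivalentActions (mapBoth (uToSp n) (torusP1 n)) (mapBoth (uToSp n) (torusP2 n)) ↔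
        n = 2)) ∧
    -- transfer along the standard embeddings of `U(n)`
    (2 ≤ n → ∀ S : Subgroup (UGrp n × UGrp n), IsTorus n S →
      (ActsFreely (mapBoth (uToSp n) S) ↔ ActsFreely (mapBoth (uToSOOdd n) S))) ∧
    (3 ≤ n → ∀ S : Subgroup (UGrp n × UGrp n), IsTorus n S →
      (ActsFreely (mapBoth (uToSp n) S) ↔ ActsFreely (mapBoth (uToSOEven n) S))) ∧
    -- free `n`-tori on `SO(2n)`
    (3 ≤ n → ∀ T : Subgroup (SOEvenGrp n × SOEvenGrp n), IsTorus n T →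
      (ActsFreely T ↔
        ActsOnOneSide T ∨
        IsConjUpToSwap (mapBoth (soEvenToOEven n) (mapBoth (uToSOEven n) (torusP1 n)))
          (mapBoth (soEvenToOEven n) T) ∨
        IsConjUpToSwap (mapBoth (soEvenToOEven n) (mapBoth (uToSOEven n) (torusP2 n)))
          (mapBoth (soEvenToOEven n) T))) ∧
    -- free `n`-tori on `SO(2n+1)`
    (3 ≤ n → ∀ T : Subgroup (SOOddGrp n × SOOddGrp n), IsTorus n T →
      (ActsFreely T ↔
        ActsOnOneSide T ∨
        IsConjUpToSwap (mapBoth (uToSOOdd n) (torusP1 n)) T ∨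
        IsConjUpToSwap (mapBoth (uToSOOdd n) (torusP2 n)) T)) := by
  exact ⟨fun hn _ hT => hT.actsFreely_sp_iff hn, equivalentActions_sp_iff,
    fun _ S _ => actsFreely_sp_iff_soOdd S, fun hn _ hS => hS.actsFreely_sp_iff_soEven hn,
    fun hn _ hT => hT.actsFreely_soEven_iff hn, fun hn _ hT => hT.actsFreely_soOdd_iff hn⟩
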